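/- Let $B_r\subset\mathbb R^2$ be the disc of radius $r$ about the origin. Let $\sigma_a,\lambda_a,\omega>0$, $\kappa=(\sigma_a\lambda_a)^{-1/2}$, and let $\Pi(x)=|x|^{-2}xx^{t}$. For $1<R<2$ define the truncated cloak on $B_3$ by $$(\sigma_R,\lambda_R)=\begin{cases}(\sigma_a I,\ \lambda_a), & |x|\le R,\\ \Big(\tfrac{|x|-1}{|x|}\Pi(x)+\tfrac{|x|}{|x|-1}(I-\Pi(x)),\ \tfrac{|x|}{4(|x|-1)}\Big), & R<|x|\le 2,\\ (I,\ 1), & 2<|x|\le 3.\end{cases}$$ Let $p=\kappa^{-2}\sum_{|\alpha|\le N}q_\alpha\partial^\alpha\delta_0$ with $N\ge 0$ and $q_\alpha\in\mathbb C$. Assume that $\omega$ is non-resonant: for every $n\in\mathbb Z$, $$\sigma_a\kappa\omega J_{|n|}'(\kappa\omega)+|n|J_{|n|}(\kappa\omega)\neq 0\quad\text{and}\quad J_{|n|}(3\omega)\ne 0 .$$ Then for all $R>1$ sufficiently close to $1$ the problem $$\lambda_R\nabla\cdot\sigma_R\nabla u_R+\omega^2u_R=p\ \text{ in }B_3,\qquad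 u_R|_{\partial B_3}=0,$$ has a unique solution $u_R$. (A solution is a distribution in $B_3$ which, away from the origin, is a continuous function on $\overline{B_3}\setminus\{0\}$ with gradient in $L^2(B_3\setminus B_\varepsilon)$ for all $\varepsilon>0$ and satisfies the divergence-form equation $\nabla\cdot\sigma_R\nabla u_R+\omega^2\lambda_R^{-1}u_R=0$ weakly, and which satisfies the equation with source $p$ in the sense of distributions in $B_R$.) As $R\to1^+$, $u_R$ converges almost everywhere in $B_3$ to a limit $u_1$ such that $$(\Delta+\kappa^2\omega^2)u_1=\kappa^2p\ \text{ in }B_1,\qquad \big[\sigma_a\, r\partial_ru_1+(-\partial_\theta^2)^{1/2}u_1\big]\big|_{\partial B_1}=0,\qquad u_1=0\ \text{ on }B_2\setminus\overline{B_1}.$$ The equation in $B_1$ holds in the sense of distributions ($u_1$ extends across the origin to a distribution), $u_1$ is smooth up to $\partial B_1$ from inside, away from the origin, and $(-\partial_\theta^2)^{1/2}$ is the Fourier multiplier $e^{in\theta}\mapsto|n|e^{in\theta}$. (If the medium is normalised so that $\sigma_a=\kappa$, i.e. $\lambda_a=\kappa^{-3}$, the boundary condition reads $\kappa r\partial_ru_1+(-\partial_\theta^2)^{1/2}u_1=0$.)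 -/

import Mathlib

open Set Filter Topology MeasureTheory TopologicalSpace
open scoped Distributions LineDeriv

noncomputable section

namespace Cloak

/-! The plane `ℝ²` is identified with `ℂ`, the point `(x₁, x₂)` being `x₁ + x₂ i`. All derivatives
are real derivatives. Complex-valued distributions are Mathlib's `𝓓'(Ω, ℂ)`. -/

/-! ### Bessel functions and non-resonant frequencies -/

/-- The Bessel function `J_n` of the first kind, of integer order `n ≥ 0`. -/
def besselJ (n : ℕ) (x : ℝ) : ℝ :=
  ∑' m : ℕ, (-1) ^ m / ((m.factorial : ℝ) * ((m + n).factorial : ℝ)) * (x / 2) ^ (2 * m + n)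

/-- The constant `κ > 0` with `κ² = (σ_a λ_a)⁻¹`. -/
def kappa (σa la : ℝ) : ℝ := (Real.sqrt (σa * la))⁻¹

/-- The frequency `ω` is non-resonant: no Fourier mode `J_{|n|}(κωr) e^{inθ}` satisfies the
non-local boundary condition `σ_a r ∂_r V + (-∂_θ²)^{1/2} V = 0` at `r = 1`, and
`J_{|n|}(3ω) ≠ 0`, for all `|n|`. -/
def NonResonant (σa la ω : ℝ) : Prop :=
  ∀ n : ℕ,
    σa * (kappa σa la * ω) * deriv (besselJ n) (kappa σa la * ω)
        + n * besselJ n (kappa σa la * ω) ≠ 0 ∧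
    besselJ n (3 * ω) ≠ 0

/-! ### The material parameters -/

/-- The coordinate vector of a point of the plane. -/
def coord (x : ℂ) : Fin 2 → ℝ := ![x.re, x.im]

/-- The two coordinate directions. -/
def dir : Fin 2 → ℂ := ![1, Complex.I]

/-- The matrix `|x|⁻² x xᵗ` of the projection onto the radial direction. -/
def radialProj (x : ℂ) : Matrix (Fin 2) (Fin 2) ℝ :=
  (‖x‖ ^ 2)⁻¹ • Matrix.vecMulVec (coord x) (coord x)

/-- The mass tensor outside the cloaked region (used for `|x| > 1`): the push-forward of the
identity under the blow-up map `y ↦ (1 + |y|/2) y/|y|` for `|x| ≤ 2`, the identity beyond. -/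
def sigmaCloak (x : ℂ) : Matrix (Fin 2) (Fin 2) ℝ :=
  if 2 < ‖x‖ then 1
  else ((‖x‖ - 1) / ‖x‖) • radialProj x + (‖x‖ / (‖x‖ - 1)) • (1 - radialProj x)

/-- The bulk modulus outside the cloaked region (used for `|x| > 1`): the push-forward of `1`
under the same map for `|x| ≤ 2`, and `1` beyond. -/
def lambdaCloak (x : ℂ) : ℝ :=
  if 2 < ‖x‖ then 1 else ‖x‖ / (4 * (‖x‖ - 1))

/-- The mass tensor `σ_R` of the truncated cloak. -/
def sigmaR (σa R : ℝ) (x : ℂ) : Matrix (Fin 2) (Fin 2) ℝ :=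
  if ‖x‖ ≤ R then σa • 1 else sigmaCloak x

/-- The bulk modulus `λ_R` of the truncated cloak. -/
def lambdaR (la R : ℝ) (x : ℂ) : ℝ :=
  if ‖x‖ ≤ R then la else lambdaCloak x

/-! ### Distributions -/

/-- The open disc of radius `r` about the origin. -/
def disc (r : ℝ) : Opens ℂ := ⟨Metric.ball 0 r, Metric.isOpen_ball⟩

/-- The open disc of radius `r` about the origin, without the origin. -/
def puncturedDisc (r : ℝ) : Opens ℂ :=
  ⟨Metric.ball 0 r \ {0}, Metric.isOpen_ball.sdiff isClosed_singleton⟩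

/-- The Laplacian of a distribution. -/
def laplace {Ω : Opens ℂ} (T : 𝓓'(Ω, ℂ)) : 𝓓'(Ω, ℂ) :=
  ∂_{(1 : ℂ)} (∂_{(1 : ℂ)} T) + ∂_{Complex.I} (∂_{Complex.I} T)

/-- `∂^α δ_0` for the multi-index `α = (α₁, α₂)`. -/
def derivDelta (Ω : Opens ℂ) (α : ℕ × ℕ) : 𝓓'(Ω, ℂ) :=
  (fun T : 𝓓'(Ω, ℂ) => ∂_{(1 : ℂ)} T)^[α.1]
    ((fun T : 𝓓'(Ω, ℂ) => ∂_{Complex.I} T)^[α.2]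
      (Distribution.mapCLM Complex.ofRealCLM (Distribution.delta (0 : ℂ))))

/-- The point source `p = κ⁻² ∑_{|α| ≤ N} q_α ∂^α δ_0`. -/
def pointSource (Ω : Opens ℂ) (κ : ℝ) (N : ℕ) (q : ℕ × ℕ → ℂ) : 𝓓'(Ω, ℂ) :=
  (κ ^ 2)⁻¹ • ∑ α ∈ (Finset.range (N + 1) ×ˢ Finset.range (N + 1)).filter
    (fun α => α.1 + α.2 ≤ N), q α • derivDelta Ω α

/-- Away from the origin, the distribution `T` is given by the function `u`. -/
def AgreesOffOrigin {Ω : Opens ℂ} (T : 𝓓'(Ω, ℂ)) (u : ℂ → ℂ) : Prop :=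
  ∀ φ : 𝓓(Ω, ℝ), (0 : ℂ) ∉ tsupport φ → T φ = ∫ x, (φ x : ℂ) * u x

/-- `g = (g₀, g₁)` is the weak gradient of `u` on `Ω`. -/
def HasWeakGradient (Ω : Opens ℂ) (u : ℂ → ℂ) (g : Fin 2 → ℂ → ℂ) : Prop :=
  ∀ (j : Fin 2) (φ : 𝓓(Ω, ℝ)),
    ∫ x, u x * (fderiv ℝ φ x (dir j) : ℂ) = - ∫ x, g j x * (φ x : ℂ)

/-! ### The problem in the truncated cloak -/

/-- `u` is the solution of `λ_R ∇·σ_R ∇u + ω² u = p` in `B_3` with `u = 0` on `∂B_3`, where `p` is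
a point source at the origin. Away from the origin `u` is a finite-energy weak solution of the
divergence-form equation `∇·σ_R ∇u + ω² λ_R⁻¹ u = 0` (in its continuous representative); on
`B_R`, where the medium is homogeneous, `u` extends across the origin to a distribution that
satisfies the equation with the source. -/
structure IsCloakSolution (σa la ω R : ℝ) (N : ℕ) (q : ℕ × ℕ → ℂ) (u : ℂ → ℂ) : Prop where
  continuousOn : ContinuousOn u (Metric.closedBall 0 3 \ {0})
  boundary : ∀ x : ℂ, ‖x‖ = 3 → u x = 0
  weak : ∃ g : Fin 2 → ℂ → ℂ,
    (∀ j, ∀ ε : ℝ, 0 < ε → MemLp (g j) 2 (volume.restrict {x : ℂ | ε < ‖x‖ ∧ ‖x‖ < 3})) ∧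
    HasWeakGradient (puncturedDisc 3) u g ∧
    ∀ φ : 𝓓(puncturedDisc 3, ℝ),
      ∫ x, ∑ j, ∑ k, (sigmaR σa R x j k : ℂ) * g j x * (fderiv ℝ φ x (dir k) : ℂ) =
        ∫ x, (ω : ℂ) ^ 2 * ((lambdaR la R x)⁻¹ : ℝ) * u x * (φ x : ℂ)
  source : ∃ T : 𝓓'(disc R, ℂ), AgreesOffOrigin T u ∧
    (la * σa) • laplace T + (ω ^ 2) • T = pointSource (disc R) (kappa σa la) N q

/-! ### The limit problem -/

/-- `g = (-∂_θ²)^{1/2} f` for functions on the circle, written as functions of the angle: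
the Fourier multiplier `|n|`, with convergence of the Fourier series at every angle. -/
def HasHalfLaplacian (f g : ℝ → ℂ) : Prop :=
  ∀ θ : ℝ, HasSum
    (fun n : ℤ => ((|n| : ℤ) : ℂ) * fourierCoeffOn Real.two_pi_pos f n * Complex.exp (n * θ * Complex.I))
    (g θ)

/-- The trace of `u` on the unit circle, as a function of the angle. -/
def circleTrace (u : ℂ → ℂ) (θ : ℝ) : ℂ := u (Complex.exp (θ * Complex.I))

/-- The derivative `∂_r u` on the unit circle, taken from inside the unit disc. -/
def innerRadialDeriv (u : ℂ → ℂ) (θ : ℝ) : ℂ :=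
  derivWithin (fun r : ℝ => u (r * Complex.exp (θ * Complex.I))) (Iic 1) 1

/-- `u` satisfies `(Δ + κ²ω²) u = κ² p` in `B_1`, is smooth up to the boundary away from the
origin, and satisfies `σ_a r ∂_r u + (-∂_θ²)^{1/2} u = 0` on `∂B_1`. -/
structure IsLimitSolution (σa la ω : ℝ) (N : ℕ) (q : ℕ × ℕ → ℂ) (u : ℂ → ℂ) : Prop where
  smooth : ContDiffOn ℝ ((⊤ : ℕ∞) : WithTop ℕ∞) u (Metric.closedBall 0 1 \ {0})
  equation : ∃ T : 𝓓'(disc 1, ℂ), AgreesOffOrigin T u ∧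
    laplace T + (kappa σa la ^ 2 * ω ^ 2) • T =
      (kappa σa la ^ 2) • pointSource (disc 1) (kappa σa la) N q
  boundary : ∃ h : ℝ → ℂ, HasHalfLaplacian (circleTrace u) h ∧
    ∀ θ : ℝ, (σa : ℂ) * innerRadialDeriv u θ + h θ = 0

end Cloak

end

/-!
Write `k = κω`. A source of order `N` radiates only the finitely many modes `e^{inθ}` with
`|n| ≤ N`, and every coefficient of the equation is radial with a tensor that is diagonal in polar
coordinates, so each Fourier mode solves an ordinary differential system for the amplitude `V` and
the flux `F` (`IsModeOn`). Inside `B_R` its solutions are Bessel functions of `kr`. In the cloak they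
are Bessel functions of `ω s`, with `s = flatRadius r` the preimage of the radius under the blow-up
map: the cloak is the push-forward of the homogeneous medium.

*Existence.* The singular solution of `Δ + k²` with source `∂^α δ_0` is a finite sum of modes in the
Bessel functions of the second kind, found by differentiating the fundamental solution
(`exists_source_dist`). Each mode is continued into the cloak by one regular mode inside and the
outer profile vanishing at `r = 3` (`outerF`); the two amplitudes are determined by the continuity of
`V` and `F` at `r = R`, a `2 × 2` system with determinant `modeDet`. The determinant is nonzero for
all `n` once `R` is close to `1` (`NonResonant.eventually_modeDet_ne_zero`): for large `n` both
profiles are monotone, uniformly in `R`, and for each of the remaining `n` it follows from the limit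
below and non-resonance.

*Uniqueness.* The difference of two solutions solves the homogeneous problem. Testing the weak
formulation with separated functions `ψ(r) Re (c e^{inθ})` shows that its angular averages satisfy the mode
equations on `(0, 3)` (`IsWeakSolution.isModeOn`). Across the origin it extends to a
distribution solution of `Δ + k²`; testing with `f(|z|²) Re (c zⁿ)`, where `f` is a cut-off of
the power series of the regular Bessel function, makes the Wronskian of the average and of
the regular solution vanish (`wronskian_eq_zero_of_helmholtz`), so the average is regular at the
origin. A regular mode that vanishes at `r = 3` is zero because `modeDet ≠ 0`, and a continuous
function all of whose angular averages vanish is zero (`eq_zero_of_ringMean`).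

*The limit.* As `R → 1⁺` the inner radius `2 (R - 1)` of the flattened cloak tends to `0`, where the
outer profile `w` is singular, like `s^{-n}` or `log s`: `|w| → ∞` and `s w' / w → -n`. Hence the
amplitude outside tends to zero (`NonResonant.tendsto_outerAmp`), while the matching condition
`F / V = s w' / w` becomes `σ_a V'(1) + |n| V(1) = 0`, the nonlocal boundary condition in Fourier
variables; the amplitude of the regular mode converges accordingly
(`NonResonant.tendsto_innerAmp`).
-/

open Set Filter Topology MeasureTheory TopologicalSpace
open scoped Distributions LineDeriv

noncomputable section

namespace Cloak

/-! ### Entire power series -/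

/-- The sum of the real power series with coefficients `a`. -/
def powerSum (a : ℕ → ℝ) (t : ℝ) : ℝ := ∑' m, a m * t ^ m

/-- The coefficient sequence `a` defines a power series with infinite radius of convergence. -/
def IsEntire (a : ℕ → ℝ) : Prop := ∀ ρ : ℝ, Summable fun m => |a m| * ρ ^ m

/-- The coefficients of the derivative of the power series with coefficients `a`. -/
def shiftCoeff (a : ℕ → ℝ) (m : ℕ) : ℝ := (m + 1) * a (m + 1)

lemma nat_mul_pow_le (m : ℕ) {ρ : ℝ} (hρ : 1 ≤ ρ) : (m : ℝ) * ρ ^ (m - 1) ≤ (2 * ρ) ^ m := by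
  rw [mul_pow]
  have h1 : (m : ℝ) ≤ 2 ^ m := by exact_mod_cast (Nat.lt_two_pow_self (n := m)).le
  have h2 : ρ ^ (m - 1) ≤ ρ ^ m := pow_le_pow_right₀ hρ (Nat.sub_le _ _)
  exact mul_le_mul h1 h2 (by positivity) (by positivity)

lemma IsEntire.summable {a : ℕ → ℝ} (ha : IsEntire a) (t : ℝ) :
    Summable fun m => a m * t ^ m := by
  refine Summable.of_norm ?_
  simpa [norm_mul, norm_pow] using ha |t|

lemma IsEntire.summable_deriv {a : ℕ → ℝ} (ha : IsEntire a) {ρ : ℝ} (hρ : 1 ≤ ρ) :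
    Summable fun m => |a m| * ((m : ℝ) * ρ ^ (m - 1)) := by
  refine Summable.of_nonneg_of_le (fun m => by positivity) (fun m => ?_) (ha (2 * ρ))
  exact mul_le_mul_of_nonneg_left (nat_mul_pow_le m hρ) (abs_nonneg _)

lemma IsEntire.shift {a : ℕ → ℝ} (ha : IsEntire a) : IsEntire (shiftCoeff a) := by
  intro ρ
  have h := (summable_nat_add_iff 1).2 (ha.summable_deriv (ρ := |ρ| + 1) (by simp))
  refine Summable.of_norm_bounded h (fun m => ?_)
  simp only [shiftCoeff, norm_mul, norm_pow, Real.norm_eq_abs, abs_abs, abs_mul,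
    Nat.add_sub_cancel]
  have h1 : |((m : ℝ) + 1)| = ((m + 1 : ℕ) : ℝ) := by
    rw [abs_of_pos (by positivity)]; push_cast; rfl
  have h2 : |ρ| ^ m ≤ (|ρ| + 1) ^ m := by gcongr; linarith
  rw [h1]
  calc _ = |a (m + 1)| * (((m + 1 : ℕ) : ℝ) * |ρ| ^ m) := by ring
    _ ≤ _ := by gcongr

lemma hasDerivAt_powerSum {a : ℕ → ℝ} (ha : IsEntire a) (t : ℝ) :
    HasDerivAt (powerSum a) (powerSum (shiftCoeff a) t) t := by
  have hρ : (1 : ℝ) ≤ |t| + 1 := by simp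
  have key := hasDerivAt_tsum_of_isPreconnected (𝕜 := ℝ) (F := ℝ)
    (g := fun m x => a m * x ^ m) (g' := fun m x => a m * ((m : ℝ) * x ^ (m - 1)))
    (u := fun m => |a m| * ((m : ℝ) * (|t| + 1) ^ (m - 1)))
    (t := Metric.ball (0 : ℝ) (|t| + 1)) (y₀ := 0) (y := t)
    (ha.summable_deriv hρ) Metric.isOpen_ball (convex_ball _ _).isPreconnected
    (fun m y _ => (hasDerivAt_pow m y).const_mul _)
    (fun m y hy => by
      have hy' : |y| ≤ |t| + 1 := by
        have := Metric.mem_ball.1 hy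
        rw [dist_zero_right, Real.norm_eq_abs] at this
        exact this.le
      rw [norm_mul, norm_mul, norm_pow, Real.norm_eq_abs, Real.norm_eq_abs, Real.norm_eq_abs,
        Nat.abs_cast]
      gcongr)
    (Metric.mem_ball_self (by positivity)) (ha.summable 0)
    (by rw [Metric.mem_ball, dist_zero_right, Real.norm_eq_abs]; linarith)
  have hsum : ∑' m, a m * ((m : ℝ) * t ^ (m - 1)) = powerSum (shiftCoeff a) t := by
    have hs : Summable fun m => a m * ((m : ℝ) * t ^ (m - 1)) := by
      refine Summable.of_norm_bounded (ha.summable_deriv hρ) (fun m => ?_)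
      rw [norm_mul, norm_mul, norm_pow, Real.norm_eq_abs, Real.norm_eq_abs, Real.norm_eq_abs,
        Nat.abs_cast]
      gcongr
      linarith
    rw [hs.tsum_eq_zero_add]
    simp only [Nat.cast_zero, zero_mul, mul_zero, zero_add, Nat.add_sub_cancel, powerSum,
      shiftCoeff]
    exact tsum_congr fun m => by push_cast; ring
  rw [hsum] at key
  exact key

lemma contDiff_powerSum {a : ℕ → ℝ} (ha : IsEntire a) :
    ContDiff ℝ ((⊤ : ℕ∞) : WithTop ℕ∞) (powerSum a) := by
  rw [contDiff_infty]
  intro n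
  induction n generalizing a with
  | zero =>
    exact contDiff_zero.2 (continuous_iff_continuousAt.2
      fun t => (hasDerivAt_powerSum ha t).continuousAt)
  | succ n ih =>
    push_cast
    rw [contDiff_succ_iff_deriv]
    refine ⟨fun t => (hasDerivAt_powerSum ha t).differentiableAt, by simp, ?_⟩
    rw [show deriv (powerSum a) = powerSum (shiftCoeff a) from
      funext fun t => (hasDerivAt_powerSum ha t).deriv]
    exact ih ha.shift

lemma powerSum_zero (a : ℕ → ℝ) : powerSum a 0 = a 0 := by
  rw [powerSum, tsum_eq_single 0 (fun m hm => by simp [hm])]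
  simp

lemma isEntire_of_le_factorial {a : ℕ → ℝ} (C : ℝ) (h : ∀ m, |a m| ≤ C / (m.factorial : ℝ)) :
    IsEntire a := by
  intro ρ
  refine Summable.of_norm_bounded ((Real.summable_pow_div_factorial |ρ|).mul_left C) (fun m => ?_)
  rw [norm_mul, norm_pow, Real.norm_eq_abs, Real.norm_eq_abs, abs_abs]
  calc _ ≤ C / (m.factorial : ℝ) * |ρ| ^ m := by gcongr; exact h m
    _ = _ := by ring

/-! ### Bessel chains -/

/-- A Bessel chain: functions `F n` on `(0, ∞)` with `F n' = -F (n+1)` such that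
`r ^ n F n (r² / 4)` solves Bessel's equation of order `n`. In the variable `t = r² / 4` all
cylinder functions of integer order arise from one function `F 0` by differentiation. -/
structure IsBesselChain (F : ℕ → ℝ → ℝ) : Prop where
  hasDerivAt : ∀ n t, 0 < t → HasDerivAt (F n) (-F (n + 1) t) t
  recurrence : ∀ n t, 0 < t → t * F (n + 2) t = (n + 1) * F (n + 1) t - F n t

/-- The coefficients of `chainJ n`. -/
def coeffJ (n m : ℕ) : ℝ := (-1) ^ m / ((m.factorial : ℝ) * ((m + n).factorial : ℝ))

/-- The chain of the Bessel functions of the first kind: `J_n (r) = (r/2)ⁿ chainJ n (r²/4)`. -/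
def chainJ (n : ℕ) : ℝ → ℝ := powerSum (coeffJ n)

lemma isEntire_coeffJ (n : ℕ) : IsEntire (coeffJ n) := by
  refine isEntire_of_le_factorial 1 fun m => ?_
  rw [coeffJ, abs_div, abs_pow, abs_neg, abs_one, one_pow, abs_of_pos (by positivity)]
  have h : (1 : ℝ) ≤ ((m + n).factorial : ℝ) := by exact_mod_cast Nat.factorial_pos _
  gcongr
  exact le_mul_of_one_le_right (by positivity) h

lemma shiftCoeff_coeffJ (n m : ℕ) : shiftCoeff (coeffJ n) m = -coeffJ (n + 1) m := by
  rw [shiftCoeff, coeffJ, coeffJ, Nat.factorial_succ, show m + 1 + n = m + (n + 1) by ring]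
  push_cast
  have h1 : (m.factorial : ℝ) ≠ 0 := by positivity
  have h2 : ((m + (n + 1)).factorial : ℝ) ≠ 0 := by positivity
  field_simp
  ring

lemma hasDerivAt_chainJ (n : ℕ) (t : ℝ) : HasDerivAt (chainJ n) (-chainJ (n + 1) t) t := by
  refine (hasDerivAt_powerSum (isEntire_coeffJ n) t).congr_deriv ?_
  simp only [chainJ, powerSum, shiftCoeff_coeffJ, neg_mul, tsum_neg]

lemma contDiff_chainJ (n : ℕ) : ContDiff ℝ ((⊤ : ℕ∞) : WithTop ℕ∞) (chainJ n) :=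
  contDiff_powerSum (isEntire_coeffJ n)

lemma continuous_chainJ (n : ℕ) : Continuous (chainJ n) := (contDiff_chainJ n).continuous

lemma coeffJ_recurrence (n m : ℕ) :
    coeffJ (n + 2) m = (n + 1) * coeffJ (n + 1) (m + 1) - coeffJ n (m + 1) := by
  simp only [coeffJ, show m + 1 + (n + 1) = m + (n + 2) by ring,
    show m + (n + 2) = m + (n + 1) + 1 by ring, show m + 1 + n = m + (n + 1) by ring,
    Nat.factorial_succ]
  push_cast
  have h1 : (m.factorial : ℝ) ≠ 0 := by positivity
  have h2 : ((m + n).factorial : ℝ) ≠ 0 := by positivity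
  field_simp
  ring

lemma chainJ_recurrence (n : ℕ) (t : ℝ) :
    t * chainJ (n + 2) t = (n + 1) * chainJ (n + 1) t - chainJ n t := by
  have hs1 := (isEntire_coeffJ (n + 1)).summable t
  have hs0 := (isEntire_coeffJ n).summable t
  simp only [chainJ, powerSum]
  rw [hs1.tsum_eq_zero_add, hs0.tsum_eq_zero_add, ← tsum_mul_left, mul_add, ← tsum_mul_left]
  have h0 : ((n : ℝ) + 1) * (coeffJ (n + 1) 0 * t ^ 0) = coeffJ n 0 * t ^ 0 := by
    simp only [coeffJ, Nat.zero_add, Nat.factorial_succ]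
    push_cast
    have h2 : (n.factorial : ℝ) ≠ 0 := by positivity
    field_simp
  rw [h0, add_sub_add_left_eq_sub, ← Summable.tsum_sub
    (((summable_nat_add_iff 1).2 hs1).mul_left _) ((summable_nat_add_iff 1).2 hs0)]
  exact tsum_congr fun m => by rw [coeffJ_recurrence]; ring

lemma isBesselChain_chainJ : IsBesselChain chainJ :=
  ⟨fun n t _ => hasDerivAt_chainJ n t, fun n t _ => chainJ_recurrence n t⟩

lemma chainJ_zero (n : ℕ) : chainJ n 0 = 1 / (n.factorial : ℝ) := by
  simp [chainJ, powerSum_zero, coeffJ]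

lemma besselJ_eq (n : ℕ) (x : ℝ) : besselJ n x = (x / 2) ^ n * chainJ n (x ^ 2 / 4) := by
  rw [besselJ, chainJ, powerSum, ← tsum_mul_left]
  refine tsum_congr fun m => ?_
  rw [coeffJ, pow_add, pow_mul, show (x / 2) ^ 2 = x ^ 2 / 4 by ring]
  ring

/-! ### The chain of the second kind -/

/-- The coefficients of the entire part of `chainY 0`. -/
def coeffE (m : ℕ) : ℝ := -2 * (harmonic m : ℝ) * coeffJ 0 m

lemma harmonic_le_two_pow (m : ℕ) : (harmonic m : ℝ) ≤ 2 ^ m := by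
  induction m with
  | zero => simp
  | succ m ih =>
    rw [harmonic_succ]
    push_cast
    have h1 : ((m : ℝ) + 1)⁻¹ ≤ 1 := inv_le_one_of_one_le₀ (by simp)
    have h2 : (1 : ℝ) ≤ 2 ^ m := one_le_pow₀ (by norm_num)
    rw [pow_succ]
    linarith

lemma isEntire_coeffE : IsEntire coeffE := by
  intro ρ
  refine Summable.of_norm_bounded ((isEntire_coeffJ 0 (2 * |ρ|)).mul_left 2) (fun m => ?_)
  have h0 : (0 : ℝ) ≤ harmonic m := by
    rw [harmonic]; push_cast; exact Finset.sum_nonneg fun i _ => by positivity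
  rw [norm_mul, norm_pow, Real.norm_eq_abs, Real.norm_eq_abs, abs_abs, coeffE, abs_mul, abs_mul,
    abs_neg, abs_two, abs_of_nonneg h0]
  calc _ ≤ 2 * 2 ^ m * |coeffJ 0 m| * |ρ| ^ m := by gcongr; exact harmonic_le_two_pow m
    _ = _ := by rw [mul_pow]; ring

/-- The smooth functions `A_n` with `chainY n = chainJ n · log + A_n / t ^ n`. -/
def regY : ℕ → ℝ → ℝ
  | 0 => powerSum coeffE
  | n + 1 => fun t => n * regY n t - t * deriv (regY n) t - t ^ n * chainJ n t

/-- The chain of the Bessel functions of the second kind (up to normalisation and multiples of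
`chainJ`), with a logarithmic singularity of `chainY 0` at `t = 0`. -/
def chainY (n : ℕ) (t : ℝ) : ℝ := chainJ n t * Real.log t + regY n t / t ^ n

lemma contDiff_regY (n : ℕ) : ContDiff ℝ ((⊤ : ℕ∞) : WithTop ℕ∞) (regY n) := by
  induction n with
  | zero => exact contDiff_powerSum isEntire_coeffE
  | succ n ih =>
    have h : ContDiff ℝ ((⊤ : ℕ∞) : WithTop ℕ∞) (deriv (regY n)) :=
      (contDiff_infty_iff_deriv.1 ih).2
    have h2 := contDiff_chainJ n
    unfold regY
    fun_prop

lemma continuous_regY (n : ℕ) : Continuous (regY n) := (contDiff_regY n).continuous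

lemma hasDerivAt_regY (n : ℕ) (t : ℝ) : HasDerivAt (regY n) (deriv (regY n) t) t :=
  ((contDiff_regY n).differentiable (by simp)).differentiableAt.hasDerivAt

lemma regY_one_zero : regY 1 0 = -1 := by
  simp [regY, chainJ_zero]

lemma regY_succ_zero (n : ℕ) : regY (n + 1) 0 = -(n.factorial : ℝ) := by
  induction n with
  | zero => simpa using regY_one_zero
  | succ n ih =>
    have h : regY (n + 2) 0 = (n + 1 : ℕ) * regY (n + 1) 0 := by simp [regY]
    rw [h, ih, Nat.factorial_succ]
    push_cast
    ring

lemma hasDerivAt_chainY (n : ℕ) {t : ℝ} (ht : 0 < t) :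
    HasDerivAt (chainY n) (-chainY (n + 1) t) t := by
  have h := ((hasDerivAt_chainJ n t).mul (Real.hasDerivAt_log ht.ne')).add
    ((hasDerivAt_regY n t).div (hasDerivAt_pow n t) (pow_ne_zero n ht.ne'))
  refine h.congr_deriv ?_
  rw [chainY, regY]
  rcases n with _ | n
  · simp
    field_simp
    ring
  · simp only [Nat.add_sub_cancel]
    push_cast
    field_simp
    ring

lemma coeffE_recurrence (m : ℕ) :
    coeffE m + (m + 1) ^ 2 * coeffE (m + 1) + 2 * (m + 1) * coeffJ 0 (m + 1) = 0 := by
  simp only [coeffE, coeffJ, harmonic_succ, Nat.factorial_succ, Nat.add_zero]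
  push_cast
  have h1 : (m.factorial : ℝ) ≠ 0 := by positivity
  field_simp
  ring

/-- Bessel's equation of order zero for `chainY 0`: the entire part satisfies
`t A'' + A' + A = 2 chainJ 1`, compensating the terms where the logarithm is differentiated. -/
lemma regY_zero_equation (t : ℝ) :
    t * deriv (deriv (regY 0)) t + deriv (regY 0) t + regY 0 t = 2 * chainJ 1 t := by
  have hE := isEntire_coeffE
  have h1 : deriv (regY 0) = powerSum (shiftCoeff coeffE) :=
    funext fun t => (hasDerivAt_powerSum hE t).deriv
  have h2 : deriv (deriv (regY 0)) t = powerSum (shiftCoeff (shiftCoeff coeffE)) t := by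
    rw [h1]; exact (hasDerivAt_powerSum hE.shift t).deriv
  have h3 : chainJ 1 t = -powerSum (shiftCoeff (coeffJ 0)) t := by
    simp only [chainJ, powerSum, shiftCoeff_coeffJ, neg_mul, tsum_neg, neg_neg, zero_add]
  rw [h2, h1, h3]
  have hs2 := hE.shift.shift.summable t
  have hs1 := hE.shift.summable t
  have hs0 := hE.summable t
  have hsJ := (isEntire_coeffJ 0).shift.summable t
  have e2 : t * powerSum (shiftCoeff (shiftCoeff coeffE)) t
      = ∑' m : ℕ, (m : ℝ) * shiftCoeff coeffE m * t ^ m := by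
    have hs : Summable fun m : ℕ => (m : ℝ) * shiftCoeff coeffE m * t ^ m := by
      rw [← summable_nat_add_iff 1]
      refine (hs2.mul_left t).congr fun m => ?_
      simp only [shiftCoeff]; push_cast; ring
    rw [hs.tsum_eq_zero_add, powerSum, ← tsum_mul_left]
    simp only [Nat.cast_zero, zero_mul, zero_add]
    refine tsum_congr fun m => ?_
    simp only [shiftCoeff]; push_cast; ring
  have hs : Summable fun m : ℕ => (m : ℝ) * shiftCoeff coeffE m * t ^ m := by
    rw [← summable_nat_add_iff 1]
    refine (hs2.mul_left t).congr fun m => ?_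
    simp only [shiftCoeff]; push_cast; ring
  rw [e2]
  simp only [regY, powerSum]
  rw [← hs.tsum_add hs1, ← (hs.add hs1).tsum_add hs0, ← tsum_neg, ← tsum_mul_left]
  refine tsum_congr fun m => ?_
  have := coeffE_recurrence m
  simp only [shiftCoeff]
  linear_combination t ^ m * this

/-- The recurrence of a Bessel chain follows, by differentiation, from its first instance. -/
lemma isBesselChain_of_zero {F : ℕ → ℝ → ℝ}
    (hd : ∀ n t, 0 < t → HasDerivAt (F n) (-F (n + 1) t) t)
    (h0 : ∀ t, 0 < t → t * F 2 t = F 1 t - F 0 t) : IsBesselChain F := by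
  refine ⟨hd, fun n => ?_⟩
  induction n with
  | zero => intro t ht; simpa using h0 t ht
  | succ n ih =>
    intro t ht
    have e : (fun t => t * F (n + 2) t) =ᶠ[𝓝 t] fun t => (n + 1) * F (n + 1) t - F n t :=
      (lt_mem_nhds ht).mono fun s hs => ih s hs
    have d1 := (hasDerivAt_id t).mul (hd (n + 2) t ht)
    have d2 := ((hd (n + 1) t ht).const_mul ((n : ℝ) + 1)).sub (hd n t ht)
    have := d1.unique (d2.congr_of_eventuallyEq e)
    simp only [id, one_mul] at this
    rw [show n + 1 + 2 = n + 2 + 1 by ring, show n + 1 + 1 = n + 2 by ring] at *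
    push_cast
    linear_combination -this

lemma isBesselChain_chainY : IsBesselChain chainY := by
  refine isBesselChain_of_zero (fun n t ht => hasDerivAt_chainY n ht) fun t ht => ?_
  have hd : deriv (regY 1) t
      = -deriv (regY 0) t - t * deriv (deriv (regY 0)) t + chainJ 1 t := by
    have hdd : HasDerivAt (deriv (regY 0)) (deriv (deriv (regY 0)) t) t :=
      ((contDiff_infty_iff_deriv.1 (contDiff_regY 0)).2.differentiable
        (by simp)).differentiableAt.hasDerivAt
    have h : HasDerivAt (regY 1) _ t :=
      (((hasDerivAt_regY 0 t).const_mul ((0 : ℕ) : ℝ)).sub ((hasDerivAt_id t).mul hdd)).sub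
        ((hasDerivAt_pow 0 t).mul (hasDerivAt_chainJ 0 t))
    rw [h.deriv]
    simp
    ring
  have e1 : regY 1 t = -t * deriv (regY 0) t - chainJ 0 t := by simp [regY]
  have e2 : regY 2 t = regY 1 t - t * deriv (regY 1) t - t * chainJ 1 t := by simp [regY]
  have eq := regY_zero_equation t
  have hJ := chainJ_recurrence 0 t
  simp only [chainY]
  field_simp
  rw [e2, hd, e1]
  simp only [zero_add, Nat.cast_zero] at hJ
  linear_combination (Real.log t * t) * hJ + t * eq

/-- Linear combinations of Bessel chains are Bessel chains. -/
lemma IsBesselChain.linComb {F G : ℕ → ℝ → ℝ} (hF : IsBesselChain F) (hG : IsBesselChain G)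
    (a b : ℝ) : IsBesselChain fun n t => a * F n t + b * G n t := by
  refine ⟨fun n t ht => ?_, fun n t ht => ?_⟩
  · refine (((hF.hasDerivAt n t ht).const_mul a).add ((hG.hasDerivAt n t ht).const_mul b)).congr_deriv ?_
    ring
  · linear_combination a * hF.recurrence n t ht + b * hG.recurrence n t ht

/-- The Wronskian of the two chains, the same for every order. -/
lemma chain_wronskian (n : ℕ) {t : ℝ} (ht : 0 < t) :
    t ^ (n + 1) * (chainJ n t * chainY (n + 1) t - chainY n t * chainJ (n + 1) t) = -1 := by
  induction n with
  | succ n ih =>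
    rw [← ih]
    have h1 := isBesselChain_chainY.recurrence n t ht
    have h2 := chainJ_recurrence n t
    linear_combination (t ^ (n + 1) * chainJ (n + 1) t) * h1 - (t ^ (n + 1) * chainY (n + 1) t) * h2
  | zero =>
    -- the logarithms cancel, and the remaining smooth function has derivative zero
    set W : ℝ → ℝ := fun t => chainJ 0 t * regY 1 t - t * (regY 0 t * chainJ 1 t) with hW
    have hWd : ∀ t, HasDerivAt W 0 t := by
      intro t
      have hdd : HasDerivAt (deriv (regY 0)) (deriv (deriv (regY 0)) t) t :=
        ((contDiff_infty_iff_deriv.1 (contDiff_regY 0)).2.differentiable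
          (by simp)).differentiableAt.hasDerivAt
      have e1 : regY 1 = fun t => -t * deriv (regY 0) t - chainJ 0 t := by
        funext t; simp [regY]
      have h1 : HasDerivAt (regY 1)
          (-1 * deriv (regY 0) t + -t * deriv (deriv (regY 0)) t - -chainJ 1 t) t := by
        rw [e1]; exact ((hasDerivAt_id t).neg.mul hdd).sub (hasDerivAt_chainJ 0 t)
      have h := ((hasDerivAt_chainJ 0 t).mul h1).sub
        ((hasDerivAt_id t).mul ((hasDerivAt_regY 0 t).mul (hasDerivAt_chainJ 1 t)))
      refine h.congr_deriv ?_
      have eq := regY_zero_equation t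
      have hJ := chainJ_recurrence 0 t
      simp only [e1, zero_add, Nat.cast_zero, id, Pi.mul_apply, Nat.reduceAdd] at hJ ⊢
      linear_combination (-chainJ 0 t) * eq + regY 0 t * hJ
    have hc : W t = W 0 := is_const_of_deriv_eq_zero
      (fun t => (hWd t).differentiableAt) (fun t => (hWd t).deriv) t 0
    have h0 : W 0 = -1 := by simp [hW, chainJ_zero, regY_one_zero]
    rw [h0] at hc
    rw [← hc, hW]
    simp only [chainY]
    field_simp
    ring

/-! ### Radial profiles of Fourier modes -/

/-- The radial profile `r ↦ rⁿ F_n (k² r² / 4)` attached to a Bessel chain `F`: for `F = chainJ` it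
is a multiple of `J_n (k r)`. -/
def modeF (F : ℕ → ℝ → ℝ) (k : ℝ) (n : ℕ) (r : ℝ) : ℝ := r ^ n * F n (k ^ 2 * r ^ 2 / 4)

/-- The function `r f'(r)` for the radial profile `f = modeF F k n`. -/
def modeP (F : ℕ → ℝ → ℝ) (k : ℝ) (n : ℕ) (r : ℝ) : ℝ :=
  n * modeF F k n r - k ^ 2 / 2 * r ^ (n + 2) * F (n + 1) (k ^ 2 * r ^ 2 / 4)

section profile

variable {F : ℕ → ℝ → ℝ} {k r : ℝ}

lemma hasDerivAt_chain_comp (hF : IsBesselChain F) (hk : 0 < k) (n : ℕ) (hr : 0 < r) :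
    HasDerivAt (fun r => F n (k ^ 2 * r ^ 2 / 4)) (-F (n + 1) (k ^ 2 * r ^ 2 / 4) * (k ^ 2 / 2 * r))
      r := by
  have h2 : HasDerivAt (fun r : ℝ => k ^ 2 * r ^ 2 / 4) (k ^ 2 / 2 * r) r := by
    refine (((hasDerivAt_pow 2 r).const_mul (k ^ 2)).div_const 4).congr_deriv ?_
    simp
    ring
  exact (hF.hasDerivAt n (k ^ 2 * r ^ 2 / 4) (by positivity)).comp r h2

lemma hasDerivAt_modeF (hF : IsBesselChain F) (hk : 0 < k) (n : ℕ) (hr : 0 < r) :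
    HasDerivAt (modeF F k n) (modeP F k n r / r) r := by
  refine ((hasDerivAt_pow n r).mul (hasDerivAt_chain_comp hF hk n hr)).congr_deriv ?_
  rw [modeP, modeF]
  rcases n with _ | n
  · simp; field_simp
  · simp only [Nat.add_sub_cancel]
    field_simp
    ring

lemma hasDerivAt_modeP (hF : IsBesselChain F) (hk : 0 < k) (n : ℕ) (hr : 0 < r) :
    HasDerivAt (modeP F k n) ((n ^ 2 / r - k ^ 2 * r) * modeF F k n r) r := by
  refine (((hasDerivAt_modeF hF hk n hr).const_mul (n : ℝ)).sub
    (((hasDerivAt_pow (n + 2) r).const_mul (k ^ 2 / 2)).mul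
      (hasDerivAt_chain_comp hF hk (n + 1) hr))).congr_deriv ?_
  have h := hF.recurrence n (k ^ 2 * r ^ 2 / 4) (by positivity)
  rw [modeP, modeF]
  simp only [show n + 2 - 1 = n + 1 by omega, show n + 1 + 1 = n + 2 by ring]
  push_cast
  field_simp at h ⊢
  linear_combination (k ^ 2 * r ^ 2 * r ^ n) * h

lemma continuousOn_modeF (hF : IsBesselChain F) (hk : 0 < k) (n : ℕ) :
    ContinuousOn (modeF F k n) (Ioi 0) :=
  fun _ hr => (hasDerivAt_modeF hF hk n hr).continuousAt.continuousWithinAt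

lemma continuousOn_modeP (hF : IsBesselChain F) (hk : 0 < k) (n : ℕ) :
    ContinuousOn (modeP F k n) (Ioi 0) :=
  fun _ hr => (hasDerivAt_modeP hF hk n hr).continuousAt.continuousWithinAt

lemma continuous_modeF_chainJ (k : ℝ) (n : ℕ) : Continuous (modeF chainJ k n) := by
  have := continuous_chainJ n
  unfold modeF
  fun_prop

lemma continuous_modeP_chainJ (k : ℝ) (n : ℕ) : Continuous (modeP chainJ k n) := by
  have := continuous_chainJ (n + 1)
  have := continuous_modeF_chainJ k n
  unfold modeP
  fun_prop

lemma modeF_linComb {F G : ℕ → ℝ → ℝ} (a b k : ℝ) (n : ℕ) (r : ℝ) :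
    modeF (fun n t => a * F n t + b * G n t) k n r = a * modeF F k n r + b * modeF G k n r := by
  simp only [modeF]; ring

lemma modeP_linComb {F G : ℕ → ℝ → ℝ} (a b k : ℝ) (n : ℕ) (r : ℝ) :
    modeP (fun n t => a * F n t + b * G n t) k n r = a * modeP F k n r + b * modeP G k n r := by
  simp only [modeP, modeF]; ring

lemma modeF_wronskian (hk : 0 < k) (n : ℕ) (hr : 0 < r) :
    modeF chainJ k n r * modeP chainY k n r - modeF chainY k n r * modeP chainJ k n r
      = 2 * (4 / k ^ 2) ^ n := by
  have h := chain_wronskian n (t := k ^ 2 * r ^ 2 / 4) (by positivity)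
  have e : (k ^ 2 * r ^ 2 / 4) ^ (n + 1) = (k ^ 2 / 4) ^ (n + 1) * r ^ (2 * n + 2) := by
    rw [show k ^ 2 * r ^ 2 / 4 = k ^ 2 / 4 * r ^ 2 by ring, mul_pow, ← pow_mul]; ring_nf
  have e2 : (k ^ 2 / 4) ^ (n + 1) * (4 / k ^ 2) ^ n = k ^ 2 / 4 := by
    rw [pow_succ, mul_right_comm, ← mul_pow, div_mul_div_comm, mul_comm (4 : ℝ),
      div_self (by positivity), one_pow, one_mul]
  rw [e] at h
  simp only [modeP, modeF]
  have e3 : (4 / k ^ 2) ^ n * (k ^ 2 / 4) = (4 / k ^ 2) ^ n * (k ^ 2 / 4) ^ (n + 1) * (4 / k ^ 2) ^ n := by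
    linear_combination (-(4 / k ^ 2) ^ n) * e2
  have e4 : (4 / k ^ 2) ^ n ≠ 0 := by positivity
  have e5 : 1 * (k ^ 2 / 4) = (k ^ 2 / 4) ^ (n + 1) * (4 / k ^ 2) ^ n := by linear_combination -e2
  generalize chainJ n (k ^ 2 * r ^ 2 / 4) = a at *
  generalize chainY n (k ^ 2 * r ^ 2 / 4) = b at *
  generalize chainJ (n + 1) (k ^ 2 * r ^ 2 / 4) = c at *
  generalize chainY (n + 1) (k ^ 2 * r ^ 2 / 4) = d at *
  linear_combination (-2 * (4 / k ^ 2) ^ n) * h + (-2 * r ^ (2 * n + 2) * (a * d - b * c)) * e5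

lemma modeF_besselJ (hk : 0 < k) (n : ℕ) (r : ℝ) :
    modeF chainJ k n r = (2 / k) ^ n * besselJ n (k * r) := by
  rw [modeF, besselJ_eq, ← mul_assoc, ← mul_pow (2 / k), show 2 / k * (k * r / 2) = r by field_simp, mul_pow k]

lemma hasDerivAt_besselJ (hk : 0 < k) (n : ℕ) :
    HasDerivAt (besselJ n) (modeP chainJ k n 1 / ((2 / k) ^ n * k)) k := by
  have h : besselJ n = fun x => ((2 / k) ^ n)⁻¹ * modeF chainJ k n (x / k) := by
    funext x
    rw [modeF_besselJ hk, ← mul_assoc, inv_mul_cancel₀ (by positivity), one_mul]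
    congr 1
    field_simp
  rw [h]
  have h2 : HasDerivAt (modeF chainJ k n) (modeP chainJ k n 1 / 1) (k / k) := by
    rw [div_self hk.ne']
    exact hasDerivAt_modeF isBesselChain_chainJ hk n one_pos
  have h4 : HasDerivAt (fun x => x / k) (1 / k) k := (hasDerivAt_id k).div_const k
  refine ((HasDerivAt.comp (h := fun x => x / k) k h2 h4).const_mul _).congr_deriv ?_
  field_simp

/-- For `n ≥ k ρ` the regular profile and its derivative have the same sign on `(0, ρ)`: the
function `f · r f'` vanishes at the origin and increases. -/
lemma modeF_mul_modeP_pos (hk : 0 < k) {n : ℕ} {ρ : ℝ} (hn : k * ρ ≤ n) (hn0 : n ≠ 0) (hr : 0 < r)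
    (hrρ : r < ρ) : 0 < modeF chainJ k n r * modeP chainJ k n r := by
  have hd : ∀ x, 0 < x → HasDerivAt (fun x => modeF chainJ k n x * modeP chainJ k n x)
      (modeP chainJ k n x / x * modeP chainJ k n x
        + modeF chainJ k n x * ((n ^ 2 / x - k ^ 2 * x) * modeF chainJ k n x)) x := fun x hx =>
    (hasDerivAt_modeF isBesselChain_chainJ hk n hx).mul
      (hasDerivAt_modeP isBesselChain_chainJ hk n hx)
  have hmono : StrictMonoOn (fun x => modeF chainJ k n x * modeP chainJ k n x) (Icc 0 r) := by
    refine strictMonoOn_of_deriv_pos (convex_Icc _ _) (Continuous.continuousOn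
      ((continuous_modeF_chainJ k n).mul (continuous_modeP_chainJ k n))) fun x hx => ?_
    rw [interior_Icc] at hx
    have hx0 : 0 < x := hx.1
    rw [(hd x hx0).deriv]
    have hq : 0 < n ^ 2 / x - k ^ 2 * x := by
      have : k * x < n := lt_of_lt_of_le (mul_lt_mul_of_pos_left (hx.2.trans hrρ) hk) hn
      have : (k * x) ^ 2 < (n : ℝ) ^ 2 := by gcongr
      rw [sub_pos, lt_div_iff₀ hx0]
      linarith
    have hw := modeF_wronskian (k := k) hk n hx0
    have hpos : 0 < 2 * (4 / k ^ 2) ^ n := by positivity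
    have h1 : 0 ≤ modeP chainJ k n x / x * modeP chainJ k n x := by
      rw [div_mul_eq_mul_div]; exact div_nonneg (mul_self_nonneg _) hx0.le
    have h2 : 0 ≤ modeF chainJ k n x * ((n ^ 2 / x - k ^ 2 * x) * modeF chainJ k n x) := by
      rw [mul_left_comm]; exact mul_nonneg hq.le (mul_self_nonneg _)
    -- both terms are squares; the Wronskian excludes a common zero
    rcases eq_or_ne (modeF chainJ k n x) 0 with h | h
    · have h3 : modeP chainJ k n x ≠ 0 := by
        intro h3; rw [h, h3] at hw; linarith [hw]
      have : 0 < modeP chainJ k n x / x * modeP chainJ k n x := by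
        rw [div_mul_eq_mul_div]; exact div_pos (mul_self_pos.2 h3) hx0
      linarith
    · have : 0 < modeF chainJ k n x * ((n ^ 2 / x - k ^ 2 * x) * modeF chainJ k n x) := by
        rw [mul_left_comm]; exact mul_pos hq (mul_self_pos.2 h)
      linarith
  have h := hmono (left_mem_Icc.2 hr.le) (right_mem_Icc.2 hr.le) hr
  have h0 : modeF chainJ k n 0 = 0 := by simp [modeF, hn0]
  simpa [h0] using h

end profile

/-! ### The outer profile -/

/-- The chain whose profile of order `n` vanishes at `r = 3`. -/
def dirichletChain (ω : ℝ) (n : ℕ) : ℕ → ℝ → ℝ := fun m t =>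
  modeF chainJ ω n 3 * chainY m t + -modeF chainY ω n 3 * chainJ m t

/-- The radial profile of order `n` at frequency `ω` that vanishes at `r = 3`. -/
def outerF (ω : ℝ) (n : ℕ) : ℝ → ℝ := modeF (dirichletChain ω n) ω n

/-- The function `r f'(r)` for `f = outerF ω n`. -/
def outerP (ω : ℝ) (n : ℕ) : ℝ → ℝ := modeP (dirichletChain ω n) ω n

section outer

variable {ω : ℝ} {n : ℕ}

lemma isBesselChain_dirichletChain (ω : ℝ) (n : ℕ) : IsBesselChain (dirichletChain ω n) :=
  isBesselChain_chainY.linComb isBesselChain_chainJ _ _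

lemma outerF_eq (ω : ℝ) (n : ℕ) (s : ℝ) :
    outerF ω n s = modeF chainJ ω n 3 * modeF chainY ω n s
      + -modeF chainY ω n 3 * modeF chainJ ω n s := modeF_linComb _ _ _ _ _

lemma outerP_eq (ω : ℝ) (n : ℕ) (s : ℝ) :
    outerP ω n s = modeF chainJ ω n 3 * modeP chainY ω n s
      + -modeF chainY ω n 3 * modeP chainJ ω n s := modeP_linComb _ _ _ _ _

lemma outerF_three (ω : ℝ) (n : ℕ) : outerF ω n 3 = 0 := by rw [outerF_eq]; ring

lemma outerP_three (hω : 0 < ω) (n : ℕ) : outerP ω n 3 = 2 * (4 / ω ^ 2) ^ n := by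
  rw [outerP_eq, ← modeF_wronskian hω n (r := 3) (by norm_num)]; ring

lemma hasDerivAt_outerF (hω : 0 < ω) (n : ℕ) {s : ℝ} (hs : 0 < s) :
    HasDerivAt (outerF ω n) (outerP ω n s / s) s :=
  hasDerivAt_modeF (isBesselChain_dirichletChain ω n) hω n hs

lemma hasDerivAt_outerP (hω : 0 < ω) (n : ℕ) {s : ℝ} (hs : 0 < s) :
    HasDerivAt (outerP ω n) ((n ^ 2 / s - ω ^ 2 * s) * outerF ω n s) s :=
  hasDerivAt_modeP (isBesselChain_dirichletChain ω n) hω n hs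

/-- For `n ≥ 3 ω` the outer profile and its derivative have opposite signs on `(0, 3)`. -/
lemma outerF_mul_outerP_neg (hω : 0 < ω) (hn : 3 * ω ≤ n) {s : ℝ} (hs : 0 < s) (hs3 : s < 3) :
    outerF ω n s * outerP ω n s < 0 := by
  have hd : ∀ x, 0 < x → HasDerivAt (fun x => outerF ω n x * outerP ω n x)
      (outerP ω n x / x * outerP ω n x
        + outerF ω n x * ((n ^ 2 / x - ω ^ 2 * x) * outerF ω n x)) x := fun x hx =>
    (hasDerivAt_outerF hω n hx).mul (hasDerivAt_outerP hω n hx)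
  have hq : ∀ x, 0 < x → x < 3 → 0 < n ^ 2 / x - ω ^ 2 * x := by
    intro x hx0 hx3
    have : ω * x < n := lt_of_lt_of_le (by nlinarith) hn
    have : (ω * x) ^ 2 < (n : ℝ) ^ 2 := by gcongr
    rw [sub_pos, lt_div_iff₀ hx0]
    linarith
  have hmono : MonotoneOn (fun x => outerF ω n x * outerP ω n x) (Icc s 3) := by
    refine monotoneOn_of_deriv_nonneg (convex_Icc _ _) (fun x hx =>
      (hd x (hs.trans_le hx.1)).continuousAt.continuousWithinAt) (fun x hx => ?_) fun x hx => ?_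
    · rw [interior_Icc] at hx
      exact (hd x (hs.trans hx.1)).differentiableAt.differentiableWithinAt
    · rw [interior_Icc] at hx
      have hx0 := hs.trans hx.1
      rw [(hd x hx0).deriv]
      have h1 : 0 ≤ outerP ω n x / x * outerP ω n x := by
        rw [div_mul_eq_mul_div]; exact div_nonneg (mul_self_nonneg _) hx0.le
      have h2 : 0 ≤ outerF ω n x * ((n ^ 2 / x - ω ^ 2 * x) * outerF ω n x) := by
        rw [mul_left_comm]; exact mul_nonneg (hq x hx0 hx.2).le (mul_self_nonneg _)
      linarith
  -- strictness comes from a neighbourhood of `s = 3`, where the derivative is positive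
  by_contra hcon
  push Not at hcon
  have h3 : outerF ω n 3 * outerP ω n 3 = 0 := by rw [outerF_three, zero_mul]
  have hz : ∀ x ∈ Icc s 3, outerF ω n x * outerP ω n x = 0 := by
    intro x hx
    have h1 := hmono (left_mem_Icc.2 hs3.le) hx hx.1
    have h2 := hmono hx (right_mem_Icc.2 hs3.le) hx.2
    simp only [h3] at h1 h2
    linarith
  have hd3 := hd 3 (by norm_num)
  have hpos : 0 < outerP ω n 3 := by rw [outerP_three hω]; positivity
  have hu : UniqueDiffWithinAt ℝ (Icc s 3) 3 := uniqueDiffOn_Icc hs3 _ (right_mem_Icc.2 hs3.le)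
  have h0 : HasDerivWithinAt (fun x => outerF ω n x * outerP ω n x) 0 (Icc s 3) 3 :=
    (hasDerivWithinAt_const (3 : ℝ) _ (0 : ℝ)).congr (fun x hx => hz x hx)
      (hz 3 (right_mem_Icc.2 hs3.le))
  have := hu.eq_deriv _ hd3.hasDerivWithinAt h0
  rw [outerF_three] at this
  have h4 : 0 < outerP ω n 3 / 3 * outerP ω n 3 := by positivity
  simp at this
  exact hpos.ne' this

/-! ### Behaviour of the profiles near the origin -/

/-- The function `t ^ n chainY n t`, in a form that extends continuously to `t = 0` if `n ≥ 1`. -/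
lemma pow_mul_chainY (n : ℕ) {t : ℝ} (ht : 0 < t) :
    t ^ n * chainY n t = t ^ n * Real.log t * chainJ n t + regY n t := by
  rw [chainY]; field_simp

lemma tendsto_pow_mul_chainY (n : ℕ) :
    Tendsto (fun t => t ^ (n + 1) * chainY (n + 1) t) (𝓝[>] 0) (𝓝 (-(n.factorial : ℝ))) := by
  have hc : Continuous fun t : ℝ => t ^ n * (t * Real.log t) * chainJ (n + 1) t + regY (n + 1) t :=
    (((continuous_pow n).mul Real.continuous_mul_log).mul (continuous_chainJ _)).add
      (continuous_regY _)
  have h := hc.tendsto 0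
  simp only [Real.log_zero, mul_zero, zero_mul, zero_add, regY_succ_zero] at h
  refine (h.mono_left nhdsWithin_le_nhds).congr' ?_
  filter_upwards [self_mem_nhdsWithin] with t ht
  rw [pow_mul_chainY _ ht]
  ring

lemma tendsto_sq_mul (k : ℝ) (hk : 0 < k) :
    Tendsto (fun s : ℝ => k ^ 2 * s ^ 2 / 4) (𝓝[>] 0) (𝓝[>] 0) := by
  refine tendsto_nhdsWithin_iff.2 ⟨?_, ?_⟩
  · have : Continuous fun s : ℝ => k ^ 2 * s ^ 2 / 4 := by fun_prop
    simpa using (this.tendsto 0).mono_left nhdsWithin_le_nhds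
  · filter_upwards [self_mem_nhdsWithin] with s hs
    have : 0 < s := hs
    exact mem_Ioi.2 (by positivity)

lemma tendsto_pow_mul_modeF_chainY {k : ℝ} (hk : 0 < k) (n : ℕ) :
    Tendsto (fun s => s ^ (n + 1) * modeF chainY k (n + 1) s) (𝓝[>] 0)
      (𝓝 (-((4 / k ^ 2) ^ (n + 1) * n.factorial))) := by
  have h := ((tendsto_pow_mul_chainY n).comp (tendsto_sq_mul k hk)).const_mul ((4 / k ^ 2) ^ (n + 1))
  rw [mul_neg] at h
  refine h.congr fun s => ?_
  simp only [Function.comp, modeF]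
  rw [show k ^ 2 * s ^ 2 / 4 = (k ^ 2 / 4) * s ^ 2 by ring, mul_pow, ← mul_assoc, ← mul_assoc,
    ← mul_pow, show 4 / k ^ 2 * (k ^ 2 / 4) = 1 by field_simp]
  ring

lemma tendsto_pow_mul_modeP_chainY {k : ℝ} (hk : 0 < k) (n : ℕ) :
    Tendsto (fun s => s ^ n * (k ^ 2 / 2 * s ^ (n + 2) * chainY (n + 1) (k ^ 2 * s ^ 2 / 4)))
      (𝓝[>] 0) (𝓝 (-(2 * (4 / k ^ 2) ^ n * n.factorial))) := by
  have h := ((tendsto_pow_mul_chainY n).comp (tendsto_sq_mul k hk)).const_mul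
    (2 * (4 / k ^ 2) ^ n)
  rw [mul_neg] at h
  refine h.congr fun s => ?_
  simp only [Function.comp]
  have e : (4 / k ^ 2) ^ n * (k ^ 2 * s ^ 2 / 4) ^ (n + 1) = s ^ (2 * n + 2) * (k ^ 2 / 4) := by
    rw [show k ^ 2 * s ^ 2 / 4 = (k ^ 2 / 4) * s ^ 2 by ring, mul_pow, pow_succ (k ^ 2 / 4),
      ← mul_assoc, ← mul_assoc, ← mul_pow, show 4 / k ^ 2 * (k ^ 2 / 4) = 1 by field_simp,
      ← pow_mul]
    ring
  linear_combination (2 * chainY (n + 1) (k ^ 2 * s ^ 2 / 4)) * e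

lemma tendsto_pow_mul_of_continuous {f : ℝ → ℝ} (hf : Continuous f) (n : ℕ) :
    Tendsto (fun s => s ^ (n + 1) * f s) (𝓝[>] 0) (𝓝 0) := by
  have h : Continuous fun s => s ^ (n + 1) * f s := by fun_prop
  simpa using (h.tendsto 0).mono_left nhdsWithin_le_nhds

/-- The outer profile blows up at the origin. -/
lemma tendsto_abs_outerF (hω : 0 < ω) (n : ℕ) (h3 : modeF chainJ ω n 3 ≠ 0) :
    Tendsto (fun s => |outerF ω n s|) (𝓝[>] 0) atTop := by
  rcases n with _ | n
  · have hlog : Tendsto (fun s => Real.log (ω ^ 2 * s ^ 2 / 4)) (𝓝[>] 0) atBot :=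
      Real.tendsto_log_nhdsGT_zero.comp (tendsto_sq_mul ω hω)
    have hJ : Tendsto (fun s => modeF chainJ ω 0 3 * chainJ 0 (ω ^ 2 * s ^ 2 / 4)) (𝓝[>] 0)
        (𝓝 (modeF chainJ ω 0 3)) := by
      have hc : Continuous fun s => modeF chainJ ω 0 3 * chainJ 0 (ω ^ 2 * s ^ 2 / 4) := by
        have := continuous_chainJ 0
        fun_prop
      have := (hc.tendsto 0).mono_left (nhdsWithin_le_nhds (s := Ioi 0))
      simpa [chainJ_zero] using this
    have hR : Tendsto (fun s => modeF chainJ ω 0 3 * regY 0 (ω ^ 2 * s ^ 2 / 4)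
        + -modeF chainY ω 0 3 * modeF chainJ ω 0 s) (𝓝[>] 0)
        (𝓝 (modeF chainJ ω 0 3 * regY 0 (ω ^ 2 * 0 ^ 2 / 4)
        + -modeF chainY ω 0 3 * modeF chainJ ω 0 0)) := by
      have hc : Continuous fun s => modeF chainJ ω 0 3 * regY 0 (ω ^ 2 * s ^ 2 / 4)
        + -modeF chainY ω 0 3 * modeF chainJ ω 0 s := by
        have := continuous_regY 0
        have := continuous_modeF_chainJ ω 0
        fun_prop
      exact (hc.tendsto 0).mono_left nhdsWithin_le_nhds
    have key : ∀ s, outerF ω 0 s = modeF chainJ ω 0 3 * chainJ 0 (ω ^ 2 * s ^ 2 / 4)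
        * Real.log (ω ^ 2 * s ^ 2 / 4) + (modeF chainJ ω 0 3 * regY 0 (ω ^ 2 * s ^ 2 / 4)
        + -modeF chainY ω 0 3 * modeF chainJ ω 0 s) := by
      intro s
      rw [outerF_eq]
      simp only [modeF, chainY, pow_zero, one_mul, div_one]
      ring
    simp only [key]
    rcases lt_or_gt_of_ne h3 with h | h
    · exact tendsto_abs_atTop_atTop.comp ((hJ.neg_mul_atBot h hlog).atTop_add hR)
    · exact tendsto_abs_atBot_atTop.comp ((hJ.pos_mul_atBot h hlog).atBot_add hR)
  · have h1 : Tendsto (fun s => s ^ (n + 1) * outerF ω (n + 1) s) (𝓝[>] 0)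
        (𝓝 (modeF chainJ ω (n + 1) 3 * -((4 / ω ^ 2) ^ (n + 1) * n.factorial) +
          -modeF chainY ω (n + 1) 3 * 0)) := by
      refine (((tendsto_pow_mul_modeF_chainY hω n).const_mul _).add
        ((tendsto_pow_mul_of_continuous (continuous_modeF_chainJ ω (n + 1)) n).const_mul
          _)).congr fun s => ?_
      rw [outerF_eq]; ring
    have h2 : Tendsto (fun s : ℝ => (s ^ (n + 1))⁻¹) (𝓝[>] 0) atTop := by
      refine tendsto_inv_nhdsGT_zero.comp (tendsto_nhdsWithin_iff.2 ⟨?_, ?_⟩)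
      · simpa using ((continuous_pow (M := ℝ) (n + 1)).tendsto 0).mono_left nhdsWithin_le_nhds
      · filter_upwards [self_mem_nhdsWithin] with s hs
        exact pow_pos (mem_Ioi.1 hs) (n + 1)
    have hne : 0 < |modeF chainJ ω (n + 1) 3 * -((4 / ω ^ 2) ^ (n + 1) * n.factorial) +
          -modeF chainY ω (n + 1) 3 * 0| := by
      rw [mul_zero, add_zero]
      exact abs_pos.2 (mul_ne_zero h3 (neg_ne_zero.2 (by positivity)))
    refine (h1.abs.pos_mul_atTop hne h2).congr' ?_
    filter_upwards [self_mem_nhdsWithin] with s hs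
    have : (0 : ℝ) < s ^ (n + 1) := pow_pos hs _
    rw [abs_mul, abs_of_pos this]
    field_simp

/-- The Dirichlet-to-Neumann multiplier of the collapsing outer region tends to `-n`: the source of
the non-local boundary condition. -/
lemma tendsto_outerP_div_outerF (hω : 0 < ω) (n : ℕ) (h3 : modeF chainJ ω n 3 ≠ 0) :
    Tendsto (fun s => outerP ω n s / outerF ω n s) (𝓝[>] 0) (𝓝 (-n)) := by
  rcases n with _ | n
  · have hP : Tendsto (fun s => outerP ω 0 s) (𝓝[>] 0)
        (𝓝 (modeF chainJ ω 0 3 * 2 + -modeF chainY ω 0 3 * 0)) := by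
      have h1 : Tendsto (modeP chainY ω 0) (𝓝[>] 0) (𝓝 2) := by
        have := (tendsto_pow_mul_modeP_chainY hω 0).neg
        simp only [pow_zero, Nat.factorial_zero, Nat.cast_one, mul_one, neg_neg] at this
        refine this.congr fun s => ?_
        simp [modeP]
      have h2 : Tendsto (modeP chainJ ω 0) (𝓝[>] 0) (𝓝 0) := by
        have := ((continuous_modeP_chainJ ω 0).tendsto 0).mono_left
          (nhdsWithin_le_nhds (s := Ioi 0))
        simpa [modeP] using this
      refine ((h1.const_mul _).add (h2.const_mul _)).congr fun s => ?_
      rw [outerP_eq]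
    have hF := tendsto_abs_outerF hω 0 h3
    have h := hP.abs.div_atTop hF
    simp only [Nat.cast_zero, neg_zero]
    rw [tendsto_zero_iff_abs_tendsto_zero]
    exact h.congr fun s => (abs_div _ _).symm
  · set c : ℝ := (4 / ω ^ 2) ^ (n + 1) * n.factorial with hc
    have hc0 : c ≠ 0 := by positivity
    have hF : Tendsto (fun s => s ^ (n + 1) * outerF ω (n + 1) s) (𝓝[>] 0)
        (𝓝 (modeF chainJ ω (n + 1) 3 * -c + -modeF chainY ω (n + 1) 3 * 0)) := by
      refine (((tendsto_pow_mul_modeF_chainY hω n).const_mul _).add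
        ((tendsto_pow_mul_of_continuous (continuous_modeF_chainJ ω (n + 1)) n).const_mul
          _)).congr fun s => ?_
      rw [outerF_eq]; ring
    have hP : Tendsto (fun s => s ^ (n + 1) * outerP ω (n + 1) s) (𝓝[>] 0)
        (𝓝 (modeF chainJ ω (n + 1) 3 * ((n + 1 : ℕ) * -c
          - -(2 * (4 / ω ^ 2) ^ (n + 1) * (n + 1).factorial)) +
          -modeF chainY ω (n + 1) 3 * 0)) := by
      refine (((((tendsto_pow_mul_modeF_chainY hω n).const_mul ((n + 1 : ℕ) : ℝ)).sub
        (tendsto_pow_mul_modeP_chainY hω (n + 1))).const_mul _).add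
        ((tendsto_pow_mul_of_continuous (continuous_modeP_chainJ ω (n + 1)) n).const_mul
          _)).congr fun s => ?_
      rw [outerP_eq]
      simp only [modeP]
      ring
    have hne : modeF chainJ ω (n + 1) 3 * -c + -modeF chainY ω (n + 1) 3 * 0 ≠ 0 := by
      rw [mul_zero, add_zero]
      exact mul_ne_zero h3 (neg_ne_zero.2 hc0)
    have h := hP.div hF hne
    have e : (modeF chainJ ω (n + 1) 3 * ((n + 1 : ℕ) * -c
          - -(2 * (4 / ω ^ 2) ^ (n + 1) * (n + 1).factorial)) +
          -modeF chainY ω (n + 1) 3 * 0) / (modeF chainJ ω (n + 1) 3 * -c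
          + -modeF chainY ω (n + 1) 3 * 0) = -((n + 1 : ℕ) : ℝ) := by
      rw [div_eq_iff hne, hc, Nat.factorial_succ]
      push_cast
      ring
    rw [e] at h
    refine h.congr' ?_
    filter_upwards [self_mem_nhdsWithin] with s hs
    exact mul_div_mul_left _ _ (pow_pos hs _).ne'

end outer

/-! ### The radial system of the truncated cloak -/

/-- The radial eigenvalue of `σ_R` at radius `r`. -/
def massRad (σa R r : ℝ) : ℝ := if r ≤ R then σa else if 2 < r then 1 else (r - 1) / r

/-- The tangential eigenvalue of `σ_R` at radius `r`. -/
def massTan (σa R r : ℝ) : ℝ := if r ≤ R then σa else if 2 < r then 1 else r / (r - 1)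

/-- The value of `λ_R` at radius `r`. -/
def modulusRad (la R r : ℝ) : ℝ := if r ≤ R then la else if 2 < r then 1 else r / (4 * (r - 1))

/-- The radial system of order `n` on `[a, b]`: the amplitude `V` and the flux `F` of a Fourier mode
`V(r) e^{±inθ}` are continuous, and away from the interfaces `r σ V' = F` and
`F' = (n² τ / r - ω² r / λ) V`, where `σ` and `τ` are the radial and tangential masses. -/
structure IsModeOn (σa la ω R : ℝ) (n : ℕ) (a b : ℝ) (V F : ℝ → ℂ) : Prop where
  continuousOn : ContinuousOn V (Icc a b)
  continuousOn_flux : ContinuousOn F (Icc a b)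
  hasDerivAt : ∀ r ∈ Ioo a b, r ∉ ({R, 2} : Set ℝ) →
    HasDerivAt V (F r / (massRad σa R r * r : ℝ)) r
  hasDerivAt_flux : ∀ r ∈ Ioo a b, r ∉ ({R, 2} : Set ℝ) →
    HasDerivAt F ((n ^ 2 * massTan σa R r / r - ω ^ 2 * r / modulusRad la R r : ℝ) * V r) r

/-- The radius in the flat plane that the cloak blows up to `r`. -/
def flatRadius (r : ℝ) : ℝ := if 2 < r then r else 2 * (r - 1)

section radial

variable {σa la ω R : ℝ} {n : ℕ}

lemma IsModeOn.mono {a b a' b' : ℝ} {V F : ℝ → ℂ} (h : IsModeOn σa la ω R n a b V F)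
    (ha : a ≤ a') (hb : b' ≤ b) : IsModeOn σa la ω R n a' b' V F where
  continuousOn := h.continuousOn.mono (Icc_subset_Icc ha hb)
  continuousOn_flux := h.continuousOn_flux.mono (Icc_subset_Icc ha hb)
  hasDerivAt r hr := h.hasDerivAt r (Ioo_subset_Ioo ha hb hr)
  hasDerivAt_flux r hr := h.hasDerivAt_flux r (Ioo_subset_Ioo ha hb hr)

lemma IsModeOn.wronskian {a b : ℝ} {V F W G : ℝ → ℂ} (h : IsModeOn σa la ω R n a b V F)
    (h' : IsModeOn σa la ω R n a b W G) (hab : a ≤ b) :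
    V a * G a - F a * W a = V b * G b - F b * W b := by
  have key := integral_eq_of_hasDerivAt_off_countable_of_le
    (fun r => V r * G r - F r * W r) (fun _ => 0) hab (s := {R, 2})
    (Set.Finite.countable (by simp))
    ((h.continuousOn.mul h'.continuousOn_flux).sub (h.continuousOn_flux.mul h'.continuousOn))
    (fun r hr => by
      refine (((h.hasDerivAt r hr.1 hr.2).mul (h'.hasDerivAt_flux r hr.1 hr.2)).sub
        ((h.hasDerivAt_flux r hr.1 hr.2).mul (h'.hasDerivAt r hr.1 hr.2))).congr_deriv ?_
      ring)
    (by simp)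
  simp only [intervalIntegral.integral_zero] at key
  exact (sub_eq_zero.1 key.symm).symm

lemma kappa_pos (hσa : 0 < σa) (hla : 0 < la) : 0 < kappa σa la :=
  inv_pos.2 (Real.sqrt_pos.2 (mul_pos hσa hla))

lemma kappa_sq (hσa : 0 < σa) (hla : 0 < la) : kappa σa la ^ 2 = (σa * la)⁻¹ := by
  rw [kappa, inv_pow, Real.sq_sqrt (mul_pos hσa hla).le]

lemma isModeOn_inner (hσa : 0 < σa) (hla : 0 < la) (hω : 0 < ω) {F : ℕ → ℝ → ℝ}
    (hF : IsBesselChain F) (n : ℕ) {a : ℝ} (ha : 0 < a) :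
    IsModeOn σa la ω R n a R (fun r => (modeF F (kappa σa la * ω) n r : ℂ))
      (fun r => ((σa * modeP F (kappa σa la * ω) n r : ℝ) : ℂ)) := by
  have hk := mul_pos (kappa_pos hσa hla) hω
  have hsub : Icc a R ⊆ Ioi 0 := fun r hr => ha.trans_le hr.1
  refine ⟨Complex.continuous_ofReal.comp_continuousOn ((continuousOn_modeF hF hk n).mono hsub),
    Complex.continuous_ofReal.comp_continuousOn
      (continuousOn_const.mul ((continuousOn_modeP hF hk n).mono hsub)), fun r hr _ => ?_,
    fun r hr _ => ?_⟩
  · have hr0 : 0 < r := ha.trans hr.1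
    refine (hasDerivAt_modeF hF hk n hr0).ofReal_comp.congr_deriv ?_
    rw [massRad, if_pos hr.2.le, ← Complex.ofReal_div]
    congr 1
    field_simp
  · have hr0 : 0 < r := ha.trans hr.1
    refine ((hasDerivAt_modeP hF hk n hr0).const_mul σa).ofReal_comp.congr_deriv ?_
    rw [massTan, if_pos hr.2.le, modulusRad, if_pos hr.2.le, ← Complex.ofReal_mul, mul_pow,
      kappa_sq hσa hla]
    congr 1
    field_simp

lemma continuous_flatRadius : Continuous flatRadius := by
  have : flatRadius = fun r => min r (2 * (r - 1)) := by
    funext r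
    rw [flatRadius]
    split_ifs with h
    · rw [min_eq_left]; linarith
    · rw [min_eq_right]; linarith
  rw [this]
  fun_prop

lemma flatRadius_pos {r : ℝ} (hr : 1 < r) : 0 < flatRadius r := by
  rw [flatRadius]; split_ifs <;> linarith

lemma flatRadius_three : flatRadius 3 = 3 := by rw [flatRadius, if_pos (by norm_num)]

/-- The blow-up map turns profiles of the flat plane into solutions in the cloak. -/
lemma isModeOn_outer (hω : 0 < ω) (hR : 1 < R) {F : ℕ → ℝ → ℝ} (hF : IsBesselChain F) (n : ℕ) :
    IsModeOn σa la ω R n R 3 (fun r => (modeF F ω n (flatRadius r) : ℂ))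
      (fun r => (modeP F ω n (flatRadius r) : ℂ)) := by
  have hmaps : MapsTo flatRadius (Icc R 3) (Ioi 0) := fun r hr => flatRadius_pos (hR.trans_le hr.1)
  have hd : ∀ r ∈ Ioo R 3, r ∉ ({R, 2} : Set ℝ) →
      HasDerivAt flatRadius (if 2 < r then 1 else 2) r := by
    intro r hr hr2
    simp only [mem_insert_iff, mem_singleton_iff, not_or] at hr2
    rcases lt_or_gt_of_ne hr2.2 with h | h
    · rw [if_neg h.not_gt]
      have h1 : HasDerivAt (fun r : ℝ => 2 * (r - 1)) 2 r := by
        simpa using ((hasDerivAt_id r).sub_const 1).const_mul (2 : ℝ)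
      refine h1.congr_of_eventuallyEq ?_
      filter_upwards [gt_mem_nhds h] with x hx
      rw [flatRadius, if_neg hx.not_gt]
    · rw [if_pos h]
      refine (hasDerivAt_id r).congr_of_eventuallyEq ?_
      filter_upwards [lt_mem_nhds h] with x hx
      rw [flatRadius, if_pos hx, id]
  refine ⟨Complex.continuous_ofReal.comp_continuousOn ((continuousOn_modeF hF hω n).comp
      continuous_flatRadius.continuousOn hmaps),
    Complex.continuous_ofReal.comp_continuousOn ((continuousOn_modeP hF hω n).comp
      continuous_flatRadius.continuousOn hmaps), fun r hr hr2 => ?_, fun r hr hr2 => ?_⟩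
  · have hr1 : 1 < r := hR.trans hr.1
    have hs := flatRadius_pos hr1
    refine (((hasDerivAt_modeF hF hω n hs).comp r (hd r hr hr2)).ofReal_comp).congr_deriv ?_
    rw [massRad, if_neg hr.1.not_ge, ← Complex.ofReal_div]
    congr 1
    rw [flatRadius] at hs ⊢
    split_ifs with h
    · simp
    · rw [if_neg h] at hs
      have : r - 1 ≠ 0 := by linarith
      field_simp
  · have hr1 : 1 < r := hR.trans hr.1
    have hs := flatRadius_pos hr1
    refine (((hasDerivAt_modeP hF hω n hs).comp r (hd r hr hr2)).ofReal_comp).congr_deriv ?_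
    rw [massTan, if_neg hr.1.not_ge, modulusRad, if_neg hr.1.not_ge, ← Complex.ofReal_mul]
    congr 1
    rw [flatRadius] at hs ⊢
    split_ifs with h
    · simp
    · rw [if_neg h] at hs
      have : r - 1 ≠ 0 := by linarith
      field_simp
      ring

lemma flatRadius_of_le {r : ℝ} (hr : r ≤ 2) : flatRadius r = 2 * (r - 1) := by
  rw [flatRadius, if_neg hr.not_gt]

/-! ### The determinant of the transmission problem -/

/-- The determinant of the transmission conditions at `r = R` for the mode of order `n`: regular
profile inside, profile vanishing at `r = 3` outside. -/
def modeDet (σa la ω R : ℝ) (n : ℕ) : ℝ :=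
  σa * modeP chainJ (kappa σa la * ω) n R * outerF ω n (2 * (R - 1))
    - modeF chainJ (kappa σa la * ω) n R * outerP ω n (2 * (R - 1))

/-- The value at `R = 1` of the determinant divided by the outer profile. -/
def limitDet (σa la ω : ℝ) (n : ℕ) : ℝ :=
  σa * modeP chainJ (kappa σa la * ω) n 1 + n * modeF chainJ (kappa σa la * ω) n 1

lemma NonResonant.limitDet_ne_zero (hσa : 0 < σa) (hla : 0 < la) (hω : 0 < ω)
    (h : NonResonant σa la ω) (n : ℕ) : limitDet σa la ω n ≠ 0 := by
  have hk := mul_pos (kappa_pos hσa hla) hω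
  have h1 := (h n).1
  rw [(hasDerivAt_besselJ hk n).deriv] at h1
  intro h0
  apply h1
  rw [limitDet, modeF_besselJ hk, mul_one] at h0
  have hp : (2 / (kappa σa la * ω)) ^ n ≠ 0 := by positivity
  generalize kappa σa la * ω = k at *
  generalize (2 / k) ^ n = p at *
  field_simp
  linear_combination h0

lemma NonResonant.modeF_three_ne_zero (hω : 0 < ω) (h : NonResonant σa la ω) (n : ℕ) :
    modeF chainJ ω n 3 ≠ 0 := by
  rw [modeF_besselJ hω, mul_comm ω]
  exact mul_ne_zero (by positivity) (h n).2

lemma tendsto_two_mul_sub_one : Tendsto (fun R : ℝ => 2 * (R - 1)) (𝓝[>] 1) (𝓝[>] 0) := by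
  refine tendsto_nhdsWithin_iff.2 ⟨?_, ?_⟩
  · have : Continuous fun R : ℝ => 2 * (R - 1) := by fun_prop
    simpa using (this.tendsto 1).mono_left nhdsWithin_le_nhds
  · filter_upwards [self_mem_nhdsWithin] with R hR
    have : 1 < R := hR
    exact mem_Ioi.2 (by linarith)

lemma NonResonant.tendsto_modeDet_div (hω : 0 < ω) (h : NonResonant σa la ω) (n : ℕ) :
    Tendsto (fun R => modeDet σa la ω R n / outerF ω n (2 * (R - 1))) (𝓝[>] 1)
      (𝓝 (limitDet σa la ω n)) := by
  have h3 := h.modeF_three_ne_zero hω n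
  have hq := (tendsto_outerP_div_outerF hω n h3).comp tendsto_two_mul_sub_one
  have habs := (tendsto_abs_outerF hω n h3).comp tendsto_two_mul_sub_one
  have hP := ((continuous_modeP_chainJ (kappa σa la * ω) n).tendsto 1).mono_left
    (nhdsWithin_le_nhds (s := Ioi 1))
  have hF := ((continuous_modeF_chainJ (kappa σa la * ω) n).tendsto 1).mono_left
    (nhdsWithin_le_nhds (s := Ioi 1))
  have hlim := (hP.const_mul σa).sub (hF.mul hq)
  have e : limitDet σa la ω n = σa * modeP chainJ (kappa σa la * ω) n 1
      - modeF chainJ (kappa σa la * ω) n 1 * -n := by rw [limitDet]; ring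
  rw [e]
  refine hlim.congr' ?_
  filter_upwards [habs.eventually_gt_atTop 0] with R hR
  have hw : outerF ω n (2 * (R - 1)) ≠ 0 := abs_pos.1 hR
  simp only [modeDet, Function.comp]
  field_simp

/-- For `R` close to `1` no mode is resonant. For high orders this is a matter of signs, for each
of the remaining finitely many orders it is the non-resonance hypothesis. -/
lemma NonResonant.eventually_modeDet_ne_zero (hσa : 0 < σa) (hla : 0 < la) (hω : 0 < ω)
    (h : NonResonant σa la ω) : ∀ᶠ R in 𝓝[>] (1 : ℝ), ∀ n, modeDet σa la ω R n ≠ 0 := by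
  have hk := mul_pos (kappa_pos hσa hla) hω
  obtain ⟨n₀, hn₀⟩ := exists_nat_ge (max (kappa σa la * ω * 2) (3 * ω))
  have hsmall : ∀ᶠ R in 𝓝[>] (1 : ℝ), ∀ n ∈ Finset.range (n₀ + 1), modeDet σa la ω R n ≠ 0 := by
    rw [Filter.eventually_all_finset]
    intro n _
    filter_upwards [(h.tendsto_modeDet_div hω n).eventually_ne
      (h.limitDet_ne_zero hσa hla hω n)] with R hR h0
    exact hR (by rw [h0, zero_div])
  filter_upwards [hsmall, Ioo_mem_nhdsGT (show (1 : ℝ) < 2 by norm_num)] with R hR hR12 n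
  rcases lt_or_ge n (n₀ + 1) with hn | hn
  · exact hR n (Finset.mem_range.2 hn)
  · have hn' : (n₀ : ℝ) ≤ n := by exact_mod_cast (Nat.le_succ n₀).trans hn
    have h1 : kappa σa la * ω * 2 ≤ n := (le_max_left _ _).trans (hn₀.trans hn')
    have h2 : 3 * ω ≤ n := (le_max_right _ _).trans (hn₀.trans hn')
    have hj := modeF_mul_modeP_pos hk h1 (by omega) (by linarith [hR12.1]) hR12.2
    have hw := outerF_mul_outerP_neg hω h2 (s := 2 * (R - 1)) (by linarith [hR12.1])
      (by linarith [hR12.2])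
    intro h0
    rw [modeDet] at h0
    generalize modeP chainJ (kappa σa la * ω) n R = p at *
    generalize modeF chainJ (kappa σa la * ω) n R = f at *
    generalize outerF ω n (2 * (R - 1)) = w at *
    generalize outerP ω n (2 * (R - 1)) = q at *
    have hw0 : w ≠ 0 := by rintro rfl; simp at hw
    -- `f w · modeDet` is a sum of two terms of the same sign, since `f p > 0 > w q`
    have e : σa * (f * p) * (w * w) - f * f * (w * q) = 0 := by linear_combination (f * w) * h0
    have e1 : 0 < σa * (f * p) * (w * w) := mul_pos (mul_pos hσa hj) (mul_self_pos.2 hw0)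
    have e2 : 0 ≤ -(f * f * (w * q)) := by
      rw [← mul_neg]; exact mul_nonneg (mul_self_nonneg _) (by linarith)
    linarith

/-- Uniqueness for the radial system: a mode that is regular at the origin, in the form of a
Wronskian condition against the regular profile, and vanishes at `r = 3` is zero. -/
lemma IsModeOn.eq_zero (hσa : 0 < σa) (hla : 0 < la) (hω : 0 < ω) (hR : 1 < R) (hR2 : R < 2)
    (hdet : modeDet σa la ω R n ≠ 0) {V F : ℝ → ℂ}
    (h : ∀ a, 0 < a → a ≤ 3 → IsModeOn σa la ω R n a 3 V F) (h3 : V 3 = 0) {a : ℝ} (ha : 0 < a)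
    (haR : a ≤ R)
    (hreg : V a * (σa * modeP chainJ (kappa σa la * ω) n a : ℝ)
      - F a * (modeF chainJ (kappa σa la * ω) n a : ℝ) = 0) :
    ∀ r, 0 < r → r ≤ 3 → V r = 0 := by
  have hk := mul_pos (kappa_pos hσa hla) hω
  have hR0 : 0 < R := by linarith
  -- Wronskians with the known solutions are constant, on either side of the interface
  have inner : ∀ {G : ℕ → ℝ → ℝ} (_ : IsBesselChain G) {x : ℝ}, 0 < x → x ≤ R →
      V x * (σa * modeP G (kappa σa la * ω) n x : ℝ) - F x * (modeF G (kappa σa la * ω) n x : ℝ)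
      = V R * (σa * modeP G (kappa σa la * ω) n R : ℝ)
        - F R * (modeF G (kappa σa la * ω) n R : ℝ) := fun hG x hx hxR =>
    ((h x hx (by linarith)).mono le_rfl (by linarith)).wronskian
      (isModeOn_inner hσa hla hω hG n hx) hxR
  have outer : ∀ {G : ℕ → ℝ → ℝ} (_ : IsBesselChain G) {x : ℝ}, R ≤ x → x ≤ 3 →
      V R * (modeP G ω n (flatRadius R) : ℝ) - F R * (modeF G ω n (flatRadius R) : ℝ)
      = V x * (modeP G ω n (flatRadius x) : ℝ) - F x * (modeF G ω n (flatRadius x) : ℝ) :=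
    fun hG x hxR hx => ((h R hR0 (by linarith)).mono le_rfl hx).wronskian
      ((isModeOn_outer hω hR hG n).mono le_rfl hx) hxR
  -- regularity at the origin and `V 3 = 0` give two equations for `(V R, F R)`, with determinant
  -- `modeDet`
  have e1 := (inner isBesselChain_chainJ ha haR).symm.trans hreg
  have e2 := outer (isBesselChain_dirichletChain ω n) (x := 3) (by linarith) le_rfl
  rw [h3, flatRadius_three, zero_mul, flatRadius_of_le hR2.le] at e2
  change V R * (outerP ω n (2 * (R - 1)) : ℝ) - F R * (outerF ω n (2 * (R - 1)) : ℝ)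
    = 0 - F 3 * (outerF ω n 3 : ℝ) at e2
  rw [outerF_three, Complex.ofReal_zero, mul_zero, sub_zero] at e2
  have hdet' : (modeDet σa la ω R n : ℂ) ≠ 0 := by exact_mod_cast hdet
  have hV : V R = 0 := by
    refine (mul_eq_zero.1 (?_ : (modeDet σa la ω R n : ℂ) * V R = 0)).resolve_left hdet'
    rw [modeDet]
    push_cast at e1 e2 ⊢
    linear_combination (outerF ω n (2 * (R - 1)) : ℂ) * e1
      - (modeF chainJ (kappa σa la * ω) n R : ℂ) * e2
  have hF : F R = 0 := by
    refine (mul_eq_zero.1 (?_ : (modeDet σa la ω R n : ℂ) * F R = 0)).resolve_left hdet'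
    rw [modeDet]
    push_cast at e1 e2 ⊢
    linear_combination (outerP ω n (2 * (R - 1)) : ℂ) * e1
      - (σa * modeP chainJ (kappa σa la * ω) n R : ℂ) * e2
  -- the Wronskians with both solutions vanish, so that `V` vanishes on each side
  intro r hr hr3
  rcases le_total r R with hrR | hrR
  · have i1 := inner isBesselChain_chainJ hr hrR
    have i2 := inner isBesselChain_chainY hr hrR
    rw [hV, hF, zero_mul, zero_mul, sub_zero] at i1 i2
    have hw := modeF_wronskian (k := kappa σa la * ω) hk n hr
    have hw' : (modeF chainJ (kappa σa la * ω) n r * modeP chainY (kappa σa la * ω) n r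
      - modeF chainY (kappa σa la * ω) n r * modeP chainJ (kappa σa la * ω) n r : ℂ) ≠ 0 := by
      have : (2 * (4 / (kappa σa la * ω) ^ 2) ^ n : ℝ) ≠ 0 := by positivity
      rw [← hw] at this
      exact_mod_cast this
    refine (mul_eq_zero.1 ?_).resolve_left hw'
    have hs : (σa : ℂ) ≠ 0 := by exact_mod_cast hσa.ne'
    refine (mul_eq_zero.1 ?_).resolve_left hs
    push_cast at i1 i2 ⊢
    linear_combination (modeF chainJ (kappa σa la * ω) n r : ℂ) * i2
      - (modeF chainY (kappa σa la * ω) n r : ℂ) * i1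
  · have i1 := outer isBesselChain_chainJ hrR hr3
    have i2 := outer isBesselChain_chainY hrR hr3
    rw [hV, hF, zero_mul, zero_mul, sub_zero] at i1 i2
    have hs := flatRadius_pos (hR.trans_le hrR)
    have hw := modeF_wronskian (k := ω) hω n hs
    have hw' : (modeF chainJ ω n (flatRadius r) * modeP chainY ω n (flatRadius r)
      - modeF chainY ω n (flatRadius r) * modeP chainJ ω n (flatRadius r) : ℂ) ≠ 0 := by
      have : (2 * (4 / ω ^ 2) ^ n : ℝ) ≠ 0 := by positivity
      rw [← hw] at this
      exact_mod_cast this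
    refine (mul_eq_zero.1 ?_).resolve_left hw'
    linear_combination (modeF chainY ω n (flatRadius r) : ℂ) * i1
      - (modeF chainJ ω n (flatRadius r) : ℂ) * i2

/-! ### The modes radiated by a point source -/

/-- The amplitude of the regular profile inside, if the singular profile has amplitude one. -/
def innerAmp (σa la ω R : ℝ) (n : ℕ) : ℝ :=
  (modeF chainY (kappa σa la * ω) n R * outerP ω n (2 * (R - 1))
    - σa * modeP chainY (kappa σa la * ω) n R * outerF ω n (2 * (R - 1))) / modeDet σa la ω R n

/-- The amplitude of the outer profile, if the singular profile inside has amplitude one. -/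
def outerAmp (σa la ω R : ℝ) (n : ℕ) : ℝ :=
  -(σa * (2 * (4 / (kappa σa la * ω) ^ 2) ^ n)) / modeDet σa la ω R n

/-- The amplitude at radius `r` of the mode whose singular part has amplitude one. -/
def radiatedV (σa la ω R : ℝ) (n : ℕ) (r : ℝ) : ℝ :=
  if r ≤ R then innerAmp σa la ω R n * modeF chainJ (kappa σa la * ω) n r
    + modeF chainY (kappa σa la * ω) n r
  else outerAmp σa la ω R n * outerF ω n (flatRadius r)

/-- The flux at radius `r` of the mode whose singular part has amplitude one. -/
def radiatedF (σa la ω R : ℝ) (n : ℕ) (r : ℝ) : ℝ :=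
  if r ≤ R then σa * (innerAmp σa la ω R n * modeP chainJ (kappa σa la * ω) n r
    + modeP chainY (kappa σa la * ω) n r)
  else outerAmp σa la ω R n * outerP ω n (flatRadius r)

lemma radiated_match (hσa : 0 < σa) (hla : 0 < la) (hω : 0 < ω) (hR : 1 < R)
    (hdet : modeDet σa la ω R n ≠ 0) :
    innerAmp σa la ω R n * modeF chainJ (kappa σa la * ω) n R
        + modeF chainY (kappa σa la * ω) n R = outerAmp σa la ω R n * outerF ω n (2 * (R - 1)) ∧
    σa * (innerAmp σa la ω R n * modeP chainJ (kappa σa la * ω) n R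
        + modeP chainY (kappa σa la * ω) n R)
      = outerAmp σa la ω R n * outerP ω n (2 * (R - 1)) := by
  have hk := mul_pos (kappa_pos hσa hla) hω
  have hw := modeF_wronskian hk n (show 0 < R by linarith)
  rw [innerAmp, outerAmp, ← hw]
  constructor
  · field_simp
    rw [modeDet]
    ring
  · field_simp
    rw [modeDet]
    ring

lemma isModeOn_radiated (hσa : 0 < σa) (hla : 0 < la) (hω : 0 < ω) (hR : 1 < R) (hR2 : R < 2)
    (hdet : modeDet σa la ω R n ≠ 0) {a : ℝ} (ha : 0 < a) :
    IsModeOn σa la ω R n a 3 (fun r => (radiatedV σa la ω R n r : ℂ))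
      (fun r => (radiatedF σa la ω R n r : ℂ)) := by
  obtain ⟨m1, m2⟩ := radiated_match hσa hla hω hR hdet
  set A := innerAmp σa la ω R n
  set B := outerAmp σa la ω R n
  have hchain : IsBesselChain fun n t => A * chainJ n t + 1 * chainY n t :=
    isBesselChain_chainJ.linComb isBesselChain_chainY _ _
  have hin := isModeOn_inner (R := R) hσa hla hω hchain n ha
  have hout := isModeOn_outer (σa := σa) (la := la) hω hR (isBesselChain_dirichletChain ω n) n
  have ein : ∀ r ≤ R, radiatedV σa la ω R n r
      = modeF (fun n t => A * chainJ n t + 1 * chainY n t) (kappa σa la * ω) n r := by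
    intro r hr
    rw [radiatedV, if_pos hr, modeF_linComb, one_mul]
  have einF : ∀ r ≤ R, radiatedF σa la ω R n r
      = σa * modeP (fun n t => A * chainJ n t + 1 * chainY n t) (kappa σa la * ω) n r := by
    intro r hr
    rw [radiatedF, if_pos hr, modeP_linComb, one_mul]
  have eout : ∀ r, R ≤ r → radiatedV σa la ω R n r
      = B * modeF (dirichletChain ω n) ω n (flatRadius r) := by
    intro r hr
    rcases hr.eq_or_lt with rfl | hr
    · rw [radiatedV, if_pos le_rfl, flatRadius_of_le hR2.le]; exact m1
    · rw [radiatedV, if_neg hr.not_ge]; rfl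
  have eoutF : ∀ r, R ≤ r → radiatedF σa la ω R n r
      = B * modeP (dirichletChain ω n) ω n (flatRadius r) := by
    intro r hr
    rcases hr.eq_or_lt with rfl | hr
    · rw [radiatedF, if_pos le_rfl, flatRadius_of_le hR2.le]; exact m2
    · rw [radiatedF, if_neg hr.not_ge]; rfl
  have hsub : Icc a 3 ⊆ Icc a R ∪ Icc R 3 := by
    intro r hr
    rcases le_total r R with h | h
    · exact Or.inl ⟨hr.1, h⟩
    · exact Or.inr ⟨h, hr.2⟩
  refine ⟨(ContinuousOn.union_of_isClosed ?_ ?_ isClosed_Icc isClosed_Icc).mono hsub,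
    (ContinuousOn.union_of_isClosed ?_ ?_ isClosed_Icc isClosed_Icc).mono hsub, ?_, ?_⟩
  · exact hin.continuousOn.congr fun r hr => by simp only [ein r hr.2]
  · refine (hout.continuousOn.const_mul (B : ℂ)).congr fun r hr => ?_
    simp only [eout r hr.1, Complex.ofReal_mul]
  · exact hin.continuousOn_flux.congr fun r hr => by simp only [einF r hr.2]
  · refine (hout.continuousOn_flux.const_mul (B : ℂ)).congr fun r hr => ?_
    simp only [eoutF r hr.1, Complex.ofReal_mul]
  · intro r hr hr2
    have hne : r ≠ R := fun h => hr2 (by simp [h])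
    rcases lt_or_gt_of_ne hne with h | h
    · refine ((hin.hasDerivAt r ⟨hr.1, h⟩ hr2).congr_of_eventuallyEq ?_).congr_deriv ?_
      · filter_upwards [gt_mem_nhds h] with x hx
        simp only [ein x (le_of_lt hx)]
      · simp only [einF r h.le]
    · refine (((hout.hasDerivAt r ⟨h, hr.2⟩ hr2).const_mul (B : ℂ)).congr_of_eventuallyEq
        ?_).congr_deriv ?_
      · filter_upwards [lt_mem_nhds h] with x hx
        simp only [eout x (le_of_lt hx), Complex.ofReal_mul]
      · simp only [eoutF r h.le, Complex.ofReal_mul, mul_div_assoc]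
  · intro r hr hr2
    have hne : r ≠ R := fun h => hr2 (by simp [h])
    rcases lt_or_gt_of_ne hne with h | h
    · refine ((hin.hasDerivAt_flux r ⟨hr.1, h⟩ hr2).congr_of_eventuallyEq ?_).congr_deriv ?_
      · filter_upwards [gt_mem_nhds h] with x hx
        simp only [einF x (le_of_lt hx)]
      · simp only [ein r h.le]
    · refine (((hout.hasDerivAt_flux r ⟨h, hr.2⟩ hr2).const_mul (B : ℂ)).congr_of_eventuallyEq
        ?_).congr_deriv ?_
      · filter_upwards [lt_mem_nhds h] with x hx
        simp only [eoutF x (le_of_lt hx), Complex.ofReal_mul]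
      · simp only [eout r h.le, Complex.ofReal_mul]
        ring

lemma radiatedV_three (hR2 : R < 2) : radiatedV σa la ω R n 3 = 0 := by
  rw [radiatedV, if_neg (by linarith), flatRadius_three, outerF_three, mul_zero]

/-- The limit of `innerAmp` as `R → 1`. -/
def limitAmp (σa la ω : ℝ) (n : ℕ) : ℝ :=
  -(n * modeF chainY (kappa σa la * ω) n 1 + σa * modeP chainY (kappa σa la * ω) n 1)
    / limitDet σa la ω n

lemma NonResonant.tendsto_innerAmp (hσa : 0 < σa) (hla : 0 < la) (hω : 0 < ω)
    (h : NonResonant σa la ω) (n : ℕ) :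
    Tendsto (fun R => innerAmp σa la ω R n) (𝓝[>] 1) (𝓝 (limitAmp σa la ω n)) := by
  have hk := mul_pos (kappa_pos hσa hla) hω
  have h3 := h.modeF_three_ne_zero hω n
  have hq := (tendsto_outerP_div_outerF hω n h3).comp tendsto_two_mul_sub_one
  have habs := (tendsto_abs_outerF hω n h3).comp tendsto_two_mul_sub_one
  have hP := (hasDerivAt_modeP isBesselChain_chainY hk n one_pos).continuousAt.tendsto.mono_left
    (nhdsWithin_le_nhds (s := Ioi 1))
  have hF := (hasDerivAt_modeF isBesselChain_chainY hk n one_pos).continuousAt.tendsto.mono_left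
    (nhdsWithin_le_nhds (s := Ioi 1))
  have hlim := ((hF.mul hq).sub (hP.const_mul σa)).div (h.tendsto_modeDet_div hω n)
    (h.limitDet_ne_zero hσa hla hω n)
  have e : limitAmp σa la ω n = (modeF chainY (kappa σa la * ω) n 1 * -n
      - σa * modeP chainY (kappa σa la * ω) n 1) / limitDet σa la ω n := by
    rw [limitAmp]; ring
  rw [e]
  refine hlim.congr' ?_
  filter_upwards [habs.eventually_gt_atTop 0] with R hR
  have hw : outerF ω n (2 * (R - 1)) ≠ 0 := abs_pos.1 hR
  simp only [innerAmp, Function.comp, Pi.div_apply]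
  rw [← div_div_div_cancel_right₀ hw _ (modeDet σa la ω R n)]
  congr 1
  field_simp

lemma NonResonant.tendsto_outerAmp (hσa : 0 < σa) (hla : 0 < la) (hω : 0 < ω)
    (h : NonResonant σa la ω) (n : ℕ) :
    Tendsto (fun R => outerAmp σa la ω R n) (𝓝[>] 1) (𝓝 0) := by
  have h3 := h.modeF_three_ne_zero hω n
  have habs := (tendsto_abs_outerF hω n h3).comp tendsto_two_mul_sub_one
  have hinv : Tendsto (fun R => (outerF ω n (2 * (R - 1)))⁻¹) (𝓝[>] 1) (𝓝 0) := by
    rw [tendsto_zero_iff_abs_tendsto_zero]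
    exact habs.inv_tendsto_atTop.congr fun R => (abs_inv _).symm
  have hlim := (hinv.const_mul (-(σa * (2 * (4 / (kappa σa la * ω) ^ 2) ^ n)))).div
    (h.tendsto_modeDet_div hω n) (h.limitDet_ne_zero hσa hla hω n)
  rw [mul_zero, zero_div] at hlim
  refine hlim.congr' ?_
  filter_upwards [habs.eventually_gt_atTop 0] with R hR
  have hw : outerF ω n (2 * (R - 1)) ≠ 0 := abs_pos.1 hR
  simp only [outerAmp, Pi.div_apply]
  rw [← div_eq_mul_inv, div_div_div_cancel_right₀ hw]

end radial

/-! ### Integration in polar coordinates -/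

/-- The unit vector with angle `θ`. -/
def circ (θ : ℝ) : ℂ := Complex.exp (θ * Complex.I)

/-- The point with polar coordinates `(r, θ)`. -/
def pt (r θ : ℝ) : ℂ := r * circ θ

lemma continuous_circ : Continuous circ := by unfold circ; fun_prop

lemma norm_circ (θ : ℝ) : ‖circ θ‖ = 1 := Complex.norm_exp_ofReal_mul_I θ

lemma circ_ne_zero (θ : ℝ) : circ θ ≠ 0 := Complex.exp_ne_zero _

lemma norm_pt (r θ : ℝ) : ‖pt r θ‖ = |r| := by simp [pt, norm_circ]

lemma norm_pt_of_pos {r : ℝ} (hr : 0 < r) (θ : ℝ) : ‖pt r θ‖ = r := by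
  rw [norm_pt, abs_of_pos hr]

lemma continuous_pt : Continuous fun p : ℝ × ℝ => pt p.1 p.2 := by unfold pt circ; fun_prop

lemma circ_eq (θ : ℝ) : circ θ = Real.cos θ + Real.sin θ * Complex.I := by
  rw [circ, Complex.exp_mul_I, Complex.ofReal_cos, Complex.ofReal_sin]

lemma circ_re (θ : ℝ) : (circ θ).re = Real.cos θ := by rw [circ]; exact Complex.exp_ofReal_mul_I_re θ

lemma circ_im (θ : ℝ) : (circ θ).im = Real.sin θ := by rw [circ]; exact Complex.exp_ofReal_mul_I_im θ

lemma hasDerivAt_circ (θ : ℝ) : HasDerivAt circ (Complex.I * circ θ) θ := by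
  have h : HasDerivAt (fun θ : ℝ => (θ : ℂ) * Complex.I) (1 * Complex.I) θ :=
    (HasDerivAt.ofReal_comp (hasDerivAt_id θ)).mul_const _
  refine h.cexp.congr_deriv ?_
  rw [circ]; ring

lemma hasDerivAt_pt_left (r θ : ℝ) : HasDerivAt (fun r => pt r θ) (circ θ) r := by
  have h : HasDerivAt (fun r : ℝ => (r : ℂ) * circ θ) (1 * circ θ) r :=
    (HasDerivAt.ofReal_comp (hasDerivAt_id r)).mul_const _
  rw [one_mul] at h
  exact h

lemma hasDerivAt_pt_right (r θ : ℝ) : HasDerivAt (pt r) (r * (Complex.I * circ θ)) θ :=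
  (hasDerivAt_circ θ).const_mul _

lemma exists_pt (z : ℂ) : ∃ θ, z = pt ‖z‖ θ :=
  ⟨Complex.arg z, (Complex.norm_mul_exp_arg_mul_I z).symm⟩

lemma integrableOn_polar {f : ℂ → ℂ} (hf : Integrable f) :
    IntegrableOn (fun p : ℝ × ℝ => (p.1 : ℂ) * f (pt p.1 p.2))
      (Ioi (0 : ℝ) ×ˢ Ioo (-Real.pi) Real.pi) := by
  have h1 : Integrable (f ∘ Complex.measurableEquivRealProd.symm) :=
    (Complex.volume_preserving_equiv_real_prod.symm).integrable_comp_of_integrable hf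
  have h2 := (integrableOn_image_iff_integrableOn_abs_det_fderiv_smul volume
    polarCoord.open_target.measurableSet
    (fun p _ => (hasFDerivAt_polarCoord_symm p).hasFDerivWithinAt) polarCoord.symm.injOn
    (f ∘ Complex.measurableEquivRealProd.symm)).1 h1.integrableOn
  refine (h2.congr_fun ?_ polarCoord.open_target.measurableSet)
  intro p hp
  have hp1 : 0 < p.1 := hp.1
  simp only [Function.comp, det_fderivPolarCoordSymm, abs_of_pos hp1,
    Complex.measurableEquivRealProd_symm_polarCoord_symm_apply, Complex.polarCoord_symm_apply,
    Complex.real_smul, pt, circ_eq]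

/-- Integration in polar coordinates of a function supported in the annulus `a ≤ |z| < 3`. -/
lemma integral_polar {f : ℂ → ℂ} (hf : Integrable f) {a : ℝ} (ha : 0 ≤ a) (ha3 : a ≤ 3)
    (h0 : ∀ z, ‖z‖ < a ∨ 3 ≤ ‖z‖ → f z = 0) :
    ∫ z, f z = ∫ r in a..3, (r : ℂ) * ∫ θ in (-Real.pi)..Real.pi, f (pt r θ) := by
  have h1 := integrableOn_polar hf
  rw [← Complex.integral_comp_polarCoord_symm]
  have e : (∫ p in polarCoord.target, p.1 • f (Complex.polarCoord.symm p))
      = ∫ p in Ioi (0 : ℝ) ×ˢ Ioo (-Real.pi) Real.pi, (p.1 : ℂ) * f (pt p.1 p.2) := by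
    refine integral_congr_ae (ae_of_all _ fun p => ?_)
    simp only [Complex.polarCoord_symm_apply, Complex.real_smul, pt, circ_eq]
  rw [e, Measure.volume_eq_prod, setIntegral_prod _ h1]
  have hpi : -Real.pi ≤ Real.pi := by linarith [Real.pi_pos]
  rw [intervalIntegral.integral_of_le ha3]
  have hsub : Ioc a 3 ⊆ Ioi 0 := fun r hr => ha.trans_lt hr.1
  have e2 : ∀ r : ℝ, (∫ θ in Ioo (-Real.pi) Real.pi, (r : ℂ) * f (pt r θ))
      = (r : ℂ) * ∫ θ in (-Real.pi)..Real.pi, f (pt r θ) := by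
    intro r
    rw [intervalIntegral.integral_of_le hpi, integral_Ioc_eq_integral_Ioo, integral_const_mul]
  simp only [e2]
  refine (setIntegral_eq_of_subset_of_ae_sdiff_eq_zero measurableSet_Ioi.nullMeasurableSet
    hsub ?_).symm.symm
  have hne : ∀ᵐ r : ℝ, r ≠ a := by
    simp [ae_iff, measure_singleton]
  filter_upwards [hne] with r hra hr
  have hr0 : 0 < r := hr.1
  have hcase : r < a ∨ 3 ≤ r := by
    by_contra hcon
    push Not at hcon
    exact hr.2 ⟨lt_of_le_of_ne hcon.1 (Ne.symm hra), hcon.2.le⟩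
  have : ∀ θ, f (pt r θ) = 0 := fun θ => h0 _ (by rwa [norm_pt_of_pos hr0])
  simp [this]

/-! ### Angular averages -/

/-- The integral of `φ` over the circle of radius `r` against the angular weight `a dθ`. -/
def ang (a : ℝ → ℂ) (φ : ℂ → ℝ) (r : ℝ) : ℂ :=
  ∫ θ in (-Real.pi)..Real.pi, a θ * (φ (pt r θ) : ℂ)

/-- The integral of the radial derivative of `φ` against the angular weight `a dθ`. -/
def angRad (a : ℝ → ℂ) (φ : ℂ → ℝ) (r : ℝ) : ℂ :=
  ∫ θ in (-Real.pi)..Real.pi, a θ * (fderiv ℝ φ (pt r θ) (circ θ) : ℂ)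

lemma continuous_fderiv_apply_pt {φ : ℂ → ℝ} (hφ : ContDiff ℝ 1 φ) {c : ℝ → ℂ} (hc : Continuous c) :
    Continuous fun p : ℝ × ℝ => (fderiv ℝ φ (pt p.1 p.2) (c p.2) : ℂ) :=
  Complex.continuous_ofReal.comp
    (((hφ.continuous_fderiv one_ne_zero).comp continuous_pt).clm_apply (hc.comp continuous_snd))

lemma continuous_ang {a : ℝ → ℂ} (ha : Continuous a) {φ : ℂ → ℝ} (hφ : Continuous φ) :
    Continuous (ang a φ) := by
  refine intervalIntegral.continuous_parametric_intervalIntegral_of_continuous'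
    (f := fun r θ => a θ * (φ (pt r θ) : ℂ)) ?_ _ _
  exact (ha.comp continuous_snd).mul (Complex.continuous_ofReal.comp (hφ.comp continuous_pt))

lemma continuous_angRad {a : ℝ → ℂ} (ha : Continuous a) {φ : ℂ → ℝ} (hφ : ContDiff ℝ 1 φ) :
    Continuous (angRad a φ) := by
  refine intervalIntegral.continuous_parametric_intervalIntegral_of_continuous'
    (f := fun r θ => a θ * (fderiv ℝ φ (pt r θ) (circ θ) : ℂ)) ?_ _ _
  exact (ha.comp continuous_snd).mul (continuous_fderiv_apply_pt hφ continuous_circ)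

lemma hasDerivAt_ang {a : ℝ → ℂ} (ha : Continuous a) {φ : ℂ → ℝ} (hφ : ContDiff ℝ 1 φ)
    (hc : HasCompactSupport φ) (r : ℝ) : HasDerivAt (ang a φ) (angRad a φ r) r := by
  obtain ⟨C, hC⟩ := (hφ.continuous_fderiv one_ne_zero).bounded_above_of_compact_support
    (hc.fderiv ℝ)
  have hm : ∀ r : ℝ, Continuous fun θ => a θ * (φ (pt r θ) : ℂ) := fun r =>
    ha.mul (Complex.continuous_ofReal.comp
      (hφ.continuous.comp (continuous_pt.comp (by fun_prop : Continuous fun θ : ℝ => (r, θ)))))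
  have hm' : ∀ r : ℝ, Continuous fun θ => a θ * (fderiv ℝ φ (pt r θ) (circ θ) : ℂ) := fun r =>
    ha.mul ((continuous_fderiv_apply_pt hφ continuous_circ).comp
      (by fun_prop : Continuous fun θ : ℝ => (r, θ)))
  refine (intervalIntegral.hasDerivAt_integral_of_dominated_loc_of_deriv_le
    (F := fun r θ => a θ * (φ (pt r θ) : ℂ))
    (F' := fun r θ => a θ * (fderiv ℝ φ (pt r θ) (circ θ) : ℂ))
    (bound := fun θ => ‖a θ‖ * C) (s := univ) Filter.univ_mem
    (Filter.Eventually.of_forall fun r => (hm r).aestronglyMeasurable)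
    ((hm r).intervalIntegrable _ _) (hm' r).aestronglyMeasurable ?_ ?_ ?_).2
  · refine ae_of_all _ fun θ _ x _ => ?_
    rw [norm_mul, Complex.norm_real]
    refine mul_le_mul_of_nonneg_left ?_ (norm_nonneg _)
    refine ((fderiv ℝ φ (pt x θ)).le_opNorm _).trans ?_
    rw [norm_circ, mul_one]
    exact hC _
  · exact (ha.norm.mul continuous_const).intervalIntegrable _ _
  · refine ae_of_all _ fun θ _ x _ => ?_
    have h := ((hφ.differentiable one_ne_zero) (pt x θ)).hasFDerivAt.comp_hasDerivAt x
      (hasDerivAt_pt_left x θ)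
    exact h.ofReal_comp.const_mul _

/-- Integration by parts on circles. -/
lemma integral_mul_fderiv_tangential {a a' : ℝ → ℂ} (ha : ∀ θ, HasDerivAt a (a' θ) θ)
    (ha' : Continuous a') (hper : a (-Real.pi) = a Real.pi) {φ : ℂ → ℝ} (hφ : ContDiff ℝ 1 φ)
    (r : ℝ) :
    ∫ θ in (-Real.pi)..Real.pi, a θ * (fderiv ℝ φ (pt r θ) (r * (Complex.I * circ θ)) : ℂ)
      = -ang a' φ r := by
  have hd : ∀ θ, HasDerivAt (fun θ => (φ (pt r θ) : ℂ))
      (fderiv ℝ φ (pt r θ) (r * (Complex.I * circ θ)) : ℂ) θ := fun θ =>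
    (((hφ.differentiable one_ne_zero) (pt r θ)).hasFDerivAt.comp_hasDerivAt θ
      (hasDerivAt_pt_right r θ)).ofReal_comp
  have hcont : Continuous fun θ : ℝ =>
      (fderiv ℝ φ (pt r θ) (r * (Complex.I * circ θ)) : ℂ) :=
    (continuous_fderiv_apply_pt hφ (c := fun θ => r * (Complex.I * circ θ))
      (by have := continuous_circ; fun_prop)).comp (by fun_prop : Continuous fun θ : ℝ => (r, θ))
  rw [intervalIntegral.integral_mul_deriv_eq_deriv_mul (fun θ _ => ha θ) (fun θ _ => hd θ)
    (ha'.intervalIntegrable _ _) (hcont.intervalIntegrable _ _)]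
  have hpt : pt r (-Real.pi) = pt r Real.pi := by
    simp [pt, circ_eq]
  rw [hper, hpt, sub_self, zero_sub, ang]

/-- Integration by parts in the radial variable against an angular average. -/
lemma integral_mul_angRad {p p' : ℝ → ℂ} {a₀ : ℝ} (ha3 : a₀ ≤ 3) {S : Set ℝ} (hS : S.Countable)
    (hp : ContinuousOn p (Icc a₀ 3)) (hd : ∀ r ∈ Ioo a₀ 3 \ S, HasDerivAt p (p' r) r)
    (hp' : IntervalIntegrable p' volume a₀ 3) {a : ℝ → ℂ} (ha : Continuous a) {φ : ℂ → ℝ}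
    (hφ : ContDiff ℝ 1 φ) (hc : HasCompactSupport φ) (h3 : ∀ z, 3 ≤ ‖z‖ → φ z = 0) :
    ∫ r in a₀..3, p r * angRad a φ r = -(p a₀ * ang a φ a₀) - ∫ r in a₀..3, p' r * ang a φ r := by
  have hA := continuous_ang ha hφ.continuous
  have hA' := continuous_angRad ha hφ
  have i1 : IntervalIntegrable (fun r => p' r * ang a φ r) volume a₀ 3 :=
    hp'.mul_continuousOn hA.continuousOn
  have i2 : IntervalIntegrable (fun r => p r * angRad a φ r) volume a₀ 3 :=
    ContinuousOn.intervalIntegrable (by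
      rw [uIcc_of_le ha3]; exact hp.mul hA'.continuousOn)
  have key := integral_eq_of_hasDerivAt_off_countable_of_le (fun r => p r * ang a φ r)
    (fun r => p' r * ang a φ r + p r * angRad a φ r) ha3 hS (hp.mul hA.continuousOn)
    (fun r hr => (hd r hr).mul (hasDerivAt_ang ha hφ hc r)) (i1.add i2)
  rw [intervalIntegral.integral_add i1 i2] at key
  have h0 : ang a φ 3 = 0 := by
    rw [ang]
    have : ∀ θ, φ (pt 3 θ) = 0 := fun θ => h3 _ (by rw [norm_pt]; norm_num)
    simp [this]
  rw [h0, mul_zero, zero_sub] at key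
  linear_combination key

/-! ### Weak derivatives of a Fourier mode -/

/-- The component of `w` along the radial direction at angle `θ`. -/
def radComp (w : ℂ) (θ : ℝ) : ℝ := (w * (starRingEnd ℂ) (circ θ)).re

/-- The component of `w` along the tangential direction at angle `θ`. -/
def tanComp (w : ℂ) (θ : ℝ) : ℝ := (w * (starRingEnd ℂ) (circ θ)).im

lemma continuous_radComp (w : ℂ) : Continuous (radComp w) := by
  have := continuous_circ
  unfold radComp; fun_prop

lemma continuous_tanComp (w : ℂ) : Continuous (tanComp w) := by
  have := continuous_circ
  unfold tanComp; fun_prop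

lemma radComp_eq (w : ℂ) (θ : ℝ) : radComp w θ = w.re * Real.cos θ + w.im * Real.sin θ := by
  simp [radComp, circ_re, circ_im]

lemma tanComp_eq (w : ℂ) (θ : ℝ) : tanComp w θ = w.im * Real.cos θ - w.re * Real.sin θ := by
  simp [tanComp, circ_re, circ_im]; ring

lemma hasDerivAt_tanComp (w : ℂ) (θ : ℝ) : HasDerivAt (tanComp w) (-radComp w θ) θ := by
  have e : tanComp w = fun θ => w.im * Real.cos θ - w.re * Real.sin θ := funext (tanComp_eq w)
  rw [e]
  refine (((Real.hasDerivAt_cos θ).const_mul w.im).sub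
    ((Real.hasDerivAt_sin θ).const_mul w.re)).congr_deriv ?_
  rw [radComp_eq]; ring

/-- The derivative in direction `w` in polar coordinates. -/
lemma fderiv_apply_polar (L : ℂ →L[ℝ] ℝ) (w : ℂ) (r θ : ℝ) :
    r * L w = r * radComp w θ * L (circ θ) + tanComp w θ * L (r * (Complex.I * circ θ)) := by
  have e1 : (r : ℂ) * (Complex.I * circ θ) = r • (Complex.I * circ θ) := by
    rw [Complex.real_smul]
  have e2 : w = radComp w θ • circ θ + tanComp w θ • (Complex.I * circ θ) := by
    have h := Real.sin_sq_add_cos_sq θ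
    apply Complex.ext
    · simp only [Complex.add_re, Complex.smul_re, Complex.mul_re, Complex.I_re, Complex.I_im,
        circ_re, circ_im, radComp_eq, tanComp_eq, smul_eq_mul]
      linear_combination (-w.re) * h
    · simp only [Complex.add_im, Complex.smul_im, Complex.mul_im, Complex.I_re, Complex.I_im,
        circ_re, circ_im, radComp_eq, tanComp_eq, smul_eq_mul]
      linear_combination (-w.im) * h
  conv_lhs => rw [e2]
  rw [e1, map_add, map_smul, map_smul, map_smul]
  simp only [smul_eq_mul]
  ring

/-- The angular factor `e^{inθ}`. -/
def harm (n : ℤ) (θ : ℝ) : ℂ := circ θ ^ n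

lemma continuous_harm (n : ℤ) : Continuous (harm n) :=
  continuous_circ.zpow₀ n fun θ => Or.inl (circ_ne_zero θ)

lemma hasDerivAt_harm (n : ℤ) (θ : ℝ) : HasDerivAt (harm n) (n * Complex.I * harm n θ) θ := by
  refine ((hasDerivAt_zpow n (circ θ) (Or.inl (circ_ne_zero θ))).comp θ
    (hasDerivAt_circ θ)).congr_deriv ?_
  rw [harm, zpow_sub_one₀ (circ_ne_zero θ)]
  field_simp [circ_ne_zero θ]

lemma circ_neg_pi : circ (-Real.pi) = circ Real.pi := by simp [circ_eq]

lemma harm_periodic (n : ℤ) : harm n (-Real.pi) = harm n Real.pi := by rw [harm, harm, circ_neg_pi]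

/-- The weak derivative of the mode `V(r) e^{inθ}` in direction `w`, in polar coordinates. The
amplitude may be singular at the origin, where no boundary term arises as `r V(r) → 0`. -/
lemma integral_mode_mul_fderiv {V Vd : ℝ → ℂ} {a₀ : ℝ} (ha3 : a₀ ≤ 3) {S : Set ℝ}
    (hS : S.Countable) (hV : ContinuousOn (fun r : ℝ => (r : ℂ) * V r) (Icc a₀ 3))
    (hd : ∀ r ∈ Ioo a₀ 3 \ S, HasDerivAt V (Vd r) r) (hVi : IntervalIntegrable V volume a₀ 3)
    (hVdi : IntervalIntegrable (fun r : ℝ => (r : ℂ) * Vd r) volume a₀ 3) (n : ℤ) (w : ℂ) {φ : ℂ → ℝ}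
    (hφ : ContDiff ℝ 1 φ) (hc : HasCompactSupport φ) (h3 : ∀ z, 3 ≤ ‖z‖ → φ z = 0)
    (h0 : a₀ = 0 ∨ ∀ z, ‖z‖ = a₀ → φ z = 0) (ha0 : 0 ≤ a₀) :
    ∫ r in a₀..3, (r : ℂ) * ∫ θ in (-Real.pi)..Real.pi,
        V r * harm n θ * (fderiv ℝ φ (pt r θ) w : ℂ)
      = -∫ r in a₀..3, (r * Vd r * ang (fun θ => harm n θ * radComp w θ) φ r
          + V r * ang (fun θ => n * Complex.I * harm n θ * tanComp w θ) φ r) := by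
  have hr := continuous_radComp w
  have ht := continuous_tanComp w
  have hh := continuous_harm n
  have hce : Continuous fun θ => harm n θ * (radComp w θ : ℂ) := by fun_prop
  have hcs : Continuous fun θ => n * Complex.I * harm n θ * (tanComp w θ : ℂ) := by fun_prop
  have hcs' : Continuous fun θ => n * Complex.I * harm n θ * (tanComp w θ : ℂ)
      - harm n θ * (radComp w θ : ℂ) := by fun_prop
  have hder : ∀ θ, HasDerivAt (fun θ => harm n θ * (tanComp w θ : ℂ))
      (n * Complex.I * harm n θ * (tanComp w θ : ℂ) - harm n θ * (radComp w θ : ℂ)) θ := by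
    intro θ
    refine ((hasDerivAt_harm n θ).mul (hasDerivAt_tanComp w θ).ofReal_comp).congr_deriv ?_
    push_cast; ring
  have hper : harm n (-Real.pi) * (tanComp w (-Real.pi) : ℂ)
      = harm n Real.pi * (tanComp w Real.pi : ℂ) := by
    rw [harm_periodic, tanComp, tanComp, circ_neg_pi]
  have hA := continuous_ang hce hφ.continuous
  have hB := continuous_ang hcs hφ.continuous
  have inner : ∀ r : ℝ, (r : ℂ) * ∫ θ in (-Real.pi)..Real.pi,
        V r * harm n θ * (fderiv ℝ φ (pt r θ) w : ℂ)
      = (r * V r) * angRad (fun θ => harm n θ * radComp w θ) φ r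
        + (V r * ang (fun θ => harm n θ * radComp w θ) φ r
          - V r * ang (fun θ => n * Complex.I * harm n θ * tanComp w θ) φ r) := by
    intro r
    have hline : Continuous fun θ : ℝ => (r, θ) := by fun_prop
    have c1 : Continuous fun θ => (fderiv ℝ φ (pt r θ) (circ θ) : ℂ) :=
      (continuous_fderiv_apply_pt hφ continuous_circ).comp hline
    have c2 : Continuous fun θ : ℝ => (fderiv ℝ φ (pt r θ) (r * (Complex.I * circ θ)) : ℂ) :=
      (continuous_fderiv_apply_pt hφ (c := fun θ => r * (Complex.I * circ θ))
        (by have := continuous_circ; fun_prop)).comp hline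
    have c0 : Continuous fun θ => (φ (pt r θ) : ℂ) :=
      Complex.continuous_ofReal.comp (hφ.continuous.comp (continuous_pt.comp hline))
    have step : (r : ℂ) * ∫ θ in (-Real.pi)..Real.pi,
        V r * harm n θ * (fderiv ℝ φ (pt r θ) w : ℂ)
        = V r * (r * angRad (fun θ => harm n θ * radComp w θ) φ r
          + ∫ θ in (-Real.pi)..Real.pi, harm n θ * (tanComp w θ : ℂ)
            * (fderiv ℝ φ (pt r θ) (r * (Complex.I * circ θ)) : ℂ)) := by
      rw [angRad, ← intervalIntegral.integral_const_mul, ← intervalIntegral.integral_const_mul,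
        ← intervalIntegral.integral_add, ← intervalIntegral.integral_const_mul]
      · refine intervalIntegral.integral_congr fun θ _ => ?_
        have h := congrArg (fun x : ℝ => (x : ℂ)) (fderiv_apply_polar (fderiv ℝ φ (pt r θ)) w r θ)
        simp only [Complex.ofReal_mul, Complex.ofReal_add] at h
        linear_combination (V r * harm n θ) * h
      · exact (continuous_const.mul (hce.mul c1)).intervalIntegrable _ _
      · exact ((hh.mul (Complex.continuous_ofReal.comp ht)).mul c2).intervalIntegrable _ _
    rw [step, integral_mul_fderiv_tangential hder hcs' hper hφ]
    have e : ang (fun θ => n * Complex.I * harm n θ * (tanComp w θ : ℂ)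
        - harm n θ * (radComp w θ : ℂ)) φ r
        = ang (fun θ => n * Complex.I * harm n θ * tanComp w θ) φ r
          - ang (fun θ => harm n θ * radComp w θ) φ r := by
      simp only [ang]
      rw [← intervalIntegral.integral_sub]
      · simp only [sub_mul]
      · exact (hcs.mul c0).intervalIntegrable _ _
      · exact (hce.mul c0).intervalIntegrable _ _
    rw [e]
    ring
  have iA : IntervalIntegrable (fun r => V r * ang (fun θ => harm n θ * radComp w θ) φ r)
      volume a₀ 3 := hVi.mul_continuousOn hA.continuousOn
  have iB : IntervalIntegrable
      (fun r => V r * ang (fun θ => n * Complex.I * harm n θ * tanComp w θ) φ r)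
      volume a₀ 3 := hVi.mul_continuousOn hB.continuousOn
  have iD : IntervalIntegrable
      (fun r : ℝ => r * Vd r * ang (fun θ => harm n θ * radComp w θ) φ r) volume a₀ 3 :=
    hVdi.mul_continuousOn hA.continuousOn
  have iP : IntervalIntegrable
      (fun r : ℝ => r * V r * angRad (fun θ => harm n θ * radComp w θ) φ r) volume a₀ 3 :=
    ContinuousOn.intervalIntegrable (by
      rw [uIcc_of_le ha3]; exact hV.mul (continuous_angRad hce hφ).continuousOn)
  have key := integral_mul_angRad ha3 hS hV (p' := fun r => V r + r * Vd r) (fun r hr => by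
    have h1 : HasDerivAt (fun r : ℝ => (r : ℂ)) 1 r := (hasDerivAt_id r).ofReal_comp
    refine (h1.mul (hd r hr)).congr_deriv ?_
    ring) (hVi.add hVdi) hce hφ hc h3
  have hbd : (a₀ : ℂ) * V a₀ * ang (fun θ => harm n θ * radComp w θ) φ a₀ = 0 := by
    rcases h0 with rfl | h0
    · simp
    · have : ∀ θ, φ (pt a₀ θ) = 0 := fun θ => h0 _ (by rw [norm_pt, abs_of_nonneg ha0])
      simp [ang, this]
  rw [hbd, neg_zero, zero_sub] at key
  rw [intervalIntegral.integral_congr fun r _ => inner r, intervalIntegral.integral_add iP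
    (iA.sub iB), intervalIntegral.integral_sub iA iB, key, intervalIntegral.integral_add iD iB]
  simp only [add_mul]
  rw [intervalIntegral.integral_add iA iD]
  ring

/-! ### Fourier modes as functions on the plane -/

/-- The direction `z / |z|` of a point. -/
def unitDir (z : ℂ) : ℂ := z / ‖z‖

/-- The mode `V(r) e^{inθ}`. -/
def modeFun (n : ℤ) (V : ℝ → ℂ) (z : ℂ) : ℂ := V ‖z‖ * unitDir z ^ n

/-- The derivative of the mode `V(r) e^{inθ}` in direction `w`, where `Vd` is the derivative of
`V`. -/
def modeGrad (n : ℤ) (V Vd : ℝ → ℂ) (w z : ℂ) : ℂ :=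
  (Vd ‖z‖ * ((w * (starRingEnd ℂ) (unitDir z)).re : ℂ)
    + n * Complex.I * (V ‖z‖ / ‖z‖) * ((w * (starRingEnd ℂ) (unitDir z)).im : ℂ)) * unitDir z ^ n

lemma measurable_unitDir : Measurable unitDir := by
  unfold unitDir
  exact measurable_id.div (Complex.measurable_ofReal.comp measurable_norm)

lemma norm_unitDir_le (z : ℂ) : ‖unitDir z‖ ≤ 1 := by
  rw [unitDir, norm_div, Complex.norm_real, norm_norm]
  exact div_self_le_one _

lemma norm_unitDir {z : ℂ} (hz : z ≠ 0) : ‖unitDir z‖ = 1 := by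
  rw [unitDir, norm_div, Complex.norm_real, norm_norm]
  exact div_self (norm_ne_zero_iff.2 hz)

lemma unitDir_ne_zero {z : ℂ} (hz : z ≠ 0) : unitDir z ≠ 0 := by
  rw [← norm_pos_iff, norm_unitDir hz]; exact one_pos

lemma continuousOn_unitDir : ContinuousOn unitDir {0}ᶜ := by
  refine continuousOn_id.div (Complex.continuous_ofReal.comp continuous_norm).continuousOn ?_
  intro z hz
  simpa using hz

lemma unitDir_pt {r : ℝ} (hr : 0 < r) (θ : ℝ) : unitDir (pt r θ) = circ θ := by
  rw [unitDir, norm_pt_of_pos hr, pt, mul_div_cancel_left₀]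
  exact_mod_cast hr.ne'

lemma measurable_unitDir_zpow (n : ℤ) : Measurable fun z => unitDir z ^ n :=
  measurable_unitDir.pow_const n

lemma norm_unitDir_zpow_le (n : ℤ) (z : ℂ) : ‖unitDir z ^ n‖ ≤ 1 := by
  rcases eq_or_ne z 0 with rfl | hz
  · rcases eq_or_ne n 0 with rfl | hn
    · simp
    · simp [unitDir, zero_zpow n hn]
  · rw [norm_zpow, norm_unitDir hz, one_zpow]

lemma modeFun_pt {r : ℝ} (hr : 0 < r) (n : ℤ) (V : ℝ → ℂ) (θ : ℝ) :
    modeFun n V (pt r θ) = V r * harm n θ := by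
  rw [modeFun, norm_pt_of_pos hr, unitDir_pt hr, harm]

lemma modeGrad_pt {r : ℝ} (hr : 0 < r) (n : ℤ) (V Vd : ℝ → ℂ) (w : ℂ) (θ : ℝ) :
    modeGrad n V Vd w (pt r θ) =
      (Vd r * radComp w θ + n * Complex.I * (V r / r) * tanComp w θ) * harm n θ := by
  rw [modeGrad, norm_pt_of_pos hr, unitDir_pt hr, harm, radComp, tanComp]

/-- Functions bounded by a radial function are integrable if the radial function is, with respect to
`r dr`. -/
lemma integrable_radial_mul {V : ℝ → ℂ} {a₀ : ℝ} (ha0 : 0 ≤ a₀) (ha3 : a₀ ≤ 3)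
    (hV : IntervalIntegrable (fun r : ℝ => (r : ℂ) * V r) volume a₀ 3) {h : ℂ → ℂ}
    (hm : Measurable h) {C : ℝ} (hC : ∀ z, ‖h z‖ ≤ C)
    (h0 : ∀ z, ‖z‖ < a₀ ∨ 3 ≤ ‖z‖ → h z = 0) :
    Integrable fun z => V ‖z‖ * h z := by
  have h1 : Integrable fun z : ℂ => (Ioc a₀ 3).indicator V ‖z‖ := by
    have key := integrable_fun_norm_addHaar (volume : Measure ℂ) (f := (Ioc a₀ 3).indicator V)
    rw [key, Complex.finrank_real_complex]
    have e : (fun y : ℝ => y ^ (2 - 1) • (Ioc a₀ 3).indicator V y)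
        = (Ioc a₀ 3).indicator fun r : ℝ => (r : ℂ) * V r := by
      funext y
      by_cases hy : y ∈ Ioc a₀ 3
      · simp [hy]
      · simp [hy]
    rw [e]
    exact (((intervalIntegrable_iff_integrableOn_Ioc_of_le ha3).1 hV).integrable_indicator
      measurableSet_Ioc).integrableOn
  refine (h1.mul_bdd (c := C) hm.aestronglyMeasurable (ae_of_all _ hC)).congr ?_
  have hne : ∀ᵐ z : ℂ, ‖z‖ ≠ a₀ := by
    have : volume (Metric.sphere (0 : ℂ) a₀) = 0 := by
      rcases eq_or_lt_of_le ha0 with rfl | h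
      · simp
      · exact Measure.addHaar_sphere_of_ne_zero _ _ h.ne'
    rw [ae_iff]
    convert this using 2
    ext z; simp
  filter_upwards [hne] with z hz
  by_cases hmem : ‖z‖ ∈ Ioc a₀ 3
  · rw [indicator_of_mem hmem]
  · rw [h0 z, mul_zero, mul_zero]
    by_contra hcon
    push Not at hcon
    exact hmem ⟨lt_of_le_of_ne hcon.1 (Ne.symm hz), hcon.2.le⟩

/-- A test function on the disc of radius `3` that vanishes for `|z| ≤ a₀`, unless `a₀ = 0`. -/
structure IsAnnularTest (a₀ : ℝ) (φ : ℂ → ℝ) : Prop where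
  nonneg : 0 ≤ a₀
  le_three : a₀ ≤ 3
  contDiff : ContDiff ℝ 1 φ
  hasCompactSupport : HasCompactSupport φ
  tsupport_subset : tsupport φ ⊆ Metric.ball 0 3
  inner : a₀ = 0 ∨ tsupport φ ⊆ {z | a₀ < ‖z‖}

namespace IsAnnularTest

variable {a₀ : ℝ} {φ : ℂ → ℝ}

lemma notMem_tsupport (h : IsAnnularTest a₀ φ) {z : ℂ} (hz : ‖z‖ < a₀ ∨ 3 ≤ ‖z‖) :
    z ∉ tsupport φ := by
  intro hmem
  rcases hz with hz | hz
  · rcases h.inner with h0 | h0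
    · linarith [norm_nonneg z]
    · exact lt_asymm hz (h0 hmem)
  · have := h.tsupport_subset hmem
    rw [mem_ball_zero_iff] at this
    linarith

lemma eq_zero (h : IsAnnularTest a₀ φ) {z : ℂ} (hz : ‖z‖ < a₀ ∨ 3 ≤ ‖z‖) : φ z = 0 :=
  image_eq_zero_of_notMem_tsupport (h.notMem_tsupport hz)

lemma fderiv_eq_zero (h : IsAnnularTest a₀ φ) {z : ℂ} (hz : ‖z‖ < a₀ ∨ 3 ≤ ‖z‖) :
    fderiv ℝ φ z = 0 :=
  image_eq_zero_of_notMem_tsupport fun hm =>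
    h.notMem_tsupport hz (tsupport_fderiv_subset ℝ hm)

lemma boundary (h : IsAnnularTest a₀ φ) : a₀ = 0 ∨ ∀ z, ‖z‖ = a₀ → φ z = 0 := by
  refine h.inner.imp id fun h0 z hz => image_eq_zero_of_notMem_tsupport fun hm => ?_
  have := h0 hm
  exact (lt_irrefl _ (hz ▸ this : a₀ < a₀)).elim

lemma exists_bound (h : IsAnnularTest a₀ φ) : ∃ C, ∀ z, ‖φ z‖ ≤ C :=
  h.contDiff.continuous.bounded_above_of_compact_support h.hasCompactSupport

lemma exists_bound_fderiv (h : IsAnnularTest a₀ φ) : ∃ C, ∀ z, ‖fderiv ℝ φ z‖ ≤ C :=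
  (h.contDiff.continuous_fderiv one_ne_zero).bounded_above_of_compact_support
    (h.hasCompactSupport.fderiv ℝ)

lemma measurable_fderiv_apply (h : IsAnnularTest a₀ φ) {v : ℂ → ℂ} (hv : Measurable v) :
    Measurable fun z => fderiv ℝ φ z (v z) := by
  have hc := h.contDiff.continuous_fderiv one_ne_zero
  have e : (fun z => fderiv ℝ φ z (v z)) = fun z =>
      (v z).re * fderiv ℝ φ z 1 + (v z).im * fderiv ℝ φ z Complex.I := by
    funext z
    conv_lhs => rw [show v z = (v z).re • (1 : ℂ) + (v z).im • Complex.I by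
      simp [Complex.re_add_im]]
    rw [map_add, map_smul, map_smul, smul_eq_mul, smul_eq_mul]
  rw [e]
  exact ((Complex.measurable_re.comp hv).mul (hc.clm_apply continuous_const).measurable).add
    ((Complex.measurable_im.comp hv).mul (hc.clm_apply continuous_const).measurable)

end IsAnnularTest

/-- A radial amplitude `V` with derivative `Vd` off a countable set, such that `V(r) e^{inθ}` is a
weakly differentiable function on `a₀ < |z| < 3` (for `a₀ = 0`: on the whole disc). -/
structure IsAmplitude (a₀ : ℝ) (V Vd : ℝ → ℂ) : Prop where
  continuousOn : ContinuousOn (fun r : ℝ => (r : ℂ) * V r) (Icc a₀ 3)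
  hasDerivAt : ∃ S : Set ℝ, S.Countable ∧ ∀ r ∈ Ioo a₀ 3 \ S, HasDerivAt V (Vd r) r
  intervalIntegrable : IntervalIntegrable V volume a₀ 3
  intervalIntegrable_deriv : IntervalIntegrable (fun r : ℝ => (r : ℂ) * Vd r) volume a₀ 3

section

variable {a₀ : ℝ} {φ : ℂ → ℝ} {V Vd : ℝ → ℂ}

lemma norm_ofReal_re_le (z : ℂ) : ‖((z.re : ℝ) : ℂ)‖ ≤ ‖z‖ := by
  rw [Complex.norm_real]; exact Complex.abs_re_le_norm z

lemma norm_ofReal_im_le (z : ℂ) : ‖((z.im : ℝ) : ℂ)‖ ≤ ‖z‖ := by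
  rw [Complex.norm_real]; exact Complex.abs_im_le_norm z

lemma norm_mul_conj_unitDir_le (w z : ℂ) : ‖w * (starRingEnd ℂ) (unitDir z)‖ ≤ ‖w‖ := by
  rw [norm_mul, RCLike.norm_conj]
  exact mul_le_of_le_one_right (norm_nonneg _) (norm_unitDir_le z)

lemma measurable_conj_unitDir (w : ℂ) : Measurable fun z => w * (starRingEnd ℂ) (unitDir z) :=
  (Complex.continuous_conj.measurable.comp measurable_unitDir).const_mul w

lemma integrable_modeFun_mul (n : ℤ) (ha0 : 0 ≤ a₀) (ha3 : a₀ ≤ 3)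
    (hV : IntervalIntegrable (fun r : ℝ => (r : ℂ) * V r) volume a₀ 3) {h : ℂ → ℂ}
    (hm : Measurable h) {C : ℝ} (hC : ∀ z, ‖h z‖ ≤ C)
    (h0 : ∀ z, ‖z‖ < a₀ ∨ 3 ≤ ‖z‖ → h z = 0) :
    Integrable fun z => modeFun n V z * h z := by
  have h1 := integrable_radial_mul ha0 ha3 hV (h := fun z => unitDir z ^ n * h z)
    ((measurable_unitDir_zpow n).mul hm) (C := C) (fun z => by
      rw [norm_mul]
      exact (mul_le_of_le_one_left (norm_nonneg _) (norm_unitDir_zpow_le n z)).trans (hC z))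
    (fun z hz => by rw [h0 z hz, mul_zero])
  exact h1.congr (ae_of_all _ fun z => by simp only [modeFun]; ring)

lemma IsAmplitude.intervalIntegrable_mul (hV : IsAmplitude a₀ V Vd) (ha3 : a₀ ≤ 3) :
    IntervalIntegrable (fun r : ℝ => (r : ℂ) * V r) volume a₀ 3 :=
  ContinuousOn.intervalIntegrable (by rw [uIcc_of_le ha3]; exact hV.continuousOn)

lemma integrable_modeGrad_mul (n : ℤ) (ha0 : 0 ≤ a₀) (ha3 : a₀ ≤ 3) (hV : IsAmplitude a₀ V Vd)
    (w : ℂ) {h : ℂ → ℂ}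
    (hm : Measurable h) {C : ℝ} (hC : ∀ z, ‖h z‖ ≤ C)
    (h0 : ∀ z, ‖z‖ < a₀ ∨ 3 ≤ ‖z‖ → h z = 0) :
    Integrable fun z => modeGrad n V Vd w z * h z := by
  have hC0 : 0 ≤ C := (norm_nonneg _).trans (hC 0)
  have hVr : IntervalIntegrable (fun r : ℝ => (r : ℂ) * (V r / r)) volume a₀ 3 := by
    refine hV.intervalIntegrable.congr_ae ?_
    rw [uIoc_of_le ha3]
    refine (ae_restrict_iff' measurableSet_Ioc).2 (ae_of_all _ fun r hr => ?_)
    have : (r : ℂ) ≠ 0 := by exact_mod_cast (ha0.trans_lt hr.1).ne'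
    field_simp
  have hre : Measurable fun z => (((w * (starRingEnd ℂ) (unitDir z)).re : ℝ) : ℂ) :=
    Complex.measurable_ofReal.comp (Complex.measurable_re.comp (measurable_conj_unitDir w))
  have him : Measurable fun z => (((w * (starRingEnd ℂ) (unitDir z)).im : ℝ) : ℂ) :=
    Complex.measurable_ofReal.comp (Complex.measurable_im.comp (measurable_conj_unitDir w))
  have h1 := integrable_radial_mul ha0 ha3 hV.intervalIntegrable_deriv
    (h := fun z => ((w * (starRingEnd ℂ) (unitDir z)).re : ℂ) * unitDir z ^ n * h z)
    ((hre.mul (measurable_unitDir_zpow n)).mul hm) (C := ‖w‖ * 1 * C) (fun z => by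
      rw [norm_mul, norm_mul]
      gcongr
      · exact (norm_ofReal_re_le _).trans (norm_mul_conj_unitDir_le w z)
      · exact norm_unitDir_zpow_le n z
      · exact hC z)
    (fun z hz => by rw [h0 z hz, mul_zero])
  have h2 := integrable_radial_mul ha0 ha3 hVr
    (h := fun z => ((w * (starRingEnd ℂ) (unitDir z)).im : ℂ) * unitDir z ^ n * h z)
    ((him.mul (measurable_unitDir_zpow n)).mul hm) (C := ‖w‖ * 1 * C) (fun z => by
      rw [norm_mul, norm_mul]
      gcongr
      · exact (norm_ofReal_im_le _).trans (norm_mul_conj_unitDir_le w z)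
      · exact norm_unitDir_zpow_le n z
      · exact hC z)
    (fun z hz => by rw [h0 z hz, mul_zero])
  refine (h1.add (h2.const_mul (n * Complex.I))).congr (ae_of_all _ fun z => ?_)
  simp only [modeGrad, Pi.add_apply]
  ring

/-- `modeGrad` is the weak gradient of `modeFun`. -/
lemma IsAmplitude.weakDeriv (hV : IsAmplitude a₀ V Vd) (hφ : IsAnnularTest a₀ φ) (n : ℤ) (w : ℂ) :
    ∫ z, modeFun n V z * (fderiv ℝ φ z w : ℂ) = -∫ z, modeGrad n V Vd w z * (φ z : ℂ) := by
  obtain ⟨C, hC⟩ := hφ.exists_bound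
  obtain ⟨C', hC'⟩ := hφ.exists_bound_fderiv
  have m1 : Measurable fun z => (fderiv ℝ φ z w : ℂ) :=
    Complex.measurable_ofReal.comp (hφ.measurable_fderiv_apply measurable_const)
  have m2 : Measurable fun z => (φ z : ℂ) :=
    Complex.measurable_ofReal.comp hφ.contDiff.continuous.measurable
  have z1 : ∀ z, ‖z‖ < a₀ ∨ 3 ≤ ‖z‖ → (fderiv ℝ φ z w : ℂ) = 0 := fun z hz => by
    simp [hφ.fderiv_eq_zero hz]
  have z2 : ∀ z, ‖z‖ < a₀ ∨ 3 ≤ ‖z‖ → (φ z : ℂ) = 0 := fun z hz => by simp [hφ.eq_zero hz]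
  have i1 := integrable_modeFun_mul n hφ.nonneg hφ.le_three
    (hV.intervalIntegrable_mul hφ.le_three) m1
    (C := C' * ‖w‖) (fun z => by
      rw [Complex.norm_real]
      exact ((fderiv ℝ φ z).le_opNorm w).trans (by gcongr; exact hC' z)) z1
  have i2 := integrable_modeGrad_mul n hφ.nonneg hφ.le_three hV w m2 (C := C)
    (fun z => by rw [Complex.norm_real]; exact hC z) z2
  rw [integral_polar i1 hφ.nonneg hφ.le_three (fun z hz => by rw [z1 z hz, mul_zero]),
    integral_polar i2 hφ.nonneg hφ.le_three (fun z hz => by rw [z2 z hz, mul_zero])]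
  obtain ⟨S, hS, hd⟩ := hV.hasDerivAt
  have key := integral_mode_mul_fderiv hφ.le_three hS hV.continuousOn hd hV.intervalIntegrable
    hV.intervalIntegrable_deriv n w hφ.contDiff hφ.hasCompactSupport
    (fun z hz => hφ.eq_zero (Or.inr hz)) hφ.boundary hφ.nonneg
  have hpos : ∀ {r : ℝ}, r ∈ uIoc a₀ 3 → 0 < r := by
    intro r hr
    rw [uIoc_of_le hφ.le_three] at hr
    exact hφ.nonneg.trans_lt hr.1
  calc _ = ∫ r in a₀..3, (r : ℂ) * ∫ θ in (-Real.pi)..Real.pi,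
        V r * harm n θ * (fderiv ℝ φ (pt r θ) w : ℂ) := by
        refine intervalIntegral.integral_congr_ae (ae_of_all _ fun r hr => ?_)
        simp only [modeFun_pt (hpos hr)]
    _ = _ := by
        rw [key]
        congr 1
        refine intervalIntegral.integral_congr_ae (ae_of_all _ fun r hr => ?_)
        have hr0 := hpos hr
        have hrc : (r : ℂ) ≠ 0 := by exact_mod_cast hr0.ne'
        have cφ : Continuous fun θ => (φ (pt r θ) : ℂ) := Complex.continuous_ofReal.comp
          (hφ.contDiff.continuous.comp (continuous_pt.comp
            (by fun_prop : Continuous fun θ : ℝ => (r, θ))))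
        have c1 := continuous_radComp w
        have c2 := continuous_tanComp w
        have c3 := continuous_harm n
        simp only [modeGrad_pt hr0, ang]
        rw [← intervalIntegral.integral_const_mul, ← intervalIntegral.integral_const_mul,
          ← intervalIntegral.integral_const_mul, ← intervalIntegral.integral_add]
        · refine intervalIntegral.integral_congr fun θ _ => ?_
          field_simp
        · exact Continuous.intervalIntegrable (by fun_prop) _ _
        · exact Continuous.intervalIntegrable (by fun_prop) _ _

/-- The pairing of the flux `(σ ∂_r u, τ ∂_θ u / r)` of the mode `u = V(r) e^{inθ}` with the
gradient of `φ`. -/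
def fluxPairing (n : ℤ) (mr mt : ℝ → ℝ) (V Vd : ℝ → ℂ) (φ : ℂ → ℝ) (z : ℂ) : ℂ :=
  (mr ‖z‖ * Vd ‖z‖ * (fderiv ℝ φ z (unitDir z) : ℂ)
    + mt ‖z‖ * (n * Complex.I * (V ‖z‖ / ‖z‖)) * (fderiv ℝ φ z (Complex.I * unitDir z) : ℂ))
    * unitDir z ^ n

/-- The divergence theorem for the flux of a mode; `F` is `r` times the radial flux. There is a
contribution of the origin if `a₀ = 0` and the flux does not vanish there. -/
lemma integral_fluxPairing (hφ : IsAnnularTest a₀ φ) (n : ℤ) {mr mt : ℝ → ℝ} {F F' : ℝ → ℂ}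
    {S : Set ℝ} (hS : S.Countable) (hF : ContinuousOn F (Icc a₀ 3))
    (hd : ∀ r ∈ Ioo a₀ 3 \ S, HasDerivAt F (F' r) r) (hF' : IntervalIntegrable F' volume a₀ 3)
    (hFV : ∀ r ∈ Ioc a₀ 3, F r = mr r * (r * Vd r))
    (hmt : IntervalIntegrable (fun r => mt r * V r) volume a₀ 3) :
    Integrable (fluxPairing n mr mt V Vd φ) ∧
    ∫ z, fluxPairing n mr mt V Vd φ z = -(F a₀ * ang (harm n) φ a₀)
      - ∫ r in a₀..3, (F' r - n ^ 2 * (mt r * V r / r)) * ang (harm n) φ r := by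
  have ha0 := hφ.nonneg
  have ha3 := hφ.le_three
  obtain ⟨C', hC'⟩ := hφ.exists_bound_fderiv
  have m1 : Measurable fun z => (fderiv ℝ φ z (unitDir z) : ℂ) :=
    Complex.measurable_ofReal.comp (hφ.measurable_fderiv_apply measurable_unitDir)
  have m2 : Measurable fun z => (fderiv ℝ φ z (Complex.I * unitDir z) : ℂ) :=
    Complex.measurable_ofReal.comp (hφ.measurable_fderiv_apply (measurable_unitDir.const_mul _))
  have b1 : ∀ z, ‖(fderiv ℝ φ z (unitDir z) : ℂ)‖ ≤ C' := fun z => by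
    rw [Complex.norm_real]
    refine ((fderiv ℝ φ z).le_opNorm _).trans ?_
    exact (mul_le_of_le_one_right (norm_nonneg _) (norm_unitDir_le z)).trans (hC' z)
  have b2 : ∀ z, ‖(fderiv ℝ φ z (Complex.I * unitDir z) : ℂ)‖ ≤ C' := fun z => by
    rw [Complex.norm_real]
    refine ((fderiv ℝ φ z).le_opNorm _).trans ?_
    rw [norm_mul, Complex.norm_I, one_mul]
    exact (mul_le_of_le_one_right (norm_nonneg _) (norm_unitDir_le z)).trans (hC' z)
  have z1 : ∀ (v : ℂ) z, ‖z‖ < a₀ ∨ 3 ≤ ‖z‖ → (fderiv ℝ φ z v : ℂ) = 0 := fun v z hz => by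
    simp [hφ.fderiv_eq_zero hz]
  have hpos : ∀ {r : ℝ}, r ∈ uIoc a₀ 3 → 0 < r := by
    intro r hr
    rw [uIoc_of_le ha3] at hr
    exact ha0.trans_lt hr.1
  have hFi : IntervalIntegrable F volume a₀ 3 :=
    ContinuousOn.intervalIntegrable (by rw [uIcc_of_le ha3]; exact hF)
  have hi1 : IntervalIntegrable (fun r : ℝ => (r : ℂ) * (mr r * Vd r)) volume a₀ 3 := by
    refine hFi.congr_ae ?_
    rw [uIoc_of_le ha3]
    refine (ae_restrict_iff' measurableSet_Ioc).2 (ae_of_all _ fun r hr => ?_)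
    simp only [hFV r hr]
    ring
  have hi2 : IntervalIntegrable (fun r : ℝ => (r : ℂ) * (mt r * V r / r)) volume a₀ 3 := by
    refine hmt.congr_ae ?_
    rw [uIoc_of_le ha3]
    refine (ae_restrict_iff' measurableSet_Ioc).2 (ae_of_all _ fun r hr => ?_)
    have : (r : ℂ) ≠ 0 := by exact_mod_cast (ha0.trans_lt hr.1).ne'
    field_simp
  have h1 := integrable_modeFun_mul n ha0 ha3 hi1 m1 b1 (fun z hz => z1 _ z hz)
  have h2 := integrable_modeFun_mul n ha0 ha3 hi2 m2 b2 (fun z hz => z1 _ z hz)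
  have hint : Integrable (fluxPairing n mr mt V Vd φ) := by
    refine (h1.add (h2.const_mul (n * Complex.I))).congr (ae_of_all _ fun z => ?_)
    simp only [fluxPairing, modeFun, Pi.add_apply]
    ring
  refine ⟨hint, ?_⟩
  rw [integral_polar hint ha0 ha3 (fun z hz => by simp [fluxPairing, z1 _ z hz])]
  have hcn := continuous_harm n
  have hA := continuous_ang hcn hφ.contDiff.continuous
  have hA' := continuous_angRad hcn hφ.contDiff
  have key := integral_mul_angRad ha3 hS hF hd hF' hcn hφ.contDiff hφ.hasCompactSupport
    (fun z hz => hφ.eq_zero (Or.inr hz))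
  have inner : ∀ r ∈ uIoc a₀ 3, (r : ℂ) * ∫ θ in (-Real.pi)..Real.pi,
      fluxPairing n mr mt V Vd φ (pt r θ)
      = F r * angRad (harm n) φ r + n ^ 2 * (mt r * V r / r) * ang (harm n) φ r := by
    intro r hr
    have hr0 := hpos hr
    have hrc : (r : ℂ) ≠ 0 := by exact_mod_cast hr0.ne'
    have hline : Continuous fun θ : ℝ => (r, θ) := by fun_prop
    have c1 : Continuous fun θ => (fderiv ℝ φ (pt r θ) (circ θ) : ℂ) :=
      (continuous_fderiv_apply_pt hφ.contDiff continuous_circ).comp hline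
    have c2 : Continuous fun θ : ℝ => (fderiv ℝ φ (pt r θ) (r * (Complex.I * circ θ)) : ℂ) :=
      (continuous_fderiv_apply_pt hφ.contDiff (c := fun θ => r * (Complex.I * circ θ))
        (by have := continuous_circ; fun_prop)).comp hline
    have htan := integral_mul_fderiv_tangential (a := harm n)
      (a' := fun θ => n * Complex.I * harm n θ) (hasDerivAt_harm n)
      (by fun_prop) (harm_periodic n) hφ.contDiff r
    have e1 : ang (fun θ => n * Complex.I * harm n θ) φ r = n * Complex.I * ang (harm n) φ r := by
      simp only [ang, mul_assoc]
      rw [intervalIntegral.integral_const_mul, intervalIntegral.integral_const_mul]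
    rw [e1] at htan
    have hr' := hr
    rw [uIoc_of_le ha3] at hr'
    have e2 : F r * angRad (harm n) φ r + n ^ 2 * (mt r * V r / r) * ang (harm n) φ r
        = ∫ θ in (-Real.pi)..Real.pi, (F r * (harm n θ * (fderiv ℝ φ (pt r θ) (circ θ) : ℂ))
          + n * Complex.I * (mt r * V r / r) * (harm n θ
            * (fderiv ℝ φ (pt r θ) (r * (Complex.I * circ θ)) : ℂ))) := by
      rw [intervalIntegral.integral_add, intervalIntegral.integral_const_mul,
        intervalIntegral.integral_const_mul, htan, angRad]
      · linear_combination (n ^ 2 * (mt r * V r / r) * ang (harm n) φ r) * Complex.I_sq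
      · exact (continuous_const.mul (hcn.mul c1)).intervalIntegrable _ _
      · exact (continuous_const.mul (hcn.mul c2)).intervalIntegrable _ _
    rw [e2, ← intervalIntegral.integral_const_mul]
    refine intervalIntegral.integral_congr fun θ _ => ?_
    have e3 : fderiv ℝ φ (pt r θ) (r * (Complex.I * circ θ))
        = r * fderiv ℝ φ (pt r θ) (Complex.I * circ θ) := by
      rw [show (r : ℂ) * (Complex.I * circ θ) = r • (Complex.I * circ θ) by
        rw [Complex.real_smul], map_smul, smul_eq_mul]
    simp only [fluxPairing, norm_pt_of_pos hr0, unitDir_pt hr0, hFV r hr', e3, harm,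
      Complex.ofReal_mul]
    field_simp
  rw [intervalIntegral.integral_congr_ae (ae_of_all _ inner)]
  have j1 : IntervalIntegrable (fun r => F r * angRad (harm n) φ r) volume a₀ 3 :=
    hFi.mul_continuousOn hA'.continuousOn
  have j2 : IntervalIntegrable
      (fun r : ℝ => n ^ 2 * (mt r * V r / r) * ang (harm n) φ r) volume a₀ 3 := by
    -- integrable as the difference of `r ∫ fluxPairing dθ` and the radial part
    have h3 := integrableOn_polar hint
    rw [Measure.volume_eq_prod, IntegrableOn, ← Measure.prod_restrict] at h3
    have h4 := h3.integral_prod_left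
    have h5 : IntegrableOn (fun r : ℝ => ∫ θ in Ioo (-Real.pi) Real.pi,
        (r : ℂ) * fluxPairing n mr mt V Vd φ (pt r θ)) (Ioc a₀ 3) :=
      IntegrableOn.mono_set h4 fun r hr => ha0.trans_lt hr.1
    have h6 : IntervalIntegrable (fun r : ℝ => ∫ θ in Ioo (-Real.pi) Real.pi,
        (r : ℂ) * fluxPairing n mr mt V Vd φ (pt r θ)) volume a₀ 3 :=
      (intervalIntegrable_iff_integrableOn_Ioc_of_le ha3).2 h5
    refine (h6.sub j1).congr_ae ?_
    refine (ae_restrict_iff' measurableSet_uIoc).2 (ae_of_all _ fun r hr => ?_)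
    have := inner r hr
    rw [intervalIntegral.integral_of_le (by linarith [Real.pi_pos]),
      integral_Ioc_eq_integral_Ioo] at this
    simp only [integral_const_mul, this]
    ring
  rw [intervalIntegral.integral_add j1 j2, key]
  have j3 : IntervalIntegrable (fun r => F' r * ang (harm n) φ r) volume a₀ 3 :=
    hF'.mul_continuousOn hA.continuousOn
  simp only [sub_mul]
  rw [intervalIntegral.integral_sub j3 j2]
  ring

/-- Integrals of a mode against a radial weight. -/
lemma integral_weight_modeFun (hφ : IsAnnularTest a₀ φ) (n : ℤ) (c : ℝ → ℝ)
    (hc : IntervalIntegrable (fun r : ℝ => (r : ℂ) * (c r * V r)) volume a₀ 3) :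
    Integrable (fun z => (c ‖z‖ : ℂ) * modeFun n V z * (φ z : ℂ)) ∧
    ∫ z, (c ‖z‖ : ℂ) * modeFun n V z * (φ z : ℂ)
      = ∫ r in a₀..3, (r * (c r * V r)) * ang (harm n) φ r := by
  have ha0 := hφ.nonneg
  have ha3 := hφ.le_three
  obtain ⟨C, hC⟩ := hφ.exists_bound
  have m2 : Measurable fun z => (φ z : ℂ) :=
    Complex.measurable_ofReal.comp hφ.contDiff.continuous.measurable
  have z2 : ∀ z, ‖z‖ < a₀ ∨ 3 ≤ ‖z‖ → (φ z : ℂ) = 0 := fun z hz => by simp [hφ.eq_zero hz]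
  have h1 := integrable_modeFun_mul n ha0 ha3 hc m2 (C := C)
    (fun z => by rw [Complex.norm_real]; exact hC z) z2
  have hint : Integrable (fun z => (c ‖z‖ : ℂ) * modeFun n V z * (φ z : ℂ)) :=
    h1.congr (ae_of_all _ fun z => by simp only [modeFun]; ring)
  refine ⟨hint, ?_⟩
  rw [integral_polar hint ha0 ha3 (fun z hz => by rw [z2 z hz, mul_zero])]
  refine intervalIntegral.integral_congr_ae (ae_of_all _ fun r hr => ?_)
  rw [uIoc_of_le ha3] at hr
  have hr0 := ha0.trans_lt hr.1
  rw [ang, mul_assoc, ← intervalIntegral.integral_const_mul ((c r : ℂ) * V r)]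
  refine congrArg _ (intervalIntegral.integral_congr fun θ _ => ?_)
  simp only [modeFun_pt hr0, norm_pt_of_pos hr0]
  ring

end

/-! ### Weak solutions in the cloak -/

lemma lambdaR_eq (la R : ℝ) (x : ℂ) : lambdaR la R x = modulusRad la R ‖x‖ := by
  simp only [lambdaR, lambdaCloak, modulusRad]

/-- The radial and tangential directions are the eigenvectors of `σ_R`. -/
lemma sigmaR_apply (σa R : ℝ) (x : ℂ) (j k : Fin 2) :
    sigmaR σa R x j k = massRad σa R ‖x‖ * radialProj x j k
      + massTan σa R ‖x‖ * ((1 : Matrix (Fin 2) (Fin 2) ℝ) j k - radialProj x j k) := by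
  simp only [sigmaR, sigmaCloak, massRad, massTan]
  split_ifs
  · simp [Matrix.smul_apply]
    ring
  · simp
  · simp [Matrix.add_apply, Matrix.sub_apply, Matrix.smul_apply]

lemma radialProj_apply (x : ℂ) (j k : Fin 2) :
    radialProj x j k = coord (unitDir x) j * coord (unitDir x) k := by
  have hre : (unitDir x).re = x.re / ‖x‖ := by rw [unitDir, Complex.div_ofReal_re]
  have him : (unitDir x).im = x.im / ‖x‖ := by rw [unitDir, Complex.div_ofReal_im]
  simp only [radialProj, Matrix.smul_apply, Matrix.vecMulVec_apply, smul_eq_mul]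
  fin_cases j <;> fin_cases k <;> simp [coord, hre, him] <;> ring

lemma measurable_massRad (σa R : ℝ) : Measurable (massRad σa R) :=
  Measurable.ite measurableSet_Iic measurable_const
    (Measurable.ite measurableSet_Ioi measurable_const (by fun_prop))

lemma measurable_massTan (σa R : ℝ) : Measurable (massTan σa R) :=
  Measurable.ite measurableSet_Iic measurable_const
    (Measurable.ite measurableSet_Ioi measurable_const (by fun_prop))

lemma measurable_modulusRad (la R : ℝ) : Measurable (modulusRad la R) :=
  Measurable.ite measurableSet_Iic measurable_const
    (Measurable.ite measurableSet_Ioi measurable_const (by fun_prop))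

/-- Truncation makes the medium uniformly elliptic. -/
lemma exists_medium_bound {σa la R : ℝ} (hσa : 0 < σa) (hla : 0 < la) (hR : 1 < R) :
    ∃ C : ℝ, 0 ≤ C ∧ ∀ r, 0 < r → 0 < massRad σa R r ∧ |massRad σa R r| ≤ C ∧
      |(massRad σa R r)⁻¹| ≤ C ∧ |massTan σa R r| ≤ C ∧ |(modulusRad la R r)⁻¹| ≤ C := by
  have hR' : 0 < R - 1 := by linarith
  refine ⟨σa + σa⁻¹ + la⁻¹ + 2 / (R - 1) + 4, by positivity, fun r hr => ?_⟩
  have h1 : 0 < σa⁻¹ := by positivity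
  have h2 : 0 < la⁻¹ := by positivity
  have h3 : 0 < 2 / (R - 1) := by positivity
  rw [massRad, massTan, modulusRad]
  split_ifs with hrR hr2
  · rw [abs_of_pos hσa, abs_of_pos h1, abs_of_pos h2]
    exact ⟨hσa, by linarith, by linarith, by linarith, by linarith⟩
  · rw [inv_one, abs_one]
    exact ⟨one_pos, by linarith, by linarith, by linarith, by linarith⟩
  · push Not at hrR hr2
    have hr1 : 0 < r - 1 := by linarith
    have e1 : |(r - 1) / r| ≤ 1 := by
      rw [abs_of_pos (by positivity), div_le_one hr]; linarith
    have e2 : |r / (r - 1)| ≤ 2 / (R - 1) := by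
      rw [abs_of_pos (by positivity)]
      exact div_le_div₀ (by norm_num) hr2 hR' (by linarith)
    have e3 : |(r / (4 * (r - 1)))⁻¹| ≤ 4 := by
      rw [inv_div, abs_of_pos (by positivity), div_le_iff₀ hr]; linarith
    refine ⟨by positivity, by linarith, ?_, by linarith, by linarith⟩
    rw [inv_div]
    linarith

lemma sum_sigmaR {σa R : ℝ} {x : ℂ} (g : Fin 2 → ℂ) (L : ℂ →L[ℝ] ℝ) (hx : x ≠ 0) :
    ∑ j, ∑ k, (sigmaR σa R x j k : ℂ) * g j * (L (dir k) : ℂ) =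
      massRad σa R ‖x‖ * (g 0 * (unitDir x).re + g 1 * (unitDir x).im) * L (unitDir x)
        + massTan σa R ‖x‖ * (g 1 * (unitDir x).re - g 0 * (unitDir x).im)
          * L (Complex.I * unitDir x) := by
  have hL : ∀ v : ℂ, L v = v.re * L 1 + v.im * L Complex.I := by
    intro v
    conv_lhs => rw [show v = v.re • (1 : ℂ) + v.im • Complex.I by simp [Complex.re_add_im]]
    rw [map_add, map_smul, map_smul, smul_eq_mul, smul_eq_mul]
  have hn : (unitDir x).re * (unitDir x).re + (unitDir x).im * (unitDir x).im = 1 := by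
    rw [← Complex.normSq_apply, Complex.normSq_eq_norm_sq, norm_unitDir hx, one_pow]
  have hn' : ((unitDir x).re : ℂ) * (unitDir x).re + (unitDir x).im * (unitDir x).im = 1 := by
    exact_mod_cast hn
  rw [hL (unitDir x), hL (Complex.I * unitDir x)]
  simp only [Fin.sum_univ_two, sigmaR_apply, radialProj_apply, coord, dir]
  simp
  linear_combination (-(massTan σa R ‖x‖ : ℂ) * (g 0 * L 1 + g 1 * L Complex.I)) * hn'

lemma sum_sigmaR_modeGrad {σa R : ℝ} {x : ℂ} (hx : x ≠ 0) (n : ℤ) (V Vd : ℝ → ℂ) (φ : ℂ → ℝ) :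
    ∑ j, ∑ k, (sigmaR σa R x j k : ℂ) * modeGrad n V Vd (dir j) x * (fderiv ℝ φ x (dir k) : ℂ) =
      fluxPairing n (massRad σa R) (massTan σa R) V Vd φ x := by
  have hn : (unitDir x).re * (unitDir x).re + (unitDir x).im * (unitDir x).im = 1 := by
    rw [← Complex.normSq_apply, Complex.normSq_eq_norm_sq, norm_unitDir hx, one_pow]
  have hn' : ((unitDir x).re : ℂ) * (unitDir x).re + (unitDir x).im * (unitDir x).im = 1 := by
    exact_mod_cast hn
  rw [sum_sigmaR (fun j => modeGrad n V Vd (dir j) x) _ hx, fluxPairing]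
  simp only [modeGrad, dir]
  simp
  generalize (fderiv ℝ φ x (unitDir x) : ℂ) = A
  generalize (fderiv ℝ φ x (Complex.I * unitDir x) : ℂ) = B
  linear_combination ((massRad σa R ‖x‖ : ℂ) * Vd ‖x‖ * unitDir x ^ n * A
    + massTan σa R ‖x‖ * (n * Complex.I * (V ‖x‖ / ‖x‖)) * unitDir x ^ n * B) * hn'

lemma exists_isAnnularTest_of_notMem {φ : ℂ → ℝ} (h1 : ContDiff ℝ 1 φ)
    (h2 : HasCompactSupport φ) (h3 : tsupport φ ⊆ Metric.ball 0 3) (h0 : (0 : ℂ) ∉ tsupport φ) :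
    ∃ a₀, 0 < a₀ ∧ IsAnnularTest a₀ φ := by
  obtain ⟨ε, hε, hball⟩ := Metric.isOpen_iff.1 (isClosed_tsupport φ).isOpen_compl 0 h0
  refine ⟨min (ε / 2) 3, by positivity, by positivity, min_le_right _ _, h1, h2, h3,
    Or.inr fun z hz => ?_⟩
  by_contra hcon
  simp only [mem_ofPred_eq, not_lt] at hcon
  have : ‖z‖ < ε := by
    have := hcon.trans (min_le_left _ _)
    linarith
  exact hball (mem_ball_zero_iff.2 this) hz

lemma exists_isAnnularTest (φ : 𝓓(puncturedDisc 3, ℝ)) : ∃ a₀, 0 < a₀ ∧ IsAnnularTest a₀ φ := by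
  have hsub : tsupport φ ⊆ Metric.ball (0 : ℂ) 3 \ {0} := φ.tsupport_subset
  exact exists_isAnnularTest_of_notMem (φ.contDiff.of_le (by exact_mod_cast le_top))
    φ.hasCompactSupport (fun z hz => (hsub hz).1) fun h => (hsub h).2 rfl

lemma isAnnularTest_of_disc {ρ : ℝ} (hρ : ρ ≤ 3) (φ : 𝓓(disc ρ, ℝ)) : IsAnnularTest 0 φ :=
  ⟨le_rfl, by norm_num, φ.contDiff.of_le (by exact_mod_cast le_top), φ.hasCompactSupport,
    φ.tsupport_subset.trans (Metric.ball_subset_ball hρ), Or.inl rfl⟩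

/-- The part of the definition of a solution that concerns the punctured disc: `u` is a weak
solution with gradient `g`, continuous up to the boundary and zero there. -/
structure IsWeakSolution (σa la ω R : ℝ) (u : ℂ → ℂ) (g : Fin 2 → ℂ → ℂ) : Prop where
  continuousOn : ContinuousOn u (Metric.closedBall 0 3 \ {0})
  boundary : ∀ x : ℂ, ‖x‖ = 3 → u x = 0
  memLp : ∀ j, ∀ ε : ℝ, 0 < ε → MemLp (g j) 2 (volume.restrict {x : ℂ | ε < ‖x‖ ∧ ‖x‖ < 3})
  weakGradient : HasWeakGradient (puncturedDisc 3) u g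
  weak : ∀ φ : 𝓓(puncturedDisc 3, ℝ),
      ∫ x, ∑ j, ∑ k, (sigmaR σa R x j k : ℂ) * g j x * (fderiv ℝ φ x (dir k) : ℂ) =
        ∫ x, (ω : ℂ) ^ 2 * ((lambdaR la R x)⁻¹ : ℝ) * u x * (φ x : ℂ)

lemma intervalIntegrable_mul_of_bounded {c : ℝ → ℝ} {V : ℝ → ℂ} {a b C : ℝ} (hab : a ≤ b)
    (hc : Measurable c) (hC : ∀ r ∈ Ioc a b, |c r| ≤ C) (hV : IntervalIntegrable V volume a b) :
    IntervalIntegrable (fun r => (c r : ℂ) * V r) volume a b := by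
  rw [intervalIntegrable_iff_integrableOn_Ioc_of_le hab] at hV ⊢
  refine Integrable.bdd_mul (c := C) hV
    (Complex.measurable_ofReal.comp hc).aestronglyMeasurable ?_
  refine (ae_restrict_iff' measurableSet_Ioc).2 (ae_of_all _ fun r hr => ?_)
  change ‖((c r : ℝ) : ℂ)‖ ≤ C
  rw [Complex.norm_real]
  exact hC r hr

lemma natAbs_sq_cast (n : ℤ) : ((n.natAbs : ℝ) : ℂ) ^ 2 = (n : ℂ) ^ 2 := by
  rw [Complex.ofReal_natCast, ← Int.cast_natCast, ← Int.cast_pow, Int.natAbs_sq, Int.cast_pow]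

section

variable {σa la ω R : ℝ}

/-- The derivative of the amplitude of a mode with flux `F`. -/
def ampDeriv (σa R : ℝ) (F : ℝ → ℂ) (r : ℝ) : ℂ := F r / (massRad σa R r * r : ℝ)

lemma IsModeOn.isAmplitude (hσa : 0 < σa) (hla : 0 < la) (hR : 1 < R) {n : ℕ} {a₀ : ℝ}
    {V F : ℝ → ℂ} (h : IsModeOn σa la ω R n a₀ 3 V F) (ha0 : 0 < a₀) (ha3 : a₀ ≤ 3) :
    IsAmplitude a₀ V (ampDeriv σa R F) where
  continuousOn := Complex.continuous_ofReal.continuousOn.mul h.continuousOn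
  hasDerivAt := ⟨{R, 2}, Set.Finite.countable (by simp), fun r hr => h.hasDerivAt r hr.1 hr.2⟩
  intervalIntegrable := ContinuousOn.intervalIntegrable (by rw [uIcc_of_le ha3]; exact h.continuousOn)
  intervalIntegrable_deriv := by
    obtain ⟨C, hC0, hC⟩ := exists_medium_bound hσa hla hR
    have hF : IntervalIntegrable F volume a₀ 3 :=
      ContinuousOn.intervalIntegrable (by rw [uIcc_of_le ha3]; exact h.continuousOn_flux)
    have h1 := intervalIntegrable_mul_of_bounded (c := fun r => (massRad σa R r)⁻¹) ha3
      (measurable_massRad σa R).inv (fun r hr => (hC r (ha0.trans hr.1)).2.2.1) hF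
    refine h1.congr_ae ?_
    rw [uIoc_of_le ha3]
    refine (ae_restrict_iff' measurableSet_Ioc).2 (ae_of_all _ fun r hr => ?_)
    have : (r : ℂ) ≠ 0 := by exact_mod_cast (ha0.trans hr.1).ne'
    simp only [ampDeriv]
    push_cast
    field_simp

/-- A solution of the radial system is a weak solution on the plane. -/
lemma isWeakSolution_mode (hσa : 0 < σa) (hla : 0 < la) (hR : 1 < R) (n : ℤ) {V F : ℝ → ℂ}
    (h : ∀ a, 0 < a → a ≤ 3 → IsModeOn σa la ω R n.natAbs a 3 V F) (h3 : V 3 = 0) :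
    IsWeakSolution σa la ω R (modeFun n V)
      (fun j => modeGrad n V (ampDeriv σa R F) (dir j)) := by
  obtain ⟨C, hC0, hC⟩ := exists_medium_bound hσa hla hR
  have contOn : ∀ {G : ℝ → ℂ}, (∀ a, 0 < a → a ≤ 3 → ContinuousOn G (Icc a 3)) →
      ContinuousOn (fun z : ℂ => G ‖z‖) (Metric.closedBall 0 3 \ {0}) := by
    intro G hG z hz
    have hz0 : 0 < ‖z‖ := norm_pos_iff.2 fun h => hz.2 (by simp [h])
    have hz3 : ‖z‖ ≤ 3 := mem_closedBall_zero_iff.1 hz.1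
    have h1 := hG (‖z‖ / 2) (by positivity) (by linarith) ‖z‖ ⟨by linarith, hz3⟩
    have h2 : ContinuousWithinAt (fun z : ℂ => G ‖z‖)
        ((Metric.closedBall 0 3 \ {0}) ∩ {w | ‖z‖ / 2 < ‖w‖}) z := by
      refine h1.comp continuous_norm.continuousWithinAt fun w hw => ?_
      exact ⟨le_of_lt hw.2, mem_closedBall_zero_iff.1 hw.1.1⟩
    refine h2.mono_of_mem_nhdsWithin (inter_mem_nhdsWithin _ ?_)
    exact (isOpen_lt continuous_const continuous_norm).mem_nhds (by simp only [mem_ofPred_eq]; linarith)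
  have hVc := contOn fun a ha ha3 => (h a ha ha3).continuousOn
  have hFc := contOn fun a ha ha3 => (h a ha ha3).continuousOn_flux
  refine ⟨?_, ?_, ?_, ?_, ?_⟩
  · refine hVc.mul ?_
    intro z hz
    have hz0 : z ≠ 0 := fun h => hz.2 h
    have h1 : ContinuousWithinAt unitDir (Metric.closedBall 0 3 \ {0}) z :=
      (continuousOn_unitDir z hz0).mono fun w hw => hw.2
    exact h1.zpow₀ n (Or.inl (unitDir_ne_zero hz0))
  · intro x hx
    rw [modeFun, hx, h3, zero_mul]
  · intro j ε hε
    have hmeas : MeasurableSet {x : ℂ | ε < ‖x‖ ∧ ‖x‖ < 3} :=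
      (measurableSet_lt measurable_const measurable_norm).inter
        (measurableSet_lt measurable_norm measurable_const)
    have hsub : {x : ℂ | ε < ‖x‖ ∧ ‖x‖ < 3} ⊆ Metric.closedBall 0 3 \ {0} := fun x hx =>
      ⟨mem_closedBall_zero_iff.2 hx.2.le, fun h0 => by
        have h1 := hx.1
        rw [mem_singleton_iff.1 h0, norm_zero] at h1
        linarith⟩
    have : IsFiniteMeasure (volume.restrict {x : ℂ | ε < ‖x‖ ∧ ‖x‖ < 3}) :=
      ⟨by
        rw [Measure.restrict_apply_univ]
        exact (measure_mono fun x hx => mem_ball_zero_iff.2 hx.2).trans_lt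
          (measure_ball_lt_top (x := (0 : ℂ)) (r := 3))⟩
    rcases lt_or_ge 3 ε with hε3 | hε3
    · have : {x : ℂ | ε < ‖x‖ ∧ ‖x‖ < 3} = ∅ := by
        ext x
        simp only [mem_ofPred_eq, mem_empty_iff_false, iff_false, not_and, not_lt]
        intro hx; linarith
      rw [this, Measure.restrict_empty]
      exact memLp_measure_zero
    obtain ⟨CV, hCV⟩ := isCompact_Icc.exists_bound_of_continuousOn (h ε hε hε3).continuousOn
    obtain ⟨CF, hCF⟩ := isCompact_Icc.exists_bound_of_continuousOn (h ε hε hε3).continuousOn_flux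
    have hV := (hVc.mono hsub).aestronglyMeasurable (μ := volume) hmeas
    have hF := (hFc.mono hsub).aestronglyMeasurable (μ := volume) hmeas
    have hre : Measurable fun z => (((dir j * (starRingEnd ℂ) (unitDir z)).re : ℝ) : ℂ) :=
      Complex.measurable_ofReal.comp (Complex.measurable_re.comp (measurable_conj_unitDir _))
    have him : Measurable fun z => (((dir j * (starRingEnd ℂ) (unitDir z)).im : ℝ) : ℂ) :=
      Complex.measurable_ofReal.comp (Complex.measurable_im.comp (measurable_conj_unitDir _))
    have hnorm : Measurable fun z : ℂ => ((‖z‖ : ℝ) : ℂ) :=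
      Complex.measurable_ofReal.comp measurable_norm
    have hmass : Measurable fun z : ℂ => ((massRad σa R ‖z‖ * ‖z‖ : ℝ) : ℂ) :=
      Complex.measurable_ofReal.comp
        (((measurable_massRad σa R).comp measurable_norm).mul measurable_norm)
    have hdir : ‖dir j‖ ≤ 1 := by fin_cases j <;> simp [dir]
    refine MemLp.of_bound (C := (CF * (C / ε) * 1 + |(n : ℝ)| * (CV / ε) * 1) * 1) ?_ ?_
    · change AEStronglyMeasurable (fun z : ℂ => (F ‖z‖ / ((massRad σa R ‖z‖ * ‖z‖ : ℝ) : ℂ)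
        * (((dir j * (starRingEnd ℂ) (unitDir z)).re : ℝ) : ℂ) + n * Complex.I * (V ‖z‖ / ‖z‖)
        * (((dir j * (starRingEnd ℂ) (unitDir z)).im : ℝ) : ℂ)) * unitDir z ^ n) _
      exact (((hF.div₀ hmass.aestronglyMeasurable).mul hre.aestronglyMeasurable).add
        ((aestronglyMeasurable_const.mul (hV.div₀ hnorm.aestronglyMeasurable)).mul
          him.aestronglyMeasurable)).mul (measurable_unitDir_zpow n).aestronglyMeasurable
    · refine (ae_restrict_iff' hmeas).2 (ae_of_all _ fun z hz => ?_)
      have hz0 : 0 < ‖z‖ := hε.trans hz.1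
      have hmem : ‖z‖ ∈ Icc ε 3 := ⟨hz.1.le, hz.2.le⟩
      have b1 : ‖ampDeriv σa R F ‖z‖‖ ≤ CF * (C / ε) := by
        obtain ⟨m1, -, m2, -, -⟩ := hC ‖z‖ hz0
        rw [ampDeriv, norm_div, Complex.norm_real, norm_mul, norm_norm, div_eq_mul_inv, mul_inv,
          Real.norm_eq_abs, ← abs_inv, div_eq_mul_inv]
        have hCF0 := (norm_nonneg _).trans (hCF _ hmem)
        gcongr
        · exact hCF _ hmem
        · exact hz.1.le
      have b2 : ‖n * Complex.I * (V ‖z‖ / ‖z‖)‖ ≤ |(n : ℝ)| * (CV / ε) := by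
        rw [norm_mul, norm_mul, Complex.norm_I, mul_one, norm_div, Complex.norm_real, norm_norm,
          Complex.norm_intCast]
        have hCV0 := (norm_nonneg _).trans (hCV _ hmem)
        gcongr
        · exact hCV _ hmem
        · exact hz.1.le
      have b3 : ‖(((dir j * (starRingEnd ℂ) (unitDir z)).re : ℝ) : ℂ)‖ ≤ 1 :=
        (norm_ofReal_re_le _).trans ((norm_mul_conj_unitDir_le _ z).trans hdir)
      have b4 : ‖(((dir j * (starRingEnd ℂ) (unitDir z)).im : ℝ) : ℂ)‖ ≤ 1 :=
        (norm_ofReal_im_le _).trans ((norm_mul_conj_unitDir_le _ z).trans hdir)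
      have hCF0 := (norm_nonneg _).trans b1
      have hCV0 := (norm_nonneg _).trans b2
      rw [modeGrad, norm_mul]
      refine mul_le_mul ((norm_add_le _ _).trans ?_) (norm_unitDir_zpow_le n z) (norm_nonneg _)
        (by positivity)
      rw [norm_mul, norm_mul]
      gcongr
  · intro j φ
    obtain ⟨a₀, ha0, hφ⟩ := exists_isAnnularTest φ
    exact ((h a₀ ha0 hφ.le_three).isAmplitude hσa hla hR ha0 hφ.le_three).weakDeriv hφ n (dir j)
  · intro φ
    obtain ⟨a₀, ha0, hφ⟩ := exists_isAnnularTest φ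
    have ha3 := hφ.le_three
    have hm := h a₀ ha0 ha3
    have hVi : IntervalIntegrable V volume a₀ 3 :=
      ContinuousOn.intervalIntegrable (by rw [uIcc_of_le ha3]; exact hm.continuousOn)
    have hrVi : IntervalIntegrable (fun r : ℝ => (r : ℂ) * V r) volume a₀ 3 :=
      ContinuousOn.intervalIntegrable (by
        rw [uIcc_of_le ha3]; exact Complex.continuous_ofReal.continuousOn.mul hm.continuousOn)
    have i1 := intervalIntegrable_mul_of_bounded ha3 (measurable_massTan σa R)
      (fun r hr => (hC r (ha0.trans hr.1)).2.2.2.1) hVi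
    have i2 := intervalIntegrable_mul_of_bounded (c := fun r => (modulusRad la R r)⁻¹) ha3
      (measurable_modulusRad la R).inv (fun r hr => (hC r (ha0.trans hr.1)).2.2.2.2) hrVi
    have i3 : IntervalIntegrable (fun r : ℝ => (n : ℂ) ^ 2 * ((massTan σa R r : ℂ) * V r / r))
        volume a₀ 3 := by
      have : IntervalIntegrable (fun r : ℝ => (massTan σa R r : ℂ) * V r * (r : ℂ)⁻¹)
          volume a₀ 3 := by
        refine i1.mul_continuousOn (ContinuousOn.inv₀ Complex.continuous_ofReal.continuousOn ?_)
        intro r hr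
        rw [uIcc_of_le ha3] at hr
        exact_mod_cast (ha0.trans_le hr.1).ne'
      exact (this.const_mul ((n : ℂ) ^ 2)).congr_ae (ae_of_all _ fun r => by simp only [div_eq_mul_inv])
    have hF' : IntervalIntegrable (fun r : ℝ => ((n.natAbs ^ 2 * massTan σa R r / r
        - ω ^ 2 * r / modulusRad la R r : ℝ) : ℂ) * V r) volume a₀ 3 := by
      refine (i3.sub (i2.const_mul ((ω : ℂ) ^ 2))).congr_ae (ae_of_all _ fun r => ?_)
      simp only
      push_cast
      rw [← natAbs_sq_cast n]
      push_cast
      ring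
    obtain ⟨-, hflux⟩ := integral_fluxPairing (V := V) (Vd := ampDeriv σa R F)
      (mr := massRad σa R) (mt := massTan σa R) hφ n
      (S := {R, 2}) (Set.Finite.countable (by simp)) hm.continuousOn_flux
      (fun r hr => hm.hasDerivAt_flux r hr.1 hr.2) hF' (fun r hr => by
        have hr0 := ha0.trans hr.1
        have h1 : (massRad σa R r : ℂ) ≠ 0 := by exact_mod_cast (hC r hr0).1.ne'
        have h2 : (r : ℂ) ≠ 0 := by exact_mod_cast hr0.ne'
        rw [ampDeriv]
        push_cast
        field_simp) i1
    obtain ⟨-, hw⟩ := integral_weight_modeFun (V := V) hφ n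
      (fun r => ω ^ 2 * (modulusRad la R r)⁻¹)
      ((i2.const_mul ((ω : ℂ) ^ 2)).congr_ae (ae_of_all _ fun r => by
        simp only
        push_cast
        ring))
    have hbd : ang (harm n) φ a₀ = 0 := by
      have h0 := hφ.boundary.resolve_left ha0.ne'
      have : ∀ θ, φ (pt a₀ θ) = 0 := fun θ => h0 _ (norm_pt_of_pos ha0 θ)
      simp [ang, this]
    have hne : ∀ᵐ z : ℂ, z ≠ 0 := by simp [ae_iff, measure_singleton]
    calc _ = ∫ x, fluxPairing n (massRad σa R) (massTan σa R) V (ampDeriv σa R F) φ x := by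
          refine integral_congr_ae ?_
          filter_upwards [hne] with x hx
          exact sum_sigmaR_modeGrad hx n V _ φ
      _ = _ := by
          rw [hflux, hbd, mul_zero, neg_zero, zero_sub]
          have e : ∀ x : ℂ, (ω : ℂ) ^ 2 * ((lambdaR la R x)⁻¹ : ℝ) * modeFun n V x * (φ x : ℂ)
              = ((ω ^ 2 * (modulusRad la R ‖x‖)⁻¹ : ℝ) : ℂ) * modeFun n V x * (φ x : ℂ) := by
            intro x; rw [lambdaR_eq]; push_cast; ring
          simp only [e]
          rw [hw, ← intervalIntegral.integral_neg]
          refine intervalIntegral.integral_congr fun r _ => ?_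
          push_cast
          rw [← natAbs_sq_cast n]
          push_cast
          ring

end

/-! ### Distributions given by functions -/

/-- The distribution given by a locally integrable function. -/
def funDist (Ω : Opens ℂ) (f : ℂ → ℂ) : 𝓓'(Ω, ℂ) :=
  TestFunction.integralAgainstBilinCLM (𝕜 := ℝ) (ContinuousLinearMap.lsmul ℝ ℝ) volume f

lemma funDist_apply {Ω : Opens ℂ} {f : ℂ → ℂ} (hf : LocallyIntegrableOn f Ω) (φ : 𝓓(Ω, ℝ)) :
    funDist Ω f φ = ∫ x, (φ x : ℂ) * f x := by
  change TestFunction.integralAgainstBilinCLM (𝕜 := ℝ) (ContinuousLinearMap.lsmul ℝ ℝ) volume f φ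
    = _
  rw [TestFunction.integralAgainstBilinCLM_eq_integral hf]
  simp

lemma lineDeriv_dist_apply {Ω : Opens ℂ} (T : 𝓓'(Ω, ℂ)) (w : ℂ) (φ : 𝓓(Ω, ℝ)) :
    (∂_{w} T) φ = -T (∂_{w} φ) := rfl

lemma lineDeriv_testFunction_apply {Ω : Opens ℂ} (w : ℂ) (φ : 𝓓(Ω, ℝ)) (x : ℂ) :
    (∂_{w} φ) x = fderiv ℝ φ x w := rfl

lemma lineDeriv_testFunction_comm {Ω : Opens ℂ} (v w : ℂ) (φ : 𝓓(Ω, ℝ)) :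
    ∂_{v} (∂_{w} φ) = ∂_{w} (∂_{v} φ) := by
  ext x
  have h2 : ContDiff ℝ 2 φ := φ.contDiff.of_le (WithTop.coe_le_coe.2 (le_top : (2 : ℕ∞) ≤ ⊤))
  have hd : Differentiable ℝ (fderiv ℝ φ) :=
    (h2.fderiv_right (m := 1) (by norm_num)).differentiable one_ne_zero
  have key : ∀ v w : ℂ, (∂_{v} (∂_{w} φ)) x = fderiv ℝ (fderiv ℝ φ) x v w := by
    intro v w
    rw [lineDeriv_testFunction_apply]
    have : ((∂_{w} φ : 𝓓(Ω, ℝ)) : ℂ → ℝ) = fun y => fderiv ℝ φ y w := rfl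
    rw [this, fderiv_clm_apply (hd x) (differentiableAt_const w)]
    simp
  rw [key, key]
  exact (h2.contDiffAt.isSymmSndFDerivAt (by simp)).eq v w

lemma laplace_apply {Ω : Opens ℂ} (T : 𝓓'(Ω, ℂ)) (φ : 𝓓(Ω, ℝ)) :
    laplace T φ = ∑ j, T (∂_{dir j} (∂_{dir j} φ)) := by
  change (∂_{(1 : ℂ)} (∂_{(1 : ℂ)} T)) φ + (∂_{Complex.I} (∂_{Complex.I} T)) φ = _
  simp [dir]

/-- The Helmholtz operator `Δ + k²` on distributions. -/
def helmholtz {Ω : Opens ℂ} (k : ℝ) (T : 𝓓'(Ω, ℂ)) : 𝓓'(Ω, ℂ) := laplace T + k ^ 2 • T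

section helmholtz

variable {Ω : Opens ℂ} {k : ℝ}

lemma helmholtz_apply (T : 𝓓'(Ω, ℂ)) (φ : 𝓓(Ω, ℝ)) :
    helmholtz k T φ = (∑ j, T (∂_{dir j} (∂_{dir j} φ))) + (k : ℂ) ^ 2 * T φ := by
  rw [← laplace_apply]
  change laplace T φ + k ^ 2 • T φ = _
  simp

lemma helmholtz_add (S T : 𝓓'(Ω, ℂ)) : helmholtz k (S + T) = helmholtz k S + helmholtz k T := by
  ext φ
  change _ = helmholtz k S φ + helmholtz k T φ
  simp only [helmholtz_apply, Fin.sum_univ_two]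
  change S _ + T _ + (S _ + T _) + (k : ℂ) ^ 2 * (S φ + T φ) = _
  ring

lemma helmholtz_smul (c : ℂ) (T : 𝓓'(Ω, ℂ)) : helmholtz k (c • T) = c • helmholtz k T := by
  ext φ
  change _ = c * helmholtz k T φ
  simp only [helmholtz_apply, Fin.sum_univ_two]
  change c * T _ + c * T _ + (k : ℂ) ^ 2 * (c * T φ) = _
  ring

lemma helmholtz_zero : helmholtz k (0 : 𝓓'(Ω, ℂ)) = 0 := by
  ext φ
  rw [helmholtz_apply]
  change (∑ _j : Fin 2, (0 : ℂ)) + (k : ℂ) ^ 2 * 0 = 0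
  simp

lemma helmholtz_sum {ι : Type*} (s : Finset ι) (T : ι → 𝓓'(Ω, ℂ)) :
    helmholtz k (∑ i ∈ s, T i) = ∑ i ∈ s, helmholtz k (T i) := by
  classical
  induction s using Finset.induction_on with
  | empty => simp [helmholtz_zero]
  | insert a s ha ih => rw [Finset.sum_insert ha, Finset.sum_insert ha, helmholtz_add, ih]

lemma helmholtz_lineDeriv (w : ℂ) (T : 𝓓'(Ω, ℂ)) :
    helmholtz k (∂_{w} T) = ∂_{w} (helmholtz k T) := by
  ext φ
  rw [lineDeriv_dist_apply]
  simp only [helmholtz_apply, lineDeriv_dist_apply, Fin.sum_univ_two]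
  rw [lineDeriv_testFunction_comm w (dir 0), lineDeriv_testFunction_comm w (dir 1),
    lineDeriv_testFunction_comm w (dir 0), lineDeriv_testFunction_comm w (dir 1)]
  ring

end helmholtz

/-! ### The Helmholtz operator on Fourier modes -/

section modes

variable {ρ : ℝ} {n : ℤ} {V Vd : ℝ → ℂ}

lemma locallyIntegrableOn_modeFun (hρ : ρ ≤ 3) (n : ℤ) (hV : IsAmplitude 0 V Vd) :
    LocallyIntegrableOn (modeFun n V) (disc ρ) := by
  have h := integrable_modeFun_mul n le_rfl (by norm_num) (hV.intervalIntegrable_mul (by norm_num))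
    (h := (Metric.ball (0 : ℂ) 3).indicator 1) (measurable_one.indicator measurableSet_ball)
    (C := 1) (fun z => by
      by_cases hz : z ∈ Metric.ball (0 : ℂ) 3 <;> simp [hz]) (fun z hz => by
      refine indicator_of_notMem (fun hmem => ?_) _
      rw [mem_ball_zero_iff] at hmem
      rcases hz with hz | hz
      · linarith [norm_nonneg z]
      · linarith)
  have e : (fun z => modeFun n V z * (Metric.ball (0 : ℂ) 3).indicator 1 z)
      = (Metric.ball (0 : ℂ) 3).indicator (modeFun n V) := by
    funext z
    by_cases hz : z ∈ Metric.ball (0 : ℂ) 3 <;> simp [hz]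
  rw [e, integrable_indicator_iff measurableSet_ball] at h
  exact (h.mono_set (Metric.ball_subset_ball hρ)).locallyIntegrableOn

lemma funDist_modeFun_apply (hρ : ρ ≤ 3) (n : ℤ) (hV : IsAmplitude 0 V Vd) (φ : 𝓓(disc ρ, ℝ)) :
    funDist (disc ρ) (modeFun n V) φ = ∫ x, modeFun n V x * (φ x : ℂ) := by
  rw [funDist_apply (locallyIntegrableOn_modeFun hρ n hV)]
  simp only [mul_comm]

lemma agreesOffOrigin_modeFun (hρ : ρ ≤ 3) (n : ℤ) (hV : IsAmplitude 0 V Vd) :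
    AgreesOffOrigin (funDist (disc ρ) (modeFun n V)) (modeFun n V) := fun φ _ =>
  funDist_apply (locallyIntegrableOn_modeFun hρ n hV) φ

lemma sum_modeGrad {x : ℂ} (hx : x ≠ 0) (n : ℤ) (V Vd : ℝ → ℂ) (φ : ℂ → ℝ) :
    ∑ j, modeGrad n V Vd (dir j) x * (fderiv ℝ φ x (dir j) : ℂ) =
      fluxPairing n (fun _ => 1) (fun _ => 1) V Vd φ x := by
  have h := sum_sigmaR_modeGrad (σa := 1) (R := ‖x‖) hx n V Vd φ
  simp only [sigmaR, le_refl, if_true, one_smul, Matrix.one_apply, Fin.sum_univ_two] at h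
  rw [Fin.sum_univ_two]
  simpa [fluxPairing, massRad, massTan] using h

/-- A mode whose amplitude satisfies Bessel's equation on `0 < r < 3` satisfies the Helmholtz
equation up to a multiple of the delta function, given by the flux `F 0` out of the origin. -/
lemma helmholtz_modeFun_apply {k : ℝ} (hρ : ρ ≤ 3) (hV : IsAmplitude 0 V Vd) {F : ℝ → ℂ}
    (hF : ContinuousOn F (Icc 0 3)) (hFV : ∀ r ∈ Ioc (0 : ℝ) 3, F r = r * Vd r)
    (hd : ∀ r ∈ Ioo (0 : ℝ) 3, HasDerivAt F ((n ^ 2 / r - k ^ 2 * r) * V r) r)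
    (hF' : IntervalIntegrable (fun r : ℝ => ((n : ℂ) ^ 2 / r - k ^ 2 * r) * V r) volume 0 3)
    (φ : 𝓓(disc ρ, ℝ)) :
    helmholtz k (funDist (disc ρ) (modeFun n V)) φ = F 0 * ang (harm n) φ 0 := by
  have hφ := isAnnularTest_of_disc hρ φ
  have h1 : ∀ j, funDist (disc ρ) (modeFun n V) (∂_{dir j} (∂_{dir j} φ))
      = -∫ x, modeGrad n V Vd (dir j) x * (fderiv ℝ φ x (dir j) : ℂ) := by
    intro j
    rw [funDist_modeFun_apply hρ n hV]
    simp only [lineDeriv_testFunction_apply (dir j) (∂_{dir j} φ)]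
    rw [hV.weakDeriv (isAnnularTest_of_disc hρ (∂_{dir j} φ)) n (dir j)]
    rfl
  have hi : ∀ j, Integrable fun x => modeGrad n V Vd (dir j) x * (fderiv ℝ φ x (dir j) : ℂ) := by
    intro j
    have hφ' := isAnnularTest_of_disc hρ (∂_{dir j} φ)
    obtain ⟨C, hC⟩ := hφ'.exists_bound
    exact integrable_modeGrad_mul n le_rfl (by norm_num) hV (dir j)
      (h := fun x => (fderiv ℝ φ x (dir j) : ℂ))
      (Complex.measurable_ofReal.comp hφ'.contDiff.continuous.measurable) (C := C)
      (fun z => by rw [Complex.norm_real]; exact hC z) (fun z hz => by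
        have := hφ'.eq_zero hz
        rw [lineDeriv_testFunction_apply] at this
        rw [this, Complex.ofReal_zero])
  have hne : ∀ᵐ z : ℂ, z ≠ 0 := by simp [ae_iff, measure_singleton]
  obtain ⟨-, h2⟩ := integral_fluxPairing (V := V) (Vd := Vd) (mr := fun _ => 1) (mt := fun _ => 1)
    hφ n (S := ∅) countable_empty hF (fun r hr => hd r hr.1) hF'
    (fun r hr => by rw [hFV r hr]; simp) (by simpa using hV.intervalIntegrable)
  obtain ⟨-, h3⟩ := integral_weight_modeFun (V := V) hφ n (fun _ => 1)
    (by simpa using hV.intervalIntegrable_mul (by norm_num))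
  have h4 : ∑ j, ∫ x, modeGrad n V Vd (dir j) x * (fderiv ℝ φ x (dir j) : ℂ)
      = ∫ z, fluxPairing n (fun _ => 1) (fun _ => 1) V Vd φ z := by
    rw [← integral_finsetSum _ fun j _ => hi j]
    refine integral_congr_ae ?_
    filter_upwards [hne] with x hx
    exact sum_modeGrad hx n V Vd φ
  rw [helmholtz_apply, funDist_modeFun_apply hρ n hV]
  simp only [h1]
  rw [Finset.sum_neg_distrib, h4, h2]
  simp only [Complex.ofReal_one, one_mul] at h3
  rw [h3, ← intervalIntegral.integral_const_mul]
  have e : ∫ r in (0 : ℝ)..3, (((n : ℂ) ^ 2 / r - k ^ 2 * r) * V r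
      - n ^ 2 * (((1 : ℝ) : ℂ) * V r / r)) * ang (harm n) φ r
      = -∫ r in (0 : ℝ)..3, (k : ℂ) ^ 2 * ((r : ℂ) * V r * ang (harm n) φ r) := by
    rw [← intervalIntegral.integral_neg]
    refine intervalIntegral.integral_congr fun r _ => ?_
    push_cast
    ring
  rw [e]
  ring

end modes

section amplitudes

variable {k : ℝ}

/-- The amplitude of the regular mode of order `n`. -/
def regularAmp (k : ℝ) (n : ℤ) (r : ℝ) : ℂ := modeF chainJ k n.natAbs r

/-- The amplitude of the singular mode of order `n`. -/
def singularAmp (k : ℝ) (n : ℤ) (r : ℝ) : ℂ := modeF chainY k n.natAbs r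

lemma isAmplitude_of_chain {F : ℕ → ℝ → ℝ} (hF : IsBesselChain F) (hk : 0 < k) (n : ℕ) {a : ℝ}
    (ha : 0 < a) (ha3 : a ≤ 3) :
    IsAmplitude a (fun r => (modeF F k n r : ℂ)) (fun r => ((modeP F k n r / r : ℝ) : ℂ)) := by
  have hsub : Icc a 3 ⊆ Ioi 0 := fun r hr => ha.trans_le hr.1
  have c1 : ContinuousOn (fun r => (modeF F k n r : ℂ)) (Icc a 3) :=
    Complex.continuous_ofReal.comp_continuousOn ((continuousOn_modeF hF hk n).mono hsub)
  have c2 : ContinuousOn (fun r => (modeP F k n r : ℂ)) (Icc a 3) :=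
    Complex.continuous_ofReal.comp_continuousOn ((continuousOn_modeP hF hk n).mono hsub)
  refine ⟨Complex.continuous_ofReal.continuousOn.mul c1, ⟨∅, countable_empty, fun r hr => ?_⟩,
    ContinuousOn.intervalIntegrable (by rwa [uIcc_of_le ha3]), ?_⟩
  · exact (hasDerivAt_modeF hF hk n (ha.trans hr.1.1)).ofReal_comp
  · refine IntervalIntegrable.congr_ae (f := fun r => (modeP F k n r : ℂ))
      (ContinuousOn.intervalIntegrable (by rwa [uIcc_of_le ha3])) ?_
    rw [uIoc_of_le ha3]
    refine (ae_restrict_iff' measurableSet_Ioc).2 (ae_of_all _ fun r hr => ?_)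
    have : (r : ℂ) ≠ 0 := by exact_mod_cast (ha.trans hr.1).ne'
    push_cast
    field_simp

lemma isAmplitude_regularAmp (hk : 0 < k) (n : ℤ) :
    IsAmplitude 0 (regularAmp k n) (fun r => ((modeP chainJ k n.natAbs r / r : ℝ) : ℂ)) := by
  have c1 : Continuous (regularAmp k n) :=
    Complex.continuous_ofReal.comp (continuous_modeF_chainJ k _)
  have c2 : Continuous (fun r => (modeP chainJ k n.natAbs r : ℂ)) :=
    Complex.continuous_ofReal.comp (continuous_modeP_chainJ k _)
  refine ⟨(Complex.continuous_ofReal.mul c1).continuousOn, ⟨∅, countable_empty, fun r hr => ?_⟩,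
    c1.intervalIntegrable _ _, ?_⟩
  · exact (hasDerivAt_modeF isBesselChain_chainJ hk _ hr.1.1).ofReal_comp
  · refine (c2.intervalIntegrable 0 3).congr_ae ?_
    rw [uIoc_of_le (by norm_num)]
    refine (ae_restrict_iff' measurableSet_Ioc).2 (ae_of_all _ fun r hr => ?_)
    have : (r : ℂ) ≠ 0 := by exact_mod_cast hr.1.ne'
    push_cast
    field_simp

lemma helmholtz_regularAmp (hk : 0 < k) {ρ : ℝ} (hρ : ρ ≤ 3) (n : ℤ) :
    helmholtz k (funDist (disc ρ) (modeFun n (regularAmp k n))) = 0 := by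
  ext φ
  have h := helmholtz_modeFun_apply (k := k) (n := n) hρ (isAmplitude_regularAmp hk n)
    (F := fun r => (modeP chainJ k n.natAbs r : ℂ))
    (Complex.continuous_ofReal.comp (continuous_modeP_chainJ k _)).continuousOn
    (fun r hr => by
      have : (r : ℂ) ≠ 0 := by exact_mod_cast hr.1.ne'
      push_cast
      field_simp)
    (fun r hr => by
      refine (hasDerivAt_modeP isBesselChain_chainJ hk n.natAbs hr.1).ofReal_comp.congr_deriv ?_
      rw [← natAbs_sq_cast, regularAmp]
      push_cast
      ring) ?_ φ
  · rw [h]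
    change _ = (0 : ℂ)
    rcases Nat.eq_zero_or_pos n.natAbs with h0 | h0
    · simp [modeP, h0]
    · simp [modeP, modeF, h0.ne']
  · rcases Nat.eq_zero_or_pos n.natAbs with h0 | h0
    · have hn : n = 0 := Int.natAbs_eq_zero.1 h0
      have c : Continuous fun r : ℝ => -((k : ℂ) ^ 2 * r * regularAmp k n r) := by
        have : Continuous (regularAmp k n) :=
          Complex.continuous_ofReal.comp (continuous_modeF_chainJ k _)
        fun_prop
      refine (c.intervalIntegrable 0 3).congr_ae (ae_of_all _ fun r => ?_)
      simp [hn]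
    · obtain ⟨m, hm⟩ := Nat.exists_eq_succ_of_ne_zero h0.ne'
      have c : Continuous fun r : ℝ => (n : ℂ) ^ 2 * (r ^ m * chainJ n.natAbs (k ^ 2 * r ^ 2 / 4) : ℝ)
          - (k : ℂ) ^ 2 * r * regularAmp k n r := by
        have : Continuous (regularAmp k n) :=
          Complex.continuous_ofReal.comp (continuous_modeF_chainJ k _)
        have := continuous_chainJ n.natAbs
        fun_prop
      refine (c.intervalIntegrable 0 3).congr_ae ?_
      rw [uIoc_of_le (by norm_num)]
      refine (ae_restrict_iff' measurableSet_Ioc).2 (ae_of_all _ fun r hr => ?_)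
      have : (r : ℂ) ≠ 0 := by exact_mod_cast hr.1.ne'
      simp only [regularAmp, modeF, hm, pow_succ]
      push_cast
      field_simp

/-- The logarithmic mode is, up to a factor, the fundamental solution of the Helmholtz equation. -/
lemma singularAmp_zero_eq (hk : 0 < k) {r : ℝ} (hr : 0 < r) :
    modeF chainY k 0 r = chainJ 0 (k ^ 2 * r ^ 2 / 4) * (Real.log (k ^ 2 / 4) + 2 * Real.log r)
      + regY 0 (k ^ 2 * r ^ 2 / 4) := by
  have : Real.log (k ^ 2 * r ^ 2 / 4) = Real.log (k ^ 2 / 4) + 2 * Real.log r := by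
    rw [show k ^ 2 * r ^ 2 / 4 = k ^ 2 / 4 * r ^ 2 by ring, Real.log_mul (by positivity)
      (by positivity), Real.log_pow]
    norm_num
  rw [modeF, chainY, this]
  simp

/-- The flux of the logarithmic mode, extended to the origin. -/
def logFlux (k r : ℝ) : ℝ :=
  -2 * ((k ^ 2 * r ^ 2 / 4) * Real.log (k ^ 2 * r ^ 2 / 4) * chainJ 1 (k ^ 2 * r ^ 2 / 4)
    + regY 1 (k ^ 2 * r ^ 2 / 4))

lemma continuous_logFlux (k : ℝ) : Continuous (logFlux k) := by
  have h1 : Continuous fun r : ℝ => (k ^ 2 * r ^ 2 / 4) * Real.log (k ^ 2 * r ^ 2 / 4) :=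
    Real.continuous_mul_log.comp (by fun_prop)
  have := continuous_chainJ 1
  have := continuous_regY 1
  unfold logFlux
  fun_prop

lemma logFlux_zero (k : ℝ) : logFlux k 0 = 2 := by simp [logFlux, regY_one_zero]

lemma logFlux_eq (hk : 0 < k) {r : ℝ} (hr : 0 < r) : logFlux k r = modeP chainY k 0 r := by
  have h : k ^ 2 * r ^ 2 / 4 ≠ 0 := by positivity
  rw [logFlux, modeP, chainY]
  field_simp
  simp
  ring

lemma isAmplitude_singularAmp_zero (hk : 0 < k) :
    IsAmplitude 0 (singularAmp k 0) (fun r => ((modeP chainY k 0 r / r : ℝ) : ℂ)) := by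
  have cJ := continuous_chainJ 0
  have cY := continuous_regY 0
  refine ⟨?_, ⟨∅, countable_empty, fun r hr => ?_⟩, ?_, ?_⟩
  · have c : Continuous fun r : ℝ => chainJ 0 (k ^ 2 * r ^ 2 / 4)
        * (r * Real.log (k ^ 2 / 4) + 2 * (r * Real.log r)) + r * regY 0 (k ^ 2 * r ^ 2 / 4) := by
      have := Real.continuous_mul_log
      fun_prop
    refine (Complex.continuous_ofReal.comp c).continuousOn.congr fun r hr => ?_
    rcases eq_or_lt_of_le hr.1 with h | h
    · simp [← h]
    · simp only [singularAmp, Int.natAbs_zero, singularAmp_zero_eq hk h, Function.comp]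
      push_cast
      ring
  · exact (hasDerivAt_modeF isBesselChain_chainY hk 0 hr.1.1).ofReal_comp
  · have h1 : IntervalIntegrable (fun r : ℝ => chainJ 0 (k ^ 2 * r ^ 2 / 4)
        * (Real.log (k ^ 2 / 4) + 2 * Real.log r) + regY 0 (k ^ 2 * r ^ 2 / 4)) volume 0 3 := by
      refine IntervalIntegrable.add ?_ (Continuous.intervalIntegrable (by fun_prop) _ _)
      refine IntervalIntegrable.continuousOn_mul ?_ (Continuous.continuousOn (by fun_prop))
      exact intervalIntegrable_const.add (intervalIntegral.intervalIntegrable_log'.const_mul 2)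
    have h2 : IntervalIntegrable (fun r : ℝ => ((chainJ 0 (k ^ 2 * r ^ 2 / 4)
        * (Real.log (k ^ 2 / 4) + 2 * Real.log r) + regY 0 (k ^ 2 * r ^ 2 / 4) : ℝ) : ℂ))
        volume 0 3 := ⟨h1.1.ofReal, h1.2.ofReal⟩
    refine h2.congr_ae ?_
    rw [uIoc_of_le (by norm_num)]
    refine (ae_restrict_iff' measurableSet_Ioc).2 (ae_of_all _ fun r hr => ?_)
    simp only [singularAmp, Int.natAbs_zero, singularAmp_zero_eq hk hr.1]
  · refine ((Complex.continuous_ofReal.comp (continuous_logFlux k)).intervalIntegrable 0 3).congr_ae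
      ?_
    rw [uIoc_of_le (by norm_num)]
    refine (ae_restrict_iff' measurableSet_Ioc).2 (ae_of_all _ fun r hr => ?_)
    have : (r : ℂ) ≠ 0 := by exact_mod_cast hr.1.ne'
    simp only [Function.comp, logFlux_eq hk hr.1]
    push_cast
    field_simp

lemma helmholtz_singularAmp_zero (hk : 0 < k) {ρ : ℝ} (hρ : ρ ≤ 3) :
    helmholtz k (funDist (disc ρ) (modeFun 0 (singularAmp k 0)))
      = ((4 * Real.pi : ℝ) : ℂ) • derivDelta (disc ρ) (0, 0) := by
  ext φ
  have hA := isAmplitude_singularAmp_zero hk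
  have h := helmholtz_modeFun_apply (k := k) (n := 0) hρ hA
    (F := fun r => (logFlux k r : ℂ))
    (Complex.continuous_ofReal.comp (continuous_logFlux k)).continuousOn
    (fun r hr => by
      have : (r : ℂ) ≠ 0 := by exact_mod_cast hr.1.ne'
      rw [logFlux_eq hk hr.1]
      push_cast
      field_simp)
    (fun r hr => by
      have h1 : HasDerivAt (logFlux k) ((((0 : ℕ) : ℝ) ^ 2 / r - k ^ 2 * r) * modeF chainY k 0 r) r := by
        refine (hasDerivAt_modeP isBesselChain_chainY hk 0 hr.1).congr_of_eventuallyEq ?_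
        filter_upwards [lt_mem_nhds hr.1] with s hs
        exact logFlux_eq hk hs
      refine h1.ofReal_comp.congr_deriv ?_
      simp [singularAmp])
    (by
      refine ((hA.intervalIntegrable_mul (by norm_num)).const_mul (-(k : ℂ) ^ 2)).congr_ae
        (ae_of_all _ fun r => ?_)
      simp
      ring) φ
  rw [h]
  change _ = ((4 * Real.pi : ℝ) : ℂ) * ((φ 0 : ℝ) : ℂ)
  have e : ang (harm 0) φ 0 = ((2 * Real.pi : ℝ) : ℂ) * (φ 0 : ℂ) := by
    simp [ang, harm, pt]
    exact Or.inl (by ring)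
  rw [e, logFlux_zero]
  push_cast
  ring

end amplitudes

/-! ### Derivatives of the singular modes -/

section singular

variable {k : ℝ}

/-- The finite sum `∑ b_n Y_n(r) e^{inθ}` of singular modes. -/
def singularField (k : ℝ) (b : ℤ →₀ ℂ) (z : ℂ) : ℂ :=
  b.sum fun n c => c * modeFun n (singularAmp k n) z

/-- The coefficient of the mode of order `n + 1` in `2 ∂/∂z̄` of the singular mode of order `n`. -/
def raiseCoeff (k : ℝ) (n : ℤ) : ℂ := if 0 ≤ n then -(k ^ 2 / 2) else 2

/-- The coefficient of the mode of order `n - 1` in `2 ∂/∂z` of the singular mode of order `n`. -/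
def lowerCoeff (k : ℝ) (n : ℤ) : ℂ := if 0 < n then 2 else -(k ^ 2 / 2)

/-- The coefficients of the derivative in direction `w` of the field with coefficients `b`. -/
def fieldDeriv (k : ℝ) (w : ℂ) (b : ℤ →₀ ℂ) : ℤ →₀ ℂ :=
  b.sum fun n c => Finsupp.single (n - 1) (c * (w / 2 * lowerCoeff k n))
    + Finsupp.single (n + 1) (c * ((starRingEnd ℂ) w / 2 * raiseCoeff k n))

lemma singularField_single (n : ℤ) (c z : ℂ) :
    singularField k (Finsupp.single n c) z = c * modeFun n (singularAmp k n) z := by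
  simp [singularField]

lemma singularField_add (b b' : ℤ →₀ ℂ) (z : ℂ) :
    singularField k (b + b') z = singularField k b z + singularField k b' z := by
  rw [singularField, Finsupp.sum_add_index' (by simp) (by intros; ring)]
  rfl

lemma singularField_smul (c : ℂ) (b : ℤ →₀ ℂ) (z : ℂ) :
    singularField k (c • b) z = c * singularField k b z := by
  rw [singularField, Finsupp.sum_smul_index (by simp), singularField, Finsupp.mul_sum]
  simp only [mul_assoc]

lemma chain_lower {F : ℕ → ℝ → ℝ} (hF : IsBesselChain F) (hk : 0 < k) (m : ℕ) {r : ℝ}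
    (hr : 0 < r) :
    modeP F k (m + 1) r / r + (m + 1) * (modeF F k (m + 1) r / r) = 2 * modeF F k m r := by
  have h := hF.recurrence m (k ^ 2 * r ^ 2 / 4) (by positivity)
  rw [modeP, modeF, modeF]
  push_cast
  field_simp
  linear_combination (-4 : ℝ) * h * r ^ (m + 1)

lemma chain_raise (F : ℕ → ℝ → ℝ) (m : ℕ) {r : ℝ} (hr : 0 < r) :
    modeP F k m r / r - m * (modeF F k m r / r) = -(k ^ 2 / 2) * modeF F k (m + 1) r := by
  rw [modeP, modeF, modeF]
  field_simp
  ring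

/-- The derivative of a singular mode is a combination of the two neighbouring modes. -/
lemma modeGrad_singularAmp (hk : 0 < k) (n : ℤ) (w : ℂ) {z : ℂ} (hz : z ≠ 0) :
    modeGrad n (singularAmp k n) (fun r => ((modeP chainY k n.natAbs r / r : ℝ) : ℂ)) w z
      = w / 2 * lowerCoeff k n * modeFun (n - 1) (singularAmp k (n - 1)) z
        + (starRingEnd ℂ) w / 2 * raiseCoeff k n * modeFun (n + 1) (singularAmp k (n + 1)) z := by
  have hr : 0 < ‖z‖ := norm_pos_iff.2 hz
  have hu := unitDir_ne_zero hz
  have hconj : (starRingEnd ℂ) (unitDir z) * unitDir z = 1 := by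
    rw [← Complex.normSq_eq_conj_mul_self, Complex.normSq_eq_norm_sq, norm_unitDir hz]
    simp
  have hup : ((modeP chainY k n.natAbs ‖z‖ / ‖z‖ : ℝ) : ℂ) - n * (singularAmp k n ‖z‖ / ‖z‖)
      = raiseCoeff k n * singularAmp k (n + 1) ‖z‖ := by
    rcases le_or_gt 0 n with h | h
    · lift n to ℕ using h
      have := chain_raise (k := k) chainY n hr
      simp only [singularAmp, raiseCoeff, Int.natAbs_natCast, Nat.cast_nonneg, if_true,
        show ((n : ℤ) + 1).natAbs = n + 1 by omega]
      exact_mod_cast this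
    · obtain ⟨m, rfl⟩ : ∃ m : ℕ, n = -(m + 1 : ℕ) := ⟨(-n - 1).toNat, by omega⟩
      have := chain_lower isBesselChain_chainY hk m hr
      simp only [singularAmp, raiseCoeff, if_neg (not_le.2 h), Int.natAbs_neg, Int.natAbs_natCast,
        show (-((m + 1 : ℕ) : ℤ) + 1).natAbs = m by omega]
      rw [← sub_eq_zero] at this ⊢
      rw [← Complex.ofReal_inj] at this
      push_cast at this ⊢
      linear_combination this
  have hdown : ((modeP chainY k n.natAbs ‖z‖ / ‖z‖ : ℝ) : ℂ) + n * (singularAmp k n ‖z‖ / ‖z‖)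
      = lowerCoeff k n * singularAmp k (n - 1) ‖z‖ := by
    rcases lt_or_ge 0 n with h | h
    · obtain ⟨m, rfl⟩ : ∃ m : ℕ, n = (m + 1 : ℕ) := ⟨(n - 1).toNat, by omega⟩
      have := chain_lower isBesselChain_chainY hk m hr
      simp only [singularAmp, lowerCoeff, if_pos h, Int.natAbs_natCast,
        show (((m + 1 : ℕ) : ℤ) - 1).natAbs = m by omega]
      rw [← sub_eq_zero] at this ⊢
      rw [← Complex.ofReal_inj] at this
      push_cast at this ⊢
      linear_combination this
    · obtain ⟨m, rfl⟩ : ∃ m : ℕ, n = -(m : ℤ) := ⟨n.natAbs, by omega⟩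
      have := chain_raise (k := k) chainY m hr
      simp only [singularAmp, lowerCoeff, if_neg (not_lt.2 h), Int.natAbs_neg, Int.natAbs_natCast,
        show (-(m : ℤ) - 1).natAbs = m + 1 by omega]
      rw [← sub_eq_zero] at this ⊢
      rw [← Complex.ofReal_inj] at this
      push_cast at this ⊢
      linear_combination this
  have hre : (((w * (starRingEnd ℂ) (unitDir z)).re : ℝ) : ℂ)
      = (w * (starRingEnd ℂ) (unitDir z) + (starRingEnd ℂ) w * unitDir z) / 2 := by
    rw [Complex.re_eq_add_conj]; simp
  have him : (((w * (starRingEnd ℂ) (unitDir z)).im : ℝ) : ℂ)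
      = (w * (starRingEnd ℂ) (unitDir z) - (starRingEnd ℂ) w * unitDir z) / (2 * Complex.I) := by
    rw [Complex.im_eq_sub_conj]; simp
  have hinv : (starRingEnd ℂ) (unitDir z) = (unitDir z)⁻¹ := eq_inv_of_mul_eq_one_left hconj
  simp only [modeGrad, modeFun]
  rw [hre, him, hinv, zpow_sub_one₀ hu, zpow_add_one₀ hu]
  have hI : Complex.I ≠ 0 := Complex.I_ne_zero
  field_simp
  linear_combination w * hdown + ((starRingEnd ℂ) w * unitDir z ^ 2) * hup

lemma integrable_singularAmp_mul (hk : 0 < k) (n : ℤ) {φ : ℂ → ℝ} {a₀ : ℝ} (ha0 : 0 < a₀)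
    (hφ : IsAnnularTest a₀ φ) : Integrable fun z => modeFun n (singularAmp k n) z * (φ z : ℂ) := by
  obtain ⟨C, hC⟩ := hφ.exists_bound
  exact integrable_modeFun_mul n ha0.le hφ.le_three
    ((isAmplitude_of_chain isBesselChain_chainY hk n.natAbs ha0 hφ.le_three).intervalIntegrable_mul
      hφ.le_three)
    (Complex.measurable_ofReal.comp hφ.contDiff.continuous.measurable) (C := C)
    (fun z => by rw [Complex.norm_real]; exact hC z) (fun z hz => by simp [hφ.eq_zero hz])

lemma integrable_singularField_mul (hk : 0 < k) (b : ℤ →₀ ℂ) {φ : ℂ → ℝ} {a₀ : ℝ} (ha0 : 0 < a₀)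
    (hφ : IsAnnularTest a₀ φ) : Integrable fun z => (φ z : ℂ) * singularField k b z := by
  have h : Integrable fun z => ∑ n ∈ b.support, b n * (modeFun n (singularAmp k n) z * (φ z : ℂ)) :=
    integrable_finsetSum _ fun n _ => (integrable_singularAmp_mul hk n ha0 hφ).const_mul _
  refine h.congr (ae_of_all _ fun z => ?_)
  simp only [singularField, Finsupp.sum, Finset.mul_sum]
  exact Finset.sum_congr rfl fun n _ => by ring

lemma integral_fieldDeriv (hk : 0 < k) (w : ℂ) (b : ℤ →₀ ℂ) {φ : ℂ → ℝ} {a₀ : ℝ} (ha0 : 0 < a₀)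
    (hφ : IsAnnularTest a₀ φ) (hi : ∀ b', Integrable fun z => (fderiv ℝ φ z w : ℂ) * singularField k b' z) :
    ∫ z, (fderiv ℝ φ z w : ℂ) * singularField k b z
      = -∫ z, (φ z : ℂ) * singularField k (fieldDeriv k w b) z := by
  induction b using Finsupp.induction_linear with
  | zero => simp [singularField, fieldDeriv]
  | add b b' h h' =>
    have e : fieldDeriv k w (b + b') = fieldDeriv k w b + fieldDeriv k w b' := by
      rw [fieldDeriv, Finsupp.sum_add_index' (by simp) ?_]
      · rfl
      · intro n c c'
        rw [add_mul, add_mul, Finsupp.single_add, Finsupp.single_add]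
        abel
    simp only [e, singularField_add, mul_add]
    rw [integral_add (hi b) (hi b'), integral_add (integrable_singularField_mul hk _ ha0 hφ)
      (integrable_singularField_mul hk _ ha0 hφ), h, h']
    ring
  | single n c =>
    have hA := isAmplitude_of_chain isBesselChain_chainY hk n.natAbs ha0 hφ.le_three
    have key := hA.weakDeriv hφ n w
    have hne : ∀ᵐ z : ℂ, z ≠ 0 := by simp [ae_iff, measure_singleton]
    have e1 : fieldDeriv k w (Finsupp.single n c)
        = Finsupp.single (n - 1) (c * (w / 2 * lowerCoeff k n))
          + Finsupp.single (n + 1) (c * ((starRingEnd ℂ) w / 2 * raiseCoeff k n)) := by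
      rw [fieldDeriv, Finsupp.sum_single_index (by simp)]
    calc _ = c * ∫ z, modeFun n (singularAmp k n) z * (fderiv ℝ φ z w : ℂ) := by
          rw [← integral_const_mul]
          refine integral_congr_ae (ae_of_all _ fun z => ?_)
          simp only [singularField_single]
          ring
      _ = -∫ z, c * (modeGrad n (singularAmp k n)
            (fun r => ((modeP chainY k n.natAbs r / r : ℝ) : ℂ)) w z * (φ z : ℂ)) := by
          rw [integral_const_mul, ← mul_neg]
          exact congrArg _ key
      _ = _ := by
          congr 1
          refine integral_congr_ae ?_
          filter_upwards [hne] with z hz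
          rw [modeGrad_singularAmp hk n w hz, e1, singularField_add, singularField_single,
            singularField_single]
          ring

lemma isAnnularTest_of_agrees {ρ : ℝ} (hρ : ρ ≤ 3) (φ : 𝓓(disc ρ, ℝ)) (h0 : (0 : ℂ) ∉ tsupport φ) :
    ∃ a₀, 0 < a₀ ∧ IsAnnularTest a₀ φ :=
  exists_isAnnularTest_of_notMem (φ.contDiff.of_le (by exact_mod_cast le_top)) φ.hasCompactSupport
    (φ.tsupport_subset.trans (Metric.ball_subset_ball hρ)) h0

lemma AgreesOffOrigin.lineDeriv (hk : 0 < k) {ρ : ℝ} (hρ : ρ ≤ 3) {T : 𝓓'(disc ρ, ℂ)} {b : ℤ →₀ ℂ}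
    (h : AgreesOffOrigin T (singularField k b)) (w : ℂ) :
    AgreesOffOrigin (∂_{w} T) (singularField k (fieldDeriv k w b)) := by
  intro φ h0
  have h0' : (0 : ℂ) ∉ tsupport (∂_{w} φ : 𝓓(disc ρ, ℝ)) := fun hmem =>
    h0 (tsupport_fderiv_apply_subset ℝ w hmem)
  obtain ⟨a₀, ha0, hφ⟩ := isAnnularTest_of_agrees hρ φ h0
  obtain ⟨a₁, ha1, hφ'⟩ := isAnnularTest_of_agrees hρ _ h0'
  rw [lineDeriv_dist_apply, h _ h0']
  have := integral_fieldDeriv hk w b ha0 hφ fun b' => integrable_singularField_mul hk b' ha1 hφ'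
  simp only [lineDeriv_testFunction_apply]
  rw [this, neg_neg]

/-- The coefficients of the field radiated by `∂^α δ_0`. -/
def sourceCoeff (k : ℝ) (α : ℕ × ℕ) : ℤ →₀ ℂ :=
  (fieldDeriv k 1)^[α.1] ((fieldDeriv k Complex.I)^[α.2]
    (Finsupp.single 0 ((4 * Real.pi : ℝ) : ℂ)⁻¹))

lemma exists_fundamental_deriv (hk : 0 < k) {ρ : ℝ} (hρ : ρ ≤ 3) (α : ℕ × ℕ) :
    ∃ T : 𝓓'(disc ρ, ℂ), AgreesOffOrigin T (singularField k (sourceCoeff k α)) ∧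
      helmholtz k T = derivDelta (disc ρ) α := by
  have step : ∀ (w : ℂ) (m : ℕ) (b : ℤ →₀ ℂ) (S : 𝓓'(disc ρ, ℂ)),
      (∃ T : 𝓓'(disc ρ, ℂ), AgreesOffOrigin T (singularField k b) ∧ helmholtz k T = S) →
      ∃ T : 𝓓'(disc ρ, ℂ), AgreesOffOrigin T (singularField k ((fieldDeriv k w)^[m] b)) ∧
        helmholtz k T = (fun T : 𝓓'(disc ρ, ℂ) => ∂_{w} T)^[m] S := by
    intro w m b S h
    induction m with
    | zero => exact h
    | succ m ih =>
      obtain ⟨T, h1, h2⟩ := ih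
      refine ⟨∂_{w} T, ?_, ?_⟩
      · rw [Function.iterate_succ_apply']
        exact h1.lineDeriv hk hρ w
      · rw [Function.iterate_succ_apply', helmholtz_lineDeriv, h2]
  -- derivatives commute with the Helmholtz operator, so the fundamental solution suffices; the
  -- factor `4π` is the flux `2` of the logarithmic mode times the length `2π` of the circle
  refine step 1 α.1 _ _ (step Complex.I α.2 _ _ ?_)
  have hpi : ((4 * Real.pi : ℝ) : ℂ) ≠ 0 := by
    exact_mod_cast (by positivity : (0 : ℝ) < 4 * Real.pi).ne'
  refine ⟨((4 * Real.pi : ℝ) : ℂ)⁻¹ • funDist (disc ρ) (modeFun 0 (singularAmp k 0)), ?_, ?_⟩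
  · intro φ h0
    change ((4 * Real.pi : ℝ) : ℂ)⁻¹ * funDist (disc ρ) (modeFun 0 (singularAmp k 0)) φ = _
    rw [agreesOffOrigin_modeFun hρ 0 (isAmplitude_singularAmp_zero hk) φ h0, ← integral_const_mul]
    refine integral_congr_ae (ae_of_all _ fun z => ?_)
    simp only [singularField_single]
    ring
  · rw [helmholtz_smul, helmholtz_singularAmp_zero hk hρ]
    ext φ
    change ((4 * Real.pi : ℝ) : ℂ)⁻¹ * (((4 * Real.pi : ℝ) : ℂ) * ((φ 0 : ℝ) : ℂ)) = ((φ 0 : ℝ) : ℂ)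
    rw [inv_mul_cancel_left₀ hpi]

/-- The coefficients of the field radiated by a point source. -/
def sourceField (k : ℝ) (N : ℕ) (q : ℕ × ℕ → ℂ) : ℤ →₀ ℂ :=
  ∑ α ∈ (Finset.range (N + 1) ×ˢ Finset.range (N + 1)).filter (fun α => α.1 + α.2 ≤ N),
    q α • sourceCoeff k α

/-- A field of a point source is a finite sum of singular modes, with coefficients that
do not depend on the disc. -/
lemma exists_source_dist (hk : 0 < k) {ρ : ℝ} (hρ : ρ ≤ 3) (N : ℕ) (q : ℕ × ℕ → ℂ) :
    ∃ T : 𝓓'(disc ρ, ℂ), AgreesOffOrigin T (singularField k (sourceField k N q)) ∧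
      helmholtz k T = ∑ α ∈ (Finset.range (N + 1) ×ˢ Finset.range (N + 1)).filter
        (fun α => α.1 + α.2 ≤ N), q α • derivDelta (disc ρ) α := by
  rw [sourceField]
  generalize (Finset.range (N + 1) ×ˢ Finset.range (N + 1)).filter (fun α => α.1 + α.2 ≤ N) = s
  classical
  induction s using Finset.induction_on with
  | empty => exact ⟨0, fun φ _ => by simp [singularField], by simp [helmholtz_zero]⟩
  | insert α s hα ih =>
    obtain ⟨T, h1, h2⟩ := ih
    obtain ⟨S, h3, h4⟩ := exists_fundamental_deriv hk hρ α
    refine ⟨q α • S + T, fun φ h0 => ?_, ?_⟩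
    · obtain ⟨a₀, ha0, hφ⟩ := isAnnularTest_of_agrees hρ φ h0
      change q α * S φ + T φ = _
      rw [h1 φ h0, h3 φ h0, Finset.sum_insert hα, ← integral_const_mul, ← integral_add
        ((integrable_singularField_mul hk _ ha0 hφ).const_mul _)
        (integrable_singularField_mul hk _ ha0 hφ)]
      refine integral_congr_ae (ae_of_all _ fun z => ?_)
      simp only [singularField_add, singularField_smul]
      ring
    · rw [helmholtz_add, helmholtz_smul, h2, h4, Finset.sum_insert hα]

end singular

/-! ### Superposition of weak solutions -/

lemma integrable_mul_of_annulus {f h : ℂ → ℂ} {ε C : ℝ}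
    (hf : IntegrableOn f {x : ℂ | ε < ‖x‖ ∧ ‖x‖ < 3}) (hm : Measurable h) (hC : ∀ z, ‖h z‖ ≤ C)
    (h0 : ∀ z, ‖z‖ ≤ ε ∨ 3 ≤ ‖z‖ → h z = 0) : Integrable fun z => f z * h z := by
  have hmeas : MeasurableSet {x : ℂ | ε < ‖x‖ ∧ ‖x‖ < 3} :=
    (measurableSet_lt measurable_const measurable_norm).inter
      (measurableSet_lt measurable_norm measurable_const)
  have h1 : IntegrableOn (fun z => f z * h z) {x : ℂ | ε < ‖x‖ ∧ ‖x‖ < 3} :=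
    Integrable.mul_bdd (c := C) hf hm.aestronglyMeasurable (ae_of_all _ hC)
  refine (integrableOn_iff_integrable_of_support_subset fun z hz => ?_).1 h1
  by_contra hcon
  refine hz ?_
  simp only [mem_ofPred_eq, not_and_or, not_lt] at hcon
  simp [h0 z hcon]

lemma measurable_sigmaR (σa R : ℝ) (j k : Fin 2) : Measurable fun x => sigmaR σa R x j k := by
  have hc : ∀ j, Measurable fun x : ℂ => coord (unitDir x) j := by
    intro j
    fin_cases j
    · exact Complex.measurable_re.comp measurable_unitDir
    · exact Complex.measurable_im.comp measurable_unitDir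
  have h1 := (measurable_massRad σa R).comp (measurable_norm (α := ℂ))
  have h2 := (measurable_massTan σa R).comp (measurable_norm (α := ℂ))
  simp only [sigmaR_apply, radialProj_apply]
  exact (h1.mul ((hc j).mul (hc k))).add (h2.mul (measurable_const.sub ((hc j).mul (hc k))))

lemma exists_sigmaR_bound {σa R : ℝ} (hσa : 0 < σa) (hR : 1 < R) :
    ∃ C : ℝ, 0 ≤ C ∧ ∀ x j k, x ≠ 0 → |sigmaR σa R x j k| ≤ C := by
  obtain ⟨C, hC0, hC⟩ := exists_medium_bound hσa one_pos hR
  refine ⟨C * 1 + C * (1 + 1), by positivity, fun x j k hx => ?_⟩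
  obtain ⟨-, h1, -, h2, -⟩ := hC ‖x‖ (norm_pos_iff.2 hx)
  have hc : ∀ j, |coord (unitDir x) j| ≤ 1 := by
    intro j
    fin_cases j
    · exact (Complex.abs_re_le_norm _).trans (norm_unitDir_le x)
    · exact (Complex.abs_im_le_norm _).trans (norm_unitDir_le x)
  have hp : |radialProj x j k| ≤ 1 := by
    rw [radialProj_apply, abs_mul]
    exact mul_le_one₀ (hc j) (abs_nonneg _) (hc k)
  have hd : |(1 : Matrix (Fin 2) (Fin 2) ℝ) j k| ≤ 1 := by
    rw [Matrix.one_apply]; split_ifs <;> simp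
  rw [sigmaR_apply]
  refine (abs_add_le _ _).trans ?_
  rw [abs_mul, abs_mul]
  gcongr
  exact (abs_sub _ _).trans (add_le_add hd hp)

namespace IsWeakSolution

variable {σa la ω R : ℝ} {u v : ℂ → ℂ} {g h : Fin 2 → ℂ → ℂ}

lemma integrableOn_annulus (hu : IsWeakSolution σa la ω R u g) {ε : ℝ} (hε : 0 < ε) :
    IntegrableOn u {x : ℂ | ε < ‖x‖ ∧ ‖x‖ < 3} := by
  have hK : IsCompact {x : ℂ | ε ≤ ‖x‖ ∧ ‖x‖ ≤ 3} := by
    refine Metric.isCompact_of_isClosed_isBounded ?_ ?_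
    · exact (isClosed_le continuous_const continuous_norm).inter
        (isClosed_le continuous_norm continuous_const)
    · exact (Metric.isBounded_closedBall (x := (0 : ℂ)) (r := 3)).subset fun x hx =>
        mem_closedBall_zero_iff.2 hx.2
  refine ((hu.continuousOn.mono fun x hx => ?_).integrableOn_compact hK).mono_set
    fun x hx => ⟨hx.1.le, hx.2.le⟩
  refine ⟨mem_closedBall_zero_iff.2 hx.2, fun h0 => ?_⟩
  have := hx.1
  rw [mem_singleton_iff.1 h0, norm_zero] at this
  linarith

lemma integrableOn_gradient (hu : IsWeakSolution σa la ω R u g) (j : Fin 2) {ε : ℝ} (hε : 0 < ε) :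
    IntegrableOn (g j) {x : ℂ | ε < ‖x‖ ∧ ‖x‖ < 3} := by
  have : IsFiniteMeasure (volume.restrict {x : ℂ | ε < ‖x‖ ∧ ‖x‖ < 3}) :=
    ⟨by
      rw [Measure.restrict_apply_univ]
      exact (measure_mono fun x hx => mem_ball_zero_iff.2 hx.2).trans_lt
        (measure_ball_lt_top (x := (0 : ℂ)) (r := 3))⟩
  exact (hu.memLp j ε hε).integrable (by norm_num)

variable {φ : ℂ → ℝ} {a₀ : ℝ}

lemma integrable_mul_test (hf : ∀ ε : ℝ, 0 < ε → IntegrableOn u {x : ℂ | ε < ‖x‖ ∧ ‖x‖ < 3})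
    (hφ : IsAnnularTest a₀ φ) (ha0 : 0 < a₀) : Integrable fun z => u z * (φ z : ℂ) := by
  obtain ⟨C, hC⟩ := hφ.exists_bound
  refine integrable_mul_of_annulus (hf (a₀ / 2) (by positivity))
    (Complex.measurable_ofReal.comp hφ.contDiff.continuous.measurable) (C := C)
    (fun z => by rw [Complex.norm_real]; exact hC z) fun z hz => ?_
  have := hφ.eq_zero (z := z) (hz.imp_left fun h => by linarith)
  simp [this]

lemma integrable_mul_fderiv (hf : ∀ ε : ℝ, 0 < ε → IntegrableOn u {x : ℂ | ε < ‖x‖ ∧ ‖x‖ < 3})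
    (hφ : IsAnnularTest a₀ φ) (ha0 : 0 < a₀) (w : ℂ) :
    Integrable fun z => u z * (fderiv ℝ φ z w : ℂ) := by
  obtain ⟨C, hC⟩ := hφ.exists_bound_fderiv
  refine integrable_mul_of_annulus (hf (a₀ / 2) (by positivity))
    (Complex.measurable_ofReal.comp (hφ.measurable_fderiv_apply measurable_const)) (C := C * ‖w‖)
    (fun z => by
      rw [Complex.norm_real]
      exact ((fderiv ℝ φ z).le_opNorm w).trans (by gcongr; exact hC z)) fun z hz => ?_
  have := hφ.fderiv_eq_zero (z := z) (hz.imp_left fun h => by linarith)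
  simp [this]

lemma integrable_flux (hσa : 0 < σa) (hR : 1 < R) (hu : IsWeakSolution σa la ω R u g)
    (hφ : IsAnnularTest a₀ φ) (ha0 : 0 < a₀) :
    Integrable fun x => ∑ j, ∑ k, (sigmaR σa R x j k : ℂ) * g j x * (fderiv ℝ φ x (dir k) : ℂ) := by
  obtain ⟨C, hC⟩ := hφ.exists_bound_fderiv
  obtain ⟨D, hD0, hD⟩ := exists_sigmaR_bound hσa hR
  refine integrable_finsetSum _ fun j _ => integrable_finsetSum _ fun k _ => ?_
  have hC0 := (norm_nonneg _).trans (hC 0)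
  refine (integrable_mul_of_annulus (hu.integrableOn_gradient j (ε := a₀ / 2) (by positivity))
    (h := fun x => (sigmaR σa R x j k : ℂ) * (fderiv ℝ φ x (dir k) : ℂ))
    ((Complex.measurable_ofReal.comp (measurable_sigmaR σa R j k)).mul
      (Complex.measurable_ofReal.comp (hφ.measurable_fderiv_apply measurable_const)))
    (C := D * (C * ‖dir k‖)) (fun z => ?_) fun z hz => ?_).congr
    (ae_of_all _ fun z => by simp only; ring)
  · rcases eq_or_ne z 0 with rfl | hz
    · rw [hφ.fderiv_eq_zero (by simpa using Or.inl ha0)]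
      simp only [zero_apply, Complex.ofReal_zero, mul_zero, norm_zero]
      positivity
    · rw [norm_mul, Complex.norm_real, Complex.norm_real]
      gcongr
      · exact hD z j k hz
      · exact ((fderiv ℝ φ z).le_opNorm _).trans (by gcongr; exact hC z)
  · have := hφ.fderiv_eq_zero (z := z) (hz.imp_left fun h => by linarith)
    simp [this]

lemma integrable_mass (hla : 0 < la) (hR : 1 < R) (hu : IsWeakSolution σa la ω R u g)
    (hφ : IsAnnularTest a₀ φ) (ha0 : 0 < a₀) :
    Integrable fun x => (ω : ℂ) ^ 2 * ((lambdaR la R x)⁻¹ : ℝ) * u x * (φ x : ℂ) := by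
  obtain ⟨C, hC⟩ := hφ.exists_bound
  obtain ⟨D, hD0, hD⟩ := exists_medium_bound one_pos hla hR
  have hC0 := (norm_nonneg _).trans (hC 0)
  have hm := ((measurable_modulusRad la R).comp (measurable_norm (α := ℂ))).inv
  refine ((integrable_mul_of_annulus (hu.integrableOn_annulus (ε := a₀ / 2) (by positivity))
    (h := fun x => (((modulusRad la R ‖x‖)⁻¹ : ℝ) : ℂ) * (φ x : ℂ))
    ((Complex.measurable_ofReal.comp hm).mul
      (Complex.measurable_ofReal.comp hφ.contDiff.continuous.measurable))
    (C := D * C) (fun z => ?_) fun z hz => ?_).const_mul ((ω : ℂ) ^ 2)).congr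
    (ae_of_all _ fun z => by simp only [lambdaR_eq]; ring)
  · rcases eq_or_ne z 0 with rfl | hz
    · rw [hφ.eq_zero (by simpa using Or.inl ha0)]
      simp only [Complex.ofReal_zero, mul_zero, norm_zero]
      positivity
    · rw [norm_mul, Complex.norm_real, Complex.norm_real]
      gcongr
      · exact (hD ‖z‖ (norm_pos_iff.2 hz)).2.2.2.2
      · exact hC z
  · have := hφ.eq_zero (z := z) (hz.imp_left fun h => by linarith)
    simp [this]

lemma zero : IsWeakSolution σa la ω R 0 0 where
  continuousOn := continuousOn_const
  boundary _ _ := rfl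
  memLp _ _ _ := MemLp.zero
  weakGradient j φ := by simp
  weak φ := by simp

lemma smul (c : ℂ) (hu : IsWeakSolution σa la ω R u g) : IsWeakSolution σa la ω R (c • u) (c • g) where
  continuousOn := hu.continuousOn.const_smul c
  boundary x hx := by simp [hu.boundary x hx]
  memLp j ε hε := (hu.memLp j ε hε).const_smul c
  weakGradient j φ := by
    have := hu.weakGradient j φ
    simp only [Pi.smul_apply, smul_eq_mul, mul_assoc, integral_const_mul]
    rw [this, mul_neg]
  weak φ := by
    have := hu.weak φ
    have e1 : ∀ x, ∑ j, ∑ k, (sigmaR σa R x j k : ℂ) * (c • g) j x * (fderiv ℝ φ x (dir k) : ℂ)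
        = c * ∑ j, ∑ k, (sigmaR σa R x j k : ℂ) * g j x * (fderiv ℝ φ x (dir k) : ℂ) := by
      intro x
      simp only [Finset.mul_sum, Pi.smul_apply, smul_eq_mul]
      exact Finset.sum_congr rfl fun j _ => Finset.sum_congr rfl fun k _ => by ring
    have e2 : ∀ x, (ω : ℂ) ^ 2 * ((lambdaR la R x)⁻¹ : ℝ) * (c • u) x * (φ x : ℂ)
        = c * ((ω : ℂ) ^ 2 * ((lambdaR la R x)⁻¹ : ℝ) * u x * (φ x : ℂ)) := by
      intro x
      rw [Pi.smul_apply, smul_eq_mul]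
      ring
    simp only [e1, e2, integral_const_mul, this]

lemma add (hσa : 0 < σa) (hla : 0 < la) (hR : 1 < R) (hu : IsWeakSolution σa la ω R u g)
    (hv : IsWeakSolution σa la ω R v h) : IsWeakSolution σa la ω R (u + v) (g + h) where
  continuousOn := hu.continuousOn.add hv.continuousOn
  boundary x hx := by simp [hu.boundary x hx, hv.boundary x hx]
  memLp j ε hε := (hu.memLp j ε hε).add (hv.memLp j ε hε)
  weakGradient j φ := by
    obtain ⟨a₀, ha0, hφ⟩ := exists_isAnnularTest φ
    have i1 := integrable_mul_fderiv (fun ε => hu.integrableOn_annulus) hφ ha0 (dir j)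
    have i2 := integrable_mul_fderiv (fun ε => hv.integrableOn_annulus) hφ ha0 (dir j)
    have i3 := integrable_mul_test (fun ε => hu.integrableOn_gradient j) hφ ha0
    have i4 := integrable_mul_test (fun ε => hv.integrableOn_gradient j) hφ ha0
    simp only [Pi.add_apply, add_mul]
    rw [integral_add i1 i2, integral_add i3 i4, hu.weakGradient j φ, hv.weakGradient j φ]
    ring
  weak φ := by
    obtain ⟨a₀, ha0, hφ⟩ := exists_isAnnularTest φ
    have e1 : ∀ x, ∑ j, ∑ k, (sigmaR σa R x j k : ℂ) * (g + h) j x * (fderiv ℝ φ x (dir k) : ℂ)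
        = (∑ j, ∑ k, (sigmaR σa R x j k : ℂ) * g j x * (fderiv ℝ φ x (dir k) : ℂ))
          + ∑ j, ∑ k, (sigmaR σa R x j k : ℂ) * h j x * (fderiv ℝ φ x (dir k) : ℂ) := by
      intro x
      simp only [← Finset.sum_add_distrib, Pi.add_apply]
      exact Finset.sum_congr rfl fun j _ => Finset.sum_congr rfl fun k _ => by ring
    have e2 : ∀ x, (ω : ℂ) ^ 2 * ((lambdaR la R x)⁻¹ : ℝ) * (u + v) x * (φ x : ℂ)
        = (ω : ℂ) ^ 2 * ((lambdaR la R x)⁻¹ : ℝ) * u x * (φ x : ℂ)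
          + (ω : ℂ) ^ 2 * ((lambdaR la R x)⁻¹ : ℝ) * v x * (φ x : ℂ) := by
      intro x
      rw [Pi.add_apply]
      ring
    simp only [e1, e2]
    rw [integral_add (hu.integrable_flux hσa hR hφ ha0) (hv.integrable_flux hσa hR hφ ha0),
      integral_add (hu.integrable_mass hla hR hφ ha0) (hv.integrable_mass hla hR hφ ha0),
      hu.weak φ, hv.weak φ]

lemma finset_sum (hσa : 0 < σa) (hla : 0 < la) (hR : 1 < R) {ι : Type*} (s : Finset ι)
    {u : ι → ℂ → ℂ} {g : ι → Fin 2 → ℂ → ℂ}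
    (hu : ∀ i ∈ s, IsWeakSolution σa la ω R (u i) (g i)) :
    IsWeakSolution σa la ω R (∑ i ∈ s, u i) (∑ i ∈ s, g i) := by
  classical
  induction s using Finset.induction_on with
  | empty => simpa using zero
  | insert i s hi ih =>
    rw [Finset.sum_insert hi, Finset.sum_insert hi]
    exact (hu i (by simp)).add hσa hla hR (ih fun j hj => hu j (by simp [hj]))

end IsWeakSolution

/-! ### Existence of the solution in the truncated cloak -/

lemma AgreesOffOrigin.congr {Ω : Opens ℂ} {T : 𝓓'(Ω, ℂ)} {u v : ℂ → ℂ} (h : AgreesOffOrigin T u)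
    (huv : EqOn u v (Ω \ {0})) : AgreesOffOrigin T v := by
  intro φ h0
  rw [h φ h0]
  refine integral_congr_ae (ae_of_all _ fun x => ?_)
  by_cases hx : x ∈ tsupport φ
  · simp only [huv ⟨φ.tsupport_subset hx, fun hx0 => h0 (mem_singleton_iff.1 hx0 ▸ hx)⟩]
  · simp [image_eq_zero_of_notMem_tsupport hx]

/-- The field of a point source, with regular modes of amplitudes `A n` superposed. -/
def totalField (k : ℝ) (b : ℤ →₀ ℂ) (A : ℤ → ℂ) (z : ℂ) : ℂ :=
  b.sum fun n c => c * (A n * modeFun n (regularAmp k n) z + modeFun n (singularAmp k n) z)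

lemma sum_smul_dist_apply {Ω : Opens ℂ} {ι : Type*} (s : Finset ι) (c : ι → ℂ)
    (T : ι → 𝓓'(Ω, ℂ)) (φ : 𝓓(Ω, ℝ)) : (∑ i ∈ s, c i • T i) φ = ∑ i ∈ s, c i * T i φ := by
  classical
  induction s using Finset.induction_on with
  | empty => rfl
  | insert i s hi ih =>
    rw [Finset.sum_insert hi, Finset.sum_insert hi, ← ih]
    rfl

lemma exists_totalField_dist {k : ℝ} (hk : 0 < k) {ρ : ℝ} (hρ : ρ ≤ 3) (N : ℕ) (q : ℕ × ℕ → ℂ)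
    (A : ℤ → ℂ) :
    ∃ T : 𝓓'(disc ρ, ℂ), AgreesOffOrigin T (totalField k (sourceField k N q) A) ∧
      helmholtz k T = ∑ α ∈ (Finset.range (N + 1) ×ˢ Finset.range (N + 1)).filter
        (fun α => α.1 + α.2 ≤ N), q α • derivDelta (disc ρ) α := by
  obtain ⟨T, h1, h2⟩ := exists_source_dist hk hρ N q
  set b := sourceField k N q
  refine ⟨T + ∑ n ∈ b.support, (b n * A n) • funDist (disc ρ) (modeFun n (regularAmp k n)),
    fun φ h0 => ?_, ?_⟩
  · obtain ⟨a₀, ha0, hφ⟩ := isAnnularTest_of_agrees hρ φ h0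
    have hφ0 := isAnnularTest_of_disc hρ φ
    obtain ⟨C, hC⟩ := hφ0.exists_bound
    have hi : ∀ n, Integrable fun z => (φ z : ℂ) * modeFun n (regularAmp k n) z := fun n =>
      (integrable_modeFun_mul n le_rfl (by norm_num)
        ((isAmplitude_regularAmp hk n).intervalIntegrable_mul (by norm_num))
        (h := fun z => (φ z : ℂ))
        (Complex.measurable_ofReal.comp hφ0.contDiff.continuous.measurable) (C := C)
        (fun z => by rw [Complex.norm_real]; exact hC z)
        (fun z hz => by simp [hφ0.eq_zero hz])).congr (ae_of_all _ fun z => mul_comm _ _)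
    have e : T φ + ∑ n ∈ b.support, b n * A n * funDist (disc ρ) (modeFun n (regularAmp k n)) φ
        = ∫ z, ((φ z : ℂ) * singularField k b z
          + ∑ n ∈ b.support, b n * A n * ((φ z : ℂ) * modeFun n (regularAmp k n) z)) := by
      rw [integral_add (integrable_singularField_mul hk b ha0 hφ)
        (integrable_finsetSum _ fun n _ => (hi n).const_mul _), h1 φ h0,
        integral_finsetSum _ fun n _ => (hi n).const_mul _]
      congr 1
      refine Finset.sum_congr rfl fun n _ => ?_
      rw [integral_const_mul, agreesOffOrigin_modeFun hρ n (isAmplitude_regularAmp hk n) φ h0]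
    rw [← sum_smul_dist_apply] at e
    refine Eq.trans e ?_
    refine integral_congr_ae (ae_of_all _ fun z => ?_)
    simp only [totalField, singularField, Finsupp.sum, Finset.mul_sum, ← Finset.sum_add_distrib]
    exact Finset.sum_congr rfl fun n _ => by ring
  · rw [helmholtz_add, h2, helmholtz_sum]
    have hz : ∀ n, helmholtz k ((b n * A n) • funDist (disc ρ) (modeFun n (regularAmp k n))) = 0 := by
      intro n
      rw [helmholtz_smul, helmholtz_regularAmp hk hρ]
      ext φ
      exact mul_zero (b n * A n)
    simp only [hz, Finset.sum_const_zero, add_zero]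

/-- The solution in the truncated cloak. -/
def cloakField (σa la ω R : ℝ) (b : ℤ →₀ ℂ) : ℂ → ℂ :=
  ∑ n ∈ b.support, b n • modeFun n (fun r => (radiatedV σa la ω R n.natAbs r : ℂ))

lemma cloakField_inner {σa la ω R : ℝ} (b : ℤ →₀ ℂ) {z : ℂ} (hz : ‖z‖ ≤ R) :
    cloakField σa la ω R b z
      = totalField (kappa σa la * ω) b (fun n => innerAmp σa la ω R n.natAbs) z := by
  simp only [cloakField, totalField, Finsupp.sum, Finset.sum_apply, Pi.smul_apply, smul_eq_mul,
    modeFun, radiatedV, if_pos hz, regularAmp, singularAmp]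
  refine Finset.sum_congr rfl fun n _ => ?_
  push_cast
  ring

lemma cloakField_outer {σa la ω R : ℝ} (b : ℤ →₀ ℂ) {z : ℂ} (hz : R < ‖z‖) :
    cloakField σa la ω R b z = ∑ n ∈ b.support, b n * ((outerAmp σa la ω R n.natAbs : ℂ)
      * modeFun n (fun r => (outerF ω n.natAbs (flatRadius r) : ℂ)) z) := by
  simp only [cloakField, Finset.sum_apply, Pi.smul_apply, smul_eq_mul, modeFun, radiatedV,
    if_neg (not_le.2 hz)]
  refine Finset.sum_congr rfl fun n _ => ?_
  push_cast
  ring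

lemma isCloakSolution_cloakField {σa la ω R : ℝ} (hσa : 0 < σa) (hla : 0 < la) (hω : 0 < ω)
    (hR : 1 < R) (hR2 : R < 2) (hdet : ∀ n, modeDet σa la ω R n ≠ 0) (N : ℕ) (q : ℕ × ℕ → ℂ) :
    IsCloakSolution σa la ω R N q
      (cloakField σa la ω R (sourceField (kappa σa la * ω) N q)) := by
  have hk := mul_pos (kappa_pos hσa hla) hω
  have hw : ∀ n : ℤ, ∃ g, IsWeakSolution σa la ω R
      (modeFun n (fun r => (radiatedV σa la ω R n.natAbs r : ℂ))) g := fun n =>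
    ⟨_, isWeakSolution_mode hσa hla hR n
      (fun a ha _ => isModeOn_radiated hσa hla hω hR hR2 (hdet _) ha)
      (by rw [radiatedV_three hR2, Complex.ofReal_zero])⟩
  choose g hg using hw
  set b := sourceField (kappa σa la * ω) N q with hb
  have hsol := IsWeakSolution.finset_sum hσa hla hR b.support fun n _ => (hg n).smul (b n)
  obtain ⟨T, h1, h2⟩ := exists_totalField_dist hk (by linarith : R ≤ 3) N q
    (fun n => innerAmp σa la ω R n.natAbs)
  refine ⟨hsol.continuousOn, hsol.boundary, ⟨_, hsol.memLp, hsol.weakGradient, hsol.weak⟩, T,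
    h1.congr fun z hz => ?_, ?_⟩
  · exact (cloakField_inner b (mem_ball_zero_iff.1 hz.1).le).symm
  · have hκ := kappa_sq hσa hla
    have e : (la * σa) • laplace T + ω ^ 2 • T = (la * σa) • helmholtz (kappa σa la * ω) T := by
      rw [helmholtz, smul_add, smul_smul, mul_pow, hκ]
      congr 2
      field_simp
    rw [e, h2, pointSource, hκ, inv_inv, mul_comm la]

/-! ### Weak derivatives on an interval -/

/-- A smooth test function on the interval `(0, 3)`. -/
structure IsRadialTest (ψ : ℝ → ℝ) : Prop where
  contDiff : ContDiff ℝ ((⊤ : ℕ∞) : WithTop ℕ∞) ψ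
  hasCompactSupport : HasCompactSupport ψ
  tsupport_subset : tsupport ψ ⊆ Ioo 0 3

namespace IsRadialTest

variable {ψ : ℝ → ℝ}

lemma hasDerivAt (h : IsRadialTest ψ) (r : ℝ) : HasDerivAt ψ (deriv ψ r) r :=
  (h.contDiff.differentiable (by simp) r).hasDerivAt

lemma derivTest (h : IsRadialTest ψ) : IsRadialTest (deriv ψ) where
  contDiff := (contDiff_infty_iff_deriv.1 h.contDiff).2
  hasCompactSupport := h.hasCompactSupport.deriv
  tsupport_subset := tsupport_deriv_subset.trans h.tsupport_subset

lemma eq_zero (h : IsRadialTest ψ) {r : ℝ} (hr : r ∉ Ioo 0 3) : ψ r = 0 :=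
  image_eq_zero_of_notMem_tsupport fun hm => hr (h.tsupport_subset hm)

lemma exists_Icc (h : IsRadialTest ψ) :
    ∃ a b, 0 < a ∧ a ≤ b ∧ b < 3 ∧ tsupport ψ ⊆ Icc a b := by
  rcases (tsupport ψ).eq_empty_or_nonempty with he | hne
  · exact ⟨1, 2, by norm_num, by norm_num, by norm_num, by simp [he]⟩
  · obtain ⟨a, ha, ha'⟩ := IsCompact.exists_isLeast h.hasCompactSupport hne
    obtain ⟨b, hb, hb'⟩ := IsCompact.exists_isGreatest h.hasCompactSupport hne
    exact ⟨a, b, (h.tsupport_subset ha).1, ha' hb, (h.tsupport_subset hb).2,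
      fun x hx => ⟨ha' hx, hb' hx⟩⟩

lemma integral_eq (h : IsRadialTest ψ) (P : ℝ → ℂ) :
    ∫ r in (0 : ℝ)..3, P r * (ψ r : ℂ) = ∫ r, P r * (ψ r : ℂ) := by
  refine intervalIntegral.integral_eq_integral_of_support_subset fun r hr => ?_
  by_contra hcon
  refine hr ?_
  simp only [h.eq_zero (fun hm => hcon (Ioo_subset_Ioc_self hm)), Complex.ofReal_zero, mul_zero]

lemma integrable_mul (h : IsRadialTest ψ) {P : ℝ → ℂ} (hP : LocallyIntegrableOn P (Ioo 0 3)) :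
    Integrable fun r => P r * (ψ r : ℂ) := by
  have h1 := hP.integrableOn_compact_subset h.tsupport_subset h.hasCompactSupport
  obtain ⟨C, hC⟩ := h.contDiff.continuous.bounded_above_of_compact_support h.hasCompactSupport
  have h2 : IntegrableOn (fun r => P r * (ψ r : ℂ)) (tsupport ψ) :=
    Integrable.mul_bdd (c := C) h1
      (Complex.continuous_ofReal.comp h.contDiff.continuous).aestronglyMeasurable
      (ae_of_all _ fun r => by rw [Complex.norm_real]; exact hC r)
  refine (integrableOn_iff_integrable_of_support_subset fun r hr => ?_).1 h2
  refine subset_tsupport ψ fun h0 => hr ?_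
  simp only [h0, Complex.ofReal_zero, mul_zero]

end IsRadialTest

/-- Integration by parts against a test function, for a primitive `H` of `Q`. -/
lemma IsRadialTest.integral_mul_deriv {ψ : ℝ → ℝ} (h : IsRadialTest ψ) {H Q : ℝ → ℂ} {S : Set ℝ}
    (hS : S.Countable) (hH : ContinuousOn H (Ioo 0 3))
    (hd : ∀ r ∈ Ioo (0 : ℝ) 3, r ∉ S → HasDerivAt H (Q r) r)
    (hQ : LocallyIntegrableOn Q (Ioo 0 3)) :
    ∫ r in (0 : ℝ)..3, H r * ((deriv ψ r : ℝ) : ℂ) = -∫ r in (0 : ℝ)..3, Q r * (ψ r : ℂ) := by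
  have i1 := h.derivTest.integrable_mul (hH.locallyIntegrableOn measurableSet_Ioo)
  have i2 := h.integrable_mul hQ
  have cont : ContinuousOn (fun r => H r * (ψ r : ℂ)) (Icc 0 3) := by
    intro r hr
    by_cases hm : r ∈ tsupport ψ
    · have hr' := h.tsupport_subset hm
      exact (((hH r hr').continuousAt (isOpen_Ioo.mem_nhds hr')).mul
        (Complex.continuous_ofReal.comp h.contDiff.continuous).continuousAt).continuousWithinAt
    · refine ContinuousAt.continuousWithinAt ?_
      refine (continuousAt_const (y := (0 : ℂ))).congr ?_
      filter_upwards [(isClosed_tsupport ψ).isOpen_compl.mem_nhds hm] with s hs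
      rw [image_eq_zero_of_notMem_tsupport hs, Complex.ofReal_zero, mul_zero]
  have key := integral_eq_of_hasDerivAt_off_countable_of_le (fun r => H r * (ψ r : ℂ))
    (fun r => Q r * (ψ r : ℂ) + H r * ((deriv ψ r : ℝ) : ℂ)) (by norm_num : (0 : ℝ) ≤ 3) hS cont
    (fun r hr => (hd r hr.1 hr.2).mul (h.hasDerivAt r).ofReal_comp)
    (i2.add i1).intervalIntegrable
  rw [intervalIntegral.integral_add i2.intervalIntegrable i1.intervalIntegrable,
    h.eq_zero (r := 3) (by simp), h.eq_zero (r := 0) (by simp)] at key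
  simp only [Complex.ofReal_zero, mul_zero, sub_zero] at key
  linear_combination key

/-- A primitive of a test function of mean zero is a test function. -/
lemma IsRadialTest.exists_primitive {ψ : ℝ → ℝ} (h : IsRadialTest ψ) (h0 : ∫ r, ψ r = 0) :
    ∃ ζ : ℝ → ℝ, IsRadialTest ζ ∧ deriv ζ = ψ := by
  obtain ⟨a, b, ha, hab, hb, hsub⟩ := h.exists_Icc
  have hc := h.contDiff.continuous
  have hz : ∀ r, r ∉ Icc a b → ψ r = 0 := fun r hr =>
    image_eq_zero_of_notMem_tsupport fun hm => hr (hsub hm)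
  have hd : ∀ r, HasDerivAt (fun r => ∫ s in (0 : ℝ)..r, ψ s) (ψ r) r := fun r =>
    intervalIntegral.integral_hasDerivAt_right (hc.intervalIntegrable _ _)
      (hc.stronglyMeasurableAtFilter _ _) hc.continuousAt
  have hderiv : deriv (fun r => ∫ s in (0 : ℝ)..r, ψ s) = ψ := funext fun r => (hd r).deriv
  have hout : ∀ r, r ∉ Icc a b → ∫ s in (0 : ℝ)..r, ψ s = 0 := by
    intro r hr
    rcases lt_or_ge r a with hra | hra
    · rw [intervalIntegral.integral_congr_ae (g := fun _ => 0) (ae_of_all _ fun s hs => hz s fun hm => ?_)]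
      · simp
      · have := (uIoc_subset_uIcc hs).2
        have := this.trans_lt (max_lt ha hra)
        exact absurd hm.1 (not_le.2 this)
    · have hbr : b < r := by
        by_contra hcon
        exact hr ⟨hra, not_lt.1 hcon⟩
      rw [intervalIntegral.integral_eq_integral_of_support_subset, h0]
      intro s hs
      have hm : s ∈ Icc a b := by_contra fun hcon => hs (hz s hcon)
      exact ⟨ha.trans_le hm.1, hm.2.trans hbr.le⟩
  have hts : tsupport (fun r => ∫ s in (0 : ℝ)..r, ψ s) ⊆ Icc a b :=
    closure_minimal (fun r hr => by_contra fun hcon => hr (hout r hcon)) isClosed_Icc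
  refine ⟨fun r => ∫ s in (0 : ℝ)..r, ψ s, ⟨?_, ?_, hts.trans fun r hr => ⟨ha.trans_le hr.1, hr.2.trans_lt hb⟩⟩,
    hderiv⟩
  · rw [contDiff_infty_iff_deriv, hderiv]
    exact ⟨fun r => (hd r).differentiableAt, h.contDiff⟩
  · exact HasCompactSupport.of_support_subset_isCompact isCompact_Icc ((subset_tsupport _).trans hts)

lemma exists_isRadialTest_integral_one : ∃ ψ : ℝ → ℝ, IsRadialTest ψ ∧ ∫ r, ψ r = 1 := by
  let f : ContDiffBump (3 / 2 : ℝ) := ⟨1 / 2, 1, by norm_num, by norm_num⟩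
  refine ⟨f.normed volume, ⟨f.contDiff_normed, f.hasCompactSupport_normed, ?_⟩, f.integral_normed⟩
  rw [f.tsupport_normed_eq, Real.closedBall_eq_Icc]
  intro r hr
  have h1 : (3 / 2 : ℝ) - 1 ≤ r := hr.1
  have h2 : r ≤ (3 / 2 : ℝ) + 1 := hr.2
  exact ⟨by linarith, by linarith⟩

/-- A function with weak derivative zero is constant. -/
lemma exists_const_of_weakDeriv_zero {K : ℝ → ℂ} (hK : LocallyIntegrableOn K (Ioo 0 3))
    (h : ∀ ψ, IsRadialTest ψ → ∫ r in (0 : ℝ)..3, K r * ((deriv ψ r : ℝ) : ℂ) = 0) :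
    ∃ c : ℂ, ∀ᵐ r, r ∈ Ioo (0 : ℝ) 3 → K r = c := by
  obtain ⟨ψ₀, hψ₀, hone⟩ := exists_isRadialTest_integral_one
  have hint : ∀ {ψ}, IsRadialTest ψ → Integrable ψ := fun hψ =>
    hψ.contDiff.continuous.integrable_of_hasCompactSupport hψ.hasCompactSupport
  refine ⟨∫ r, K r * (ψ₀ r : ℂ), ?_⟩
  have hconst : LocallyIntegrableOn (fun _ : ℝ => ∫ r, K r * (ψ₀ r : ℂ)) (Ioo (0 : ℝ) 3) :=
    continuousOn_const.locallyIntegrableOn measurableSet_Ioo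
  have key := isOpen_Ioo.ae_eq_zero_of_integral_contDiff_smul_eq_zero
    (hK.sub hconst) (μ := volume) fun ψ h1 h2 h3 => ?_
  · filter_upwards [key] with r hr hmem
    exact sub_eq_zero.1 (hr hmem)
  have hψ : IsRadialTest ψ := ⟨h1, h2, h3⟩
  -- subtracting a multiple of `ψ₀` makes the mean zero, so that the difference is a derivative
  have hψ' : IsRadialTest (fun r => ψ r - (∫ s, ψ s) * ψ₀ r) := by
    refine ⟨h1.sub (contDiff_const.mul hψ₀.contDiff), h2.sub ?_, ?_⟩
    · exact hψ₀.hasCompactSupport.mul_left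
    · refine (tsupport_sub _ _).trans (union_subset h3 ?_)
      exact (tsupport_mul_subset_right).trans hψ₀.tsupport_subset
  obtain ⟨ζ, hζ, hζd⟩ := hψ'.exists_primitive (by
    rw [integral_sub (hint hψ) ((hint hψ₀).const_mul _), integral_const_mul, hone]; ring)
  have h0 := h ζ hζ
  rw [hζd, hψ'.integral_eq] at h0
  have e : ∀ r, K r * ((ψ r - (∫ s, ψ s) * ψ₀ r : ℝ) : ℂ)
      = K r * (ψ r : ℂ) - ((∫ s, ψ s : ℝ) : ℂ) * (K r * (ψ₀ r : ℂ)) := by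
    intro r; push_cast; ring
  simp only [e] at h0
  rw [integral_sub (hψ.integrable_mul hK) ((hψ₀.integrable_mul hK).const_mul _),
    integral_const_mul] at h0
  have e2 : ∀ r, ψ r • ((fun r => K r) - fun _ : ℝ => ∫ r, K r * (ψ₀ r : ℂ)) r
      = K r * (ψ r : ℂ) - (∫ r, K r * (ψ₀ r : ℂ)) * ((ψ r : ℝ) : ℂ) := by
    intro r; rw [Complex.real_smul, Pi.sub_apply]; ring
  refine (integral_congr_ae (ae_of_all _ e2)).trans ?_
  have hi : Integrable fun r => ((ψ r : ℝ) : ℂ) := (hint hψ).ofReal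
  have hI : ∫ r, ((ψ r : ℝ) : ℂ) = ((∫ r, ψ r : ℝ) : ℂ) := integral_ofReal
  rw [integral_sub (hψ.integrable_mul hK) (hi.const_mul _), integral_const_mul, hI]
  linear_combination h0

/-- A function with weak derivative `Q` is, up to a constant, a given primitive of `Q`. -/
lemma exists_const_of_weakDeriv {P H Q : ℝ → ℂ} {S : Set ℝ} (hP : LocallyIntegrableOn P (Ioo 0 3))
    (hS : S.Countable) (hH : ContinuousOn H (Ioo 0 3))
    (hd : ∀ r ∈ Ioo (0 : ℝ) 3, r ∉ S → HasDerivAt H (Q r) r)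
    (hQ : LocallyIntegrableOn Q (Ioo 0 3))
    (h : ∀ ψ, IsRadialTest ψ →
      ∫ r in (0 : ℝ)..3, P r * ((deriv ψ r : ℝ) : ℂ) = -∫ r in (0 : ℝ)..3, Q r * (ψ r : ℂ)) :
    ∃ c : ℂ, ∀ᵐ r, r ∈ Ioo (0 : ℝ) 3 → P r = H r + c := by
  have hH' := hH.locallyIntegrableOn (μ := volume) measurableSet_Ioo
  obtain ⟨c, hc⟩ := exists_const_of_weakDeriv_zero (hP.sub hH') fun ψ hψ => by
    simp only [Pi.sub_apply, sub_mul]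
    rw [intervalIntegral.integral_sub (hψ.derivTest.integrable_mul hP).intervalIntegrable
      (hψ.derivTest.integrable_mul hH').intervalIntegrable, h ψ hψ,
      hψ.integral_mul_deriv hS hH hd hQ, sub_self]
  refine ⟨c, ?_⟩
  filter_upwards [hc] with r hr hmem
  rw [← hr hmem, Pi.sub_apply]
  ring

/-! ### Separated test functions -/

/-- The real harmonic `Re (c e^{inθ})`, as a function on the plane. -/
def angFun (n : ℕ) (c z : ℂ) : ℝ := (c * unitDir z ^ n).re

/-- The integral of `f` over the circle of radius `r`, with respect to the angle. -/
def ringMean (f : ℂ → ℂ) (r : ℝ) : ℂ := ∫ θ in (-Real.pi)..Real.pi, f (pt r θ)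

lemma angFun_pt {r : ℝ} (hr : 0 < r) (n : ℕ) (c : ℂ) (θ : ℝ) :
    angFun n c (pt r θ) = (c * circ θ ^ n).re := by
  rw [angFun, unitDir_pt hr]

lemma measurable_angFun (n : ℕ) (c : ℂ) : Measurable (angFun n c) :=
  Complex.measurable_re.comp ((measurable_unitDir.pow_const n).const_mul c)

lemma abs_angFun_le (n : ℕ) (c z : ℂ) : |angFun n c z| ≤ ‖c‖ := by
  refine (Complex.abs_re_le_norm _).trans ?_
  rw [norm_mul, norm_pow]
  exact mul_le_of_le_one_right (norm_nonneg _) (pow_le_one₀ (norm_nonneg _) (norm_unitDir_le z))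

lemma hasDerivAt_angular (n : ℕ) (c : ℂ) (θ : ℝ) :
    HasDerivAt (fun θ => (c * circ θ ^ n).re) (n * Complex.I * c * circ θ ^ n).re θ := by
  have h : HasDerivAt (fun θ => c * circ θ ^ n) (n * Complex.I * c * circ θ ^ n) θ := by
    refine (((hasDerivAt_circ θ).pow n).const_mul c).congr_deriv ?_
    rcases n with _ | n
    · simp
    · rw [Nat.add_sub_cancel, pow_succ]
      ring
  exact (Complex.reCLM.hasFDerivAt.comp_hasDerivAt θ h)

lemma contDiffOn_unitDir : ContDiffOn ℝ ((⊤ : ℕ∞) : WithTop ℕ∞) unitDir {0}ᶜ := by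
  intro z hz
  have hz' : z ≠ 0 := hz
  refine ContDiffAt.contDiffWithinAt ?_
  have h1 : ContDiffAt ℝ ((⊤ : ℕ∞) : WithTop ℕ∞) (fun z : ℂ => ((‖z‖ : ℝ) : ℂ)) z :=
    Complex.ofRealCLM.contDiff.contDiffAt.comp z (contDiffAt_norm ℝ hz')
  have h2 : ((‖z‖ : ℝ) : ℂ) ≠ 0 := by exact_mod_cast (norm_pos_iff.2 hz').ne'
  exact contDiffAt_id.mul (h1.inv h2)

lemma contDiffOn_angFun (n : ℕ) (c : ℂ) :
    ContDiffOn ℝ ((⊤ : ℕ∞) : WithTop ℕ∞) (angFun n c) {0}ᶜ :=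
  Complex.reCLM.contDiff.comp_contDiffOn (contDiffOn_const.mul (contDiffOn_unitDir.pow n))

lemma IsRadialTest.contDiffOn_norm {ψ : ℝ → ℝ} (h : IsRadialTest ψ) :
    ContDiffOn ℝ ((⊤ : ℕ∞) : WithTop ℕ∞) (fun z : ℂ => ψ ‖z‖) {0}ᶜ := fun _ hz =>
  (h.contDiff.contDiffAt.comp _ (contDiffAt_norm ℝ hz)).contDiffWithinAt

lemma IsRadialTest.exists_testFunction {ψ : ℝ → ℝ} (h : IsRadialTest ψ) {f : ℂ → ℝ}
    (hf : ContDiffOn ℝ ((⊤ : ℕ∞) : WithTop ℕ∞) f {0}ᶜ) (h0 : ∀ z, ψ ‖z‖ = 0 → f z = 0) :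
    ∃ φ : 𝓓(puncturedDisc 3, ℝ), ⇑φ = f := by
  obtain ⟨a, b, ha, hab, hb, hsub⟩ := h.exists_Icc
  have hK : IsCompact {z : ℂ | a ≤ ‖z‖ ∧ ‖z‖ ≤ b} := by
    refine Metric.isCompact_of_isClosed_isBounded ?_ ?_
    · exact (isClosed_le continuous_const continuous_norm).inter
        (isClosed_le continuous_norm continuous_const)
    · exact (Metric.isBounded_closedBall (x := (0 : ℂ)) (r := b)).subset fun x hx =>
        mem_closedBall_zero_iff.2 hx.2
  have hz : ∀ z : ℂ, z ∉ {z : ℂ | a ≤ ‖z‖ ∧ ‖z‖ ≤ b} → f z = 0 := fun z hz =>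
    h0 z (image_eq_zero_of_notMem_tsupport fun hm => hz (hsub hm))
  have hts : tsupport f ⊆ {z : ℂ | a ≤ ‖z‖ ∧ ‖z‖ ≤ b} :=
    closure_minimal (fun z hz' => by_contra fun hcon => hz' (hz z hcon)) hK.isClosed
  refine ⟨⟨f, contDiff_iff_contDiffAt.2 fun z => ?_,
    HasCompactSupport.of_support_subset_isCompact hK ((subset_tsupport _).trans hts),
    hts.trans fun z hz => ?_⟩, rfl⟩
  · by_cases hz0 : z = 0
    · refine (contDiffAt_const (c := (0 : ℝ))).congr_of_eventuallyEq ?_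
      have : {w : ℂ | ‖w‖ < a} ∈ 𝓝 z :=
        (isOpen_lt continuous_norm continuous_const).mem_nhds (by simpa [hz0] using ha)
      filter_upwards [this] with w hw
      exact hz w fun hm => not_le.2 hw hm.1
    · exact hf.contDiffAt (isOpen_compl_singleton.mem_nhds hz0)
  · refine ⟨mem_ball_zero_iff.2 (hz.2.trans_lt hb), fun h0 => ?_⟩
    have := hz.1
    rw [mem_singleton_iff.1 h0, norm_zero] at this
    linarith

/-- The test function `ψ(|z|) Re (c e^{inθ})`. -/
lemma IsRadialTest.exists_separated {ψ : ℝ → ℝ} (h : IsRadialTest ψ) (n : ℕ) (c : ℂ) :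
    ∃ φ : 𝓓(puncturedDisc 3, ℝ), (∀ z, φ z = ψ ‖z‖ * angFun n c z) ∧
      ∀ z, z ≠ 0 → fderiv ℝ φ z (unitDir z) = deriv ψ ‖z‖ * angFun n c z ∧
        fderiv ℝ φ z (Complex.I * unitDir z) = ψ ‖z‖ / ‖z‖ * angFun n (n * Complex.I * c) z := by
  obtain ⟨φ, hφ⟩ := h.exists_testFunction (f := fun z => ψ ‖z‖ * angFun n c z)
    (h.contDiffOn_norm.mul (contDiffOn_angFun n c)) (fun z hz => by rw [hz, zero_mul])
  refine ⟨φ, fun z => congrFun hφ z, fun z hz => ?_⟩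
  have hr : 0 < ‖z‖ := norm_pos_iff.2 hz
  obtain ⟨θ, hθ⟩ := exists_pt z
  set r := ‖z‖ with hrdef
  have hval : ∀ s, 0 < s → ∀ t, φ (pt s t) = ψ s * (c * circ t ^ n).re := fun s hs t => by
    rw [hφ]
    simp only [norm_pt_of_pos hs, angFun_pt hs]
  have hd : HasFDerivAt φ (fderiv ℝ φ (pt r θ)) (pt r θ) :=
    (φ.contDiff.differentiable (by simp) _).hasFDerivAt
  have h1 := (hd.comp_hasDerivAt r (hasDerivAt_pt_left r θ)).unique
    ((((h.hasDerivAt r).mul_const ((c * circ θ ^ n).re))).congr_of_eventuallyEq (by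
      filter_upwards [lt_mem_nhds hr] with s hs
      exact hval s hs θ))
  have h2 := (hd.comp_hasDerivAt θ (hasDerivAt_pt_right r θ)).unique
    (((hasDerivAt_angular n c θ).const_mul (ψ r)).congr_of_eventuallyEq (by
      filter_upwards with t
      exact hval r hr t))
  have e3 : fderiv ℝ φ (pt r θ) (r * (Complex.I * circ θ))
      = r * fderiv ℝ φ (pt r θ) (Complex.I * circ θ) := by
    rw [show (r : ℂ) * (Complex.I * circ θ) = r • (Complex.I * circ θ) by
      rw [Complex.real_smul], map_smul, smul_eq_mul]
  rw [e3] at h2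
  rw [hθ, unitDir_pt hr, angFun_pt hr, angFun_pt hr]
  refine ⟨h1, ?_⟩
  rw [div_mul_eq_mul_div, eq_div_iff hr.ne']
  linear_combination h2

/-- The divergence of a vector field in polar coordinates. -/
lemma divergence_polar {X : ℂ → ℂ} {r θ : ℝ} (hr : 0 < r) (hX : DifferentiableAt ℝ X (pt r θ))
    {D₁ D₂ : ℂ} (h₁ : HasDerivAt (fun s => X (pt s θ)) D₁ r)
    (h₂ : HasDerivAt (fun t => X (pt r t)) D₂ θ) :
    (fderiv ℝ X (pt r θ) 1).re + (fderiv ℝ X (pt r θ) Complex.I).im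
      = ((starRingEnd ℂ) (circ θ) * D₁).re + ((starRingEnd ℂ) (Complex.I * circ θ) * D₂).re / r := by
  have e1 := (hX.hasFDerivAt.comp_hasDerivAt r (hasDerivAt_pt_left r θ)).unique h₁
  have e2 := (hX.hasFDerivAt.comp_hasDerivAt θ (hasDerivAt_pt_right r θ)).unique h₂
  have hL : ∀ v : ℂ, fderiv ℝ X (pt r θ) v = v.re * fderiv ℝ X (pt r θ) 1
      + v.im * fderiv ℝ X (pt r θ) Complex.I := by
    intro v
    conv_lhs => rw [show v = v.re • (1 : ℂ) + v.im • Complex.I by simp [Complex.re_add_im]]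
    rw [map_add, map_smul, map_smul, Complex.real_smul, Complex.real_smul]
  have hn : (circ θ).re * (circ θ).re + (circ θ).im * (circ θ).im = 1 := by
    rw [← Complex.normSq_apply, Complex.normSq_eq_norm_sq, norm_circ, one_pow]
  rw [← e1, ← e2, hL (circ θ), hL (r * (Complex.I * circ θ))]
  generalize fderiv ℝ X (pt r θ) 1 = A
  generalize fderiv ℝ X (pt r θ) Complex.I = B
  simp
  field_simp
  linear_combination (-(A.re + B.im)) * hn

lemma fderiv_coord {X : ℂ → ℂ} {z : ℂ} (hX : DifferentiableAt ℝ X z) :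
    fderiv ℝ (fun z => (X z).re) z 1 + fderiv ℝ (fun z => (X z).im) z Complex.I
      = (fderiv ℝ X z 1).re + (fderiv ℝ X z Complex.I).im := by
  have h1 : fderiv ℝ (fun z => (X z).re) z = Complex.reCLM.comp (fderiv ℝ X z) :=
    (Complex.reCLM.hasFDerivAt.comp z hX.hasFDerivAt).fderiv
  have h2 : fderiv ℝ (fun z => (X z).im) z = Complex.imCLM.comp (fderiv ℝ X z) :=
    (Complex.imCLM.hasFDerivAt.comp z hX.hasFDerivAt).fderiv
  rw [h1, h2]
  rfl

/-- The test vector field `d ψ(|z|) Re (c e^{inθ}) e_r / |z|`, for a complex constant `d`: radial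
for `d = 1` and tangential for `d = i`. -/
lemma IsRadialTest.exists_vectorField {ψ : ℝ → ℝ} (h : IsRadialTest ψ) (n : ℕ) (c d : ℂ) :
    ∃ φ : Fin 2 → 𝓓(puncturedDisc 3, ℝ),
      (∀ z, φ 0 z = ψ ‖z‖ / ‖z‖ * angFun n c z * (d * unitDir z).re) ∧
      (∀ z, φ 1 z = ψ ‖z‖ / ‖z‖ * angFun n c z * (d * unitDir z).im) ∧
      ∀ z, z ≠ 0 → ∑ j, fderiv ℝ (φ j) z (dir j) = d.re * (deriv ψ ‖z‖ / ‖z‖ * angFun n c z)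
        + d.im * (ψ ‖z‖ / ‖z‖ ^ 2 * angFun n (n * Complex.I * c) z) := by
  set X : ℂ → ℂ := fun z => ((ψ ‖z‖ / ‖z‖ * angFun n c z : ℝ) : ℂ) * (d * unitDir z) with hXdef
  have hX : ContDiffOn ℝ ((⊤ : ℕ∞) : WithTop ℕ∞) X {0}ᶜ := by
    have hnorm : ContDiffOn ℝ ((⊤ : ℕ∞) : WithTop ℕ∞) (fun z : ℂ => ‖z‖) {0}ᶜ := fun z hz =>
      (contDiffAt_norm ℝ hz).contDiffWithinAt
    have h1 := (h.contDiffOn_norm.div hnorm fun z hz => (norm_pos_iff.2 hz).ne').mul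
      (contDiffOn_angFun n c)
    exact (Complex.ofRealCLM.contDiff.comp_contDiffOn h1).mul (contDiffOn_const.mul contDiffOn_unitDir)
  have h0 : ∀ z, ψ ‖z‖ = 0 → X z = 0 := fun z hz => by simp [hXdef, hz]
  obtain ⟨φ₀, hφ₀⟩ := h.exists_testFunction (f := fun z => (X z).re)
    (Complex.reCLM.contDiff.comp_contDiffOn hX) (fun z hz => by rw [h0 z hz, Complex.zero_re])
  obtain ⟨φ₁, hφ₁⟩ := h.exists_testFunction (f := fun z => (X z).im)
    (Complex.imCLM.contDiff.comp_contDiffOn hX) (fun z hz => by rw [h0 z hz, Complex.zero_im])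
  refine ⟨![φ₀, φ₁], fun z => ?_, fun z => ?_, fun z hz => ?_⟩
  · exact (congrFun hφ₀ z).trans (Complex.re_ofReal_mul _ _)
  · exact (congrFun hφ₁ z).trans (Complex.im_ofReal_mul _ _)
  have hr : 0 < ‖z‖ := norm_pos_iff.2 hz
  have hXz : DifferentiableAt ℝ X z :=
    (hX.contDiffAt (isOpen_compl_singleton.mem_nhds hz)).differentiableAt (by simp)
  obtain ⟨θ, hθ⟩ := exists_pt z
  have e : ∑ j, fderiv ℝ ((![φ₀, φ₁] : Fin 2 → 𝓓(puncturedDisc 3, ℝ)) j) z (dir j)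
      = (fderiv ℝ X z 1).re + (fderiv ℝ X z Complex.I).im := by
    rw [← fderiv_coord hXz, Fin.sum_univ_two, ← hφ₀, ← hφ₁]
    rfl
  rw [e]
  set r := ‖z‖ with hrdef
  rw [hθ] at hXz ⊢
  have hval : ∀ s, 0 < s → ∀ t, X (pt s t)
      = (((ψ s / s : ℝ) : ℂ) * ((c * circ t ^ n).re : ℂ)) * (d * circ t) := fun s hs t => by
    simp only [hXdef, norm_pt_of_pos hs, angFun_pt hs, unitDir_pt hs]
    push_cast
    ring
  have hψ : HasDerivAt (fun s => ((ψ s / s : ℝ) : ℂ))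
      (((deriv ψ r * r - ψ r * 1) / r ^ 2 : ℝ) : ℂ) r :=
    ((h.hasDerivAt r).div (hasDerivAt_id r) hr.ne').ofReal_comp
  have h1 : HasDerivAt (fun s => X (pt s θ)) _ r :=
    ((hψ.mul_const ((c * circ θ ^ n).re : ℂ)).mul_const (d * circ θ)).congr_of_eventuallyEq (by
      filter_upwards [lt_mem_nhds hr] with s hs
      exact hval s hs θ)
  have h2 : HasDerivAt (fun t => X (pt r t)) _ θ :=
    (((hasDerivAt_angular n c θ).ofReal_comp.const_mul ((ψ r / r : ℝ) : ℂ)).mul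
      ((hasDerivAt_circ θ).const_mul d)).congr_of_eventuallyEq (by
      filter_upwards with t
      exact hval r hr t)
  rw [divergence_polar hr hXz h1 h2, angFun_pt hr, angFun_pt hr]
  have hn : (circ θ).re * (circ θ).re + (circ θ).im * (circ θ).im = 1 := by
    rw [← Complex.normSq_apply, Complex.normSq_eq_norm_sq, norm_circ, one_pow]
  generalize (n * Complex.I * c * circ θ ^ n).re = a'
  generalize (c * circ θ ^ n).re = a
  simp only [Complex.mul_re, Complex.mul_im, Complex.ofReal_re, Complex.ofReal_im, Complex.conj_re,
    Complex.conj_im, Complex.add_re, Complex.add_im, Complex.I_re, Complex.I_im]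
  field_simp
  have hn2 : (circ θ).re ^ 2 + (circ θ).im ^ 2 = 1 := by rw [sq, sq]; exact hn
  linear_combination (d.re * deriv ψ r * a * r + d.im * ψ r * a') * hn2

/-! ### Angular means -/

section mean

variable {f : ℂ → ℂ}

lemma integrableOn_ringMean {ε : ℝ} (hε : 0 < ε)
    (hf : IntegrableOn f {x : ℂ | ε < ‖x‖ ∧ ‖x‖ < 3}) : IntegrableOn (ringMean f) (Ioo ε 3) := by
  have hmeas : MeasurableSet {x : ℂ | ε < ‖x‖ ∧ ‖x‖ < 3} :=
    (measurableSet_lt measurable_const measurable_norm).inter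
      (measurableSet_lt measurable_norm measurable_const)
  have h3 := integrableOn_polar (hf.integrable_indicator hmeas)
  rw [Measure.volume_eq_prod, IntegrableOn, ← Measure.prod_restrict] at h3
  have h4 : IntegrableOn (fun r : ℝ => ∫ θ in Ioo (-Real.pi) Real.pi,
      (r : ℂ) * {x : ℂ | ε < ‖x‖ ∧ ‖x‖ < 3}.indicator f (pt r θ)) (Ioo ε 3) :=
    IntegrableOn.mono_set h3.integral_prod_left fun r hr => hε.trans hr.1
  have h5 : IntegrableOn (fun r : ℝ => (r : ℂ) * ringMean f r) (Ioo ε 3) := by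
    refine h4.congr_fun (fun r hr => ?_) measurableSet_Ioo
    have hr0 := hε.trans hr.1
    rw [ringMean, intervalIntegral.integral_of_le (by linarith [Real.pi_pos]),
      integral_Ioc_eq_integral_Ioo, ← integral_const_mul]
    refine integral_congr_ae (ae_of_all _ fun θ => ?_)
    simp only
    rw [indicator_of_mem]
    simp only [mem_ofPred_eq, norm_pt_of_pos hr0]
    exact hr
  have h6 : IntegrableOn (fun r : ℝ => ((r : ℂ) * ringMean f r) * ((r⁻¹ : ℝ) : ℂ)) (Ioo ε 3) := by
    refine Integrable.mul_bdd (c := ε⁻¹) h5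
      (Complex.measurable_ofReal.comp measurable_inv).aestronglyMeasurable ?_
    refine (ae_restrict_iff' measurableSet_Ioo).2 (ae_of_all _ fun r hr => ?_)
    have hr0 := hε.trans hr.1
    rw [Complex.norm_real, Real.norm_of_nonneg (by positivity)]
    exact inv_anti₀ hε hr.1.le
  refine h6.congr_fun (fun r hr => ?_) measurableSet_Ioo
  have : (r : ℂ) ≠ 0 := by exact_mod_cast (hε.trans hr.1).ne'
  simp only
  push_cast
  field_simp

lemma locallyIntegrableOn_ringMean
    (hf : ∀ ε : ℝ, 0 < ε → IntegrableOn f {x : ℂ | ε < ‖x‖ ∧ ‖x‖ < 3}) :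
    LocallyIntegrableOn (ringMean f) (Ioo 0 3) := by
  intro r hr
  refine ⟨Ioo (r / 2) 3, mem_nhdsWithin_of_mem_nhds (isOpen_Ioo.mem_nhds ⟨by linarith [hr.1], hr.2⟩),
    integrableOn_ringMean (by linarith [hr.1]) (hf _ (by linarith [hr.1]))⟩

/-- Integrals of `f` against a radial function reduce to the angular mean of `f`. -/
lemma integral_radial_weight
    (hf : ∀ ε : ℝ, 0 < ε → IntegrableOn f {x : ℂ | ε < ‖x‖ ∧ ‖x‖ < 3}) {ψ c : ℝ → ℝ}
    (hψ : IsRadialTest ψ) (hc : Measurable c)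
    (hb : ∀ a : ℝ, 0 < a → ∃ C, ∀ r, a ≤ r → |c r| ≤ C) :
    Integrable (fun z => f z * ((c ‖z‖ * ψ ‖z‖ : ℝ) : ℂ)) ∧
    ∫ z, f z * ((c ‖z‖ * ψ ‖z‖ : ℝ) : ℂ)
      = ∫ r in (0 : ℝ)..3, ((r : ℂ) * c r * ringMean f r) * (ψ r : ℂ) := by
  obtain ⟨a, b, ha, hab, hb3, hsub⟩ := hψ.exists_Icc
  obtain ⟨C, hC⟩ := hb a ha
  have hC0 : 0 ≤ C := (abs_nonneg _).trans (hC a le_rfl)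
  obtain ⟨D, hD⟩ := hψ.contDiff.continuous.bounded_above_of_compact_support hψ.hasCompactSupport
  have hz : ∀ r, r ∉ Icc a b → ψ r = 0 := fun r hr =>
    image_eq_zero_of_notMem_tsupport fun hm => hr (hsub hm)
  have hi : Integrable (fun z => f z * ((c ‖z‖ * ψ ‖z‖ : ℝ) : ℂ)) := by
    refine integrable_mul_of_annulus (hf (a / 2) (by positivity)) (C := C * D)
      (Complex.measurable_ofReal.comp ((hc.comp measurable_norm).mul
        (hψ.contDiff.continuous.measurable.comp measurable_norm))) (fun z => ?_) (fun z hz' => ?_)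
    · rw [Complex.norm_real, norm_mul]
      have hD0 := (norm_nonneg _).trans (hD 0)
      by_cases hm : ‖z‖ ∈ Icc a b
      · gcongr
        · exact hC _ hm.1
        · exact hD _
      · rw [hz _ hm, norm_zero, mul_zero]; positivity
    · rw [hz, mul_zero, Complex.ofReal_zero]
      rintro ⟨h1, h2⟩
      rcases hz' with h | h <;> linarith
  refine ⟨hi, ?_⟩
  rw [integral_polar hi le_rfl (by norm_num)]
  · refine intervalIntegral.integral_congr_ae (ae_of_all _ fun r hr => ?_)
    rw [uIoc_of_le (by norm_num)] at hr
    simp only [norm_pt_of_pos hr.1, ringMean]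
    rw [intervalIntegral.integral_mul_const]
    push_cast
    ring
  · intro z hz'
    rw [hψ.eq_zero, mul_zero, Complex.ofReal_zero, mul_zero]
    rintro ⟨h1, h2⟩
    rcases hz' with h | h <;> linarith

lemma integrableOn_mul_angFun {ε : ℝ} (hf : IntegrableOn f {x : ℂ | ε < ‖x‖ ∧ ‖x‖ < 3}) (n : ℕ)
    (c : ℂ) : IntegrableOn (fun z => f z * (angFun n c z : ℂ)) {x : ℂ | ε < ‖x‖ ∧ ‖x‖ < 3} :=
  Integrable.mul_bdd (c := ‖c‖) hf
    (Complex.measurable_ofReal.comp (measurable_angFun n c)).aestronglyMeasurable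
    (ae_of_all _ fun z => by rw [Complex.norm_real]; exact abs_angFun_le n c z)

end mean

/-! ### The radial system of a weak solution -/

lemma continuousOn_ringMean {f : ℂ → ℂ} (hf : ContinuousOn f (Metric.closedBall 0 3 \ {0})) {a : ℝ}
    (ha : 0 < a) (ha3 : a ≤ 3) : ContinuousOn (ringMean f) (Icc a 3) := by
  have hc : Continuous fun p : ℝ × ℝ => f (pt (max a (min p.1 3)) p.2) := by
    refine hf.comp_continuous (continuous_pt.comp
      ((by fun_prop : Continuous fun p : ℝ × ℝ => (max a (min p.1 3), p.2)))) fun p => ?_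
    have hpos : 0 < max a (min p.1 3) := ha.trans_le (le_max_left _ _)
    have hn := norm_pt_of_pos hpos p.2
    refine ⟨mem_closedBall_zero_iff.2 ?_, fun h0 => ?_⟩
    · rw [hn]; exact max_le ha3 (min_le_right _ _)
    · rw [mem_singleton_iff.1 h0, norm_zero] at hn
      exact hpos.ne hn
  have h2 : Continuous fun r : ℝ => ringMean f (max a (min r 3)) :=
    intervalIntegral.continuous_parametric_intervalIntegral_of_continuous'
      (f := fun r θ => f (pt (max a (min r 3)) θ)) hc _ _
  refine h2.continuousOn.congr fun r hr => ?_
  simp only [min_eq_left hr.2, max_eq_right hr.1]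

lemma exists_primitive_off {Q : ℝ → ℂ} {S : Set ℝ}
    (hQ : ∀ a : ℝ, 0 < a → a ≤ 3 → IntervalIntegrable Q volume a 3)
    (hc : ∀ r ∈ Ioo (0 : ℝ) 3, r ∉ S → ContinuousAt Q r) :
    ∃ H : ℝ → ℂ, (∀ a : ℝ, 0 < a → a ≤ 3 → ContinuousOn H (Icc a 3)) ∧
      ∀ r ∈ Ioo (0 : ℝ) 3, r ∉ S → HasDerivAt H (Q r) r := by
  refine ⟨fun r => ∫ s in (1 : ℝ)..r, Q s, fun a ha ha3 => ?_, fun r hr hrS => ?_⟩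
  · have h := intervalIntegral.continuousOn_primitive_interval' (a := 1) (b₁ := min a 1) (b₂ := 3)
      (hQ (min a 1) (lt_min ha one_pos) ((min_le_left _ _).trans ha3))
      (by rw [uIcc_of_le ((min_le_left _ _).trans ha3)]; exact ⟨min_le_right _ _, by norm_num⟩)
    rw [uIcc_of_le ((min_le_left _ _).trans ha3)] at h
    exact h.mono (Icc_subset_Icc_left (min_le_left _ _))
  · have h1 := hQ (min (r / 2) 1) (lt_min (by linarith [hr.1]) one_pos)
      ((min_le_right _ _).trans (by norm_num))
    have hle : min (r / 2) 1 ≤ 3 := (min_le_right _ _).trans (by norm_num)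
    refine intervalIntegral.integral_hasDerivAt_right (h1.mono_set ?_) ?_ (hc r hr hrS)
    · rw [uIcc_of_le hle]
      refine uIcc_subset_Icc ⟨min_le_right _ _, by norm_num⟩ ⟨?_, hr.2.le⟩
      exact (min_le_left _ _).trans (by linarith [hr.1])
    · refine AEStronglyMeasurable.stronglyMeasurableAtFilter_of_mem h1.1.aestronglyMeasurable ?_
      have h2 : min (r / 2) 1 < r := (min_le_left _ _).trans_lt (by linarith [hr.1])
      exact mem_of_superset (Ioo_mem_nhds h2 hr.2) Ioo_subset_Ioc_self

lemma locallyIntegrableOn_of_intervalIntegrable {Q : ℝ → ℂ}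
    (hQ : ∀ a : ℝ, 0 < a → a ≤ 3 → IntervalIntegrable Q volume a 3) :
    LocallyIntegrableOn Q (Ioo 0 3) := by
  intro r hr
  refine ⟨Ioc (r / 2) 3, mem_nhdsWithin_of_mem_nhds (mem_of_superset
    (isOpen_Ioo.mem_nhds ⟨by linarith [hr.1], hr.2⟩) Ioo_subset_Ioc_self), ?_⟩
  exact (hQ (r / 2) (by linarith [hr.1]) (by linarith [hr.1, hr.2])).1

lemma continuousAt_medium {σa la R r : ℝ} (hR : 1 < R) (hr : 0 < r) (hr' : r ∉ ({R, 2} : Set ℝ)) :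
    ContinuousAt (massRad σa R) r ∧ ContinuousAt (massTan σa R) r ∧
      ContinuousAt (modulusRad la R) r := by
  simp only [mem_insert_iff, mem_singleton_iff, not_or] at hr'
  rcases lt_or_gt_of_ne hr'.1 with h | h
  · have hmem := Iio_mem_nhds h
    refine ⟨(continuousAt_const (y := σa)).congr ?_, (continuousAt_const (y := σa)).congr ?_,
      (continuousAt_const (y := la)).congr ?_⟩ <;> filter_upwards [hmem] with s hs
    · rw [massRad, if_pos (le_of_lt hs)]
    · rw [massTan, if_pos (le_of_lt hs)]
    · rw [modulusRad, if_pos (le_of_lt hs)]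
  have hmem := Ioi_mem_nhds h
  rcases lt_or_gt_of_ne hr'.2 with h2 | h2
  · have hmem2 := Iio_mem_nhds h2
    have hr1 : r - 1 ≠ 0 := by linarith
    have c : ContinuousAt (fun r : ℝ => r - 1) r := by fun_prop
    refine ⟨(c.div continuousAt_id hr.ne').congr ?_, (continuousAt_id.div c hr1).congr ?_,
      (continuousAt_id.div (c.const_mul 4) (mul_ne_zero (by norm_num) hr1)).congr ?_⟩ <;>
      filter_upwards [hmem, hmem2] with s hs hs2
    · rw [massRad, if_neg (not_le.2 hs), if_neg (not_lt.2 (le_of_lt hs2))]; rfl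
    · rw [massTan, if_neg (not_le.2 hs), if_neg (not_lt.2 (le_of_lt hs2))]; rfl
    · rw [modulusRad, if_neg (not_le.2 hs), if_neg (not_lt.2 (le_of_lt hs2))]; rfl
  · have hmem2 := Ioi_mem_nhds h2
    refine ⟨(continuousAt_const (y := (1 : ℝ))).congr ?_,
      (continuousAt_const (y := (1 : ℝ))).congr ?_,
      (continuousAt_const (y := (1 : ℝ))).congr ?_⟩ <;> filter_upwards [hmem, hmem2] with s hs hs2
    · rw [massRad, if_neg (not_le.2 hs), if_pos (mem_Ioi.1 hs2)]
    · rw [massTan, if_neg (not_le.2 hs), if_pos (mem_Ioi.1 hs2)]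
    · rw [modulusRad, if_neg (not_le.2 hs), if_pos (mem_Ioi.1 hs2)]

/-- The radial component of a vector field. -/
def radPart (g : Fin 2 → ℂ → ℂ) (z : ℂ) : ℂ := g 0 z * (unitDir z).re + g 1 z * (unitDir z).im

/-- The tangential component of a vector field. -/
def tanPart (g : Fin 2 → ℂ → ℂ) (z : ℂ) : ℂ := g 1 z * (unitDir z).re - g 0 z * (unitDir z).im

namespace IsWeakSolution

variable {σa la ω R : ℝ} {v : ℂ → ℂ} {g : Fin 2 → ℂ → ℂ} {ψ : ℝ → ℝ}

lemma integrableOn_mul_unitDir (hv : IsWeakSolution σa la ω R v g) {ε : ℝ} (hε : 0 < ε)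
    (j : Fin 2) : IntegrableOn (fun z => g j z * (unitDir z).re) {x : ℂ | ε < ‖x‖ ∧ ‖x‖ < 3} ∧
      IntegrableOn (fun z => g j z * (unitDir z).im) {x : ℂ | ε < ‖x‖ ∧ ‖x‖ < 3} :=
  ⟨Integrable.mul_bdd (c := 1) (hv.integrableOn_gradient j hε)
      (Complex.measurable_ofReal.comp
        (Complex.measurable_re.comp measurable_unitDir)).aestronglyMeasurable
      (ae_of_all _ fun z => (norm_ofReal_re_le _).trans (norm_unitDir_le z)),
    Integrable.mul_bdd (c := 1) (hv.integrableOn_gradient j hε)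
      (Complex.measurable_ofReal.comp
        (Complex.measurable_im.comp measurable_unitDir)).aestronglyMeasurable
      (ae_of_all _ fun z => (norm_ofReal_im_le _).trans (norm_unitDir_le z))⟩

lemma integrableOn_radPart (hv : IsWeakSolution σa la ω R v g) {ε : ℝ} (hε : 0 < ε) :
    IntegrableOn (radPart g) {x : ℂ | ε < ‖x‖ ∧ ‖x‖ < 3} :=
  (hv.integrableOn_mul_unitDir hε 0).1.add (hv.integrableOn_mul_unitDir hε 1).2

lemma integrableOn_tanPart (hv : IsWeakSolution σa la ω R v g) {ε : ℝ} (hε : 0 < ε) :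
    IntegrableOn (tanPart g) {x : ℂ | ε < ‖x‖ ∧ ‖x‖ < 3} :=
  (hv.integrableOn_mul_unitDir hε 1).1.sub (hv.integrableOn_mul_unitDir hε 0).2

lemma integral_divergence (hv : IsWeakSolution σa la ω R v g)
    (φ : Fin 2 → 𝓓(puncturedDisc 3, ℝ)) :
    ∫ z, v z * ((∑ j, fderiv ℝ (φ j) z (dir j) : ℝ) : ℂ)
      = -∫ z, (g 0 z * (φ 0 z : ℂ) + g 1 z * (φ 1 z : ℂ)) := by
  obtain ⟨a₀, ha0, hφ0⟩ := exists_isAnnularTest (φ 0)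
  obtain ⟨a₁, ha1, hφ1⟩ := exists_isAnnularTest (φ 1)
  have i0 := integrable_mul_fderiv (fun ε => hv.integrableOn_annulus) hφ0 ha0 (dir 0)
  have i1 := integrable_mul_fderiv (fun ε => hv.integrableOn_annulus) hφ1 ha1 (dir 1)
  have i2 := integrable_mul_test (fun ε => hv.integrableOn_gradient 0) hφ0 ha0
  have i3 := integrable_mul_test (fun ε => hv.integrableOn_gradient 1) hφ1 ha1
  simp only [Fin.sum_univ_two, Complex.ofReal_add, mul_add]
  rw [integral_add i0 i1, integral_add i2 i3, hv.weakGradient 0 (φ 0), hv.weakGradient 1 (φ 1)]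
  ring

lemma exists_inv_bound : ∀ a : ℝ, 0 < a → ∃ C, ∀ r, a ≤ r → |r⁻¹| ≤ C := fun a ha =>
  ⟨a⁻¹, fun r hr => by rw [abs_inv, abs_of_pos (ha.trans_le hr)]; exact inv_anti₀ ha hr⟩

lemma weak_radial (hv : IsWeakSolution σa la ω R v g) (hψ : IsRadialTest ψ) (n : ℕ) (c : ℂ) :
    ∫ r in (0 : ℝ)..3, ringMean (fun z => v z * (angFun n c z : ℂ)) r * ((deriv ψ r : ℝ) : ℂ)
      = -∫ r in (0 : ℝ)..3, ringMean (fun z => radPart g z * (angFun n c z : ℂ)) r * (ψ r : ℂ) := by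
  obtain ⟨φ, h0, h1, hdiv⟩ := hψ.exists_vectorField n c 1
  have key := hv.integral_divergence φ
  obtain ⟨-, k1⟩ := integral_radial_weight (fun ε hε =>
    integrableOn_mul_angFun (hv.integrableOn_annulus hε) n c) hψ.derivTest measurable_inv
    exists_inv_bound
  obtain ⟨-, k2⟩ := integral_radial_weight (fun ε hε =>
    integrableOn_mul_angFun (hv.integrableOn_radPart hε) n c) hψ measurable_inv exists_inv_bound
  have hne : ∀ᵐ z : ℂ, z ≠ 0 := by simp [ae_iff, measure_singleton]
  have e1 : ∫ z, v z * ((∑ j, fderiv ℝ (φ j) z (dir j) : ℝ) : ℂ)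
      = ∫ z, v z * (angFun n c z : ℂ) * ((‖z‖⁻¹ * deriv ψ ‖z‖ : ℝ) : ℂ) := by
    refine integral_congr_ae ?_
    filter_upwards [hne] with z hz
    rw [hdiv z hz, Complex.one_re, Complex.one_im]
    push_cast
    ring
  have e2 : ∫ z, (g 0 z * (φ 0 z : ℂ) + g 1 z * (φ 1 z : ℂ))
      = ∫ z, radPart g z * (angFun n c z : ℂ) * ((‖z‖⁻¹ * ψ ‖z‖ : ℝ) : ℂ) := by
    refine integral_congr_ae (ae_of_all _ fun z => ?_)
    simp only [h0, h1, radPart, one_mul]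
    push_cast
    ring
  rw [e1, e2, k1, k2] at key
  have clean : ∀ (W : ℝ → ℂ) (χ : ℝ → ℝ), ∫ r in (0 : ℝ)..3, ((r : ℂ) * ((r⁻¹ : ℝ) : ℂ) * W r) * (χ r : ℂ)
      = ∫ r in (0 : ℝ)..3, W r * (χ r : ℂ) := by
    intro W χ
    refine intervalIntegral.integral_congr_ae (ae_of_all _ fun r hr => ?_)
    rw [uIoc_of_le (by norm_num)] at hr
    have : (r : ℂ) ≠ 0 := by exact_mod_cast hr.1.ne'
    push_cast
    field_simp
  rwa [clean, clean] at key

lemma weak_tangential (hv : IsWeakSolution σa la ω R v g) (hψ : IsRadialTest ψ) (n : ℕ) (c : ℂ) :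
    ∫ r in (0 : ℝ)..3, ((n : ℂ) ^ 2 * (((r⁻¹ : ℝ) : ℂ) *
        ringMean (fun z => v z * (angFun n c z : ℂ)) r)) * (ψ r : ℂ)
      = ∫ r in (0 : ℝ)..3, ringMean (fun z => tanPart g z *
        (angFun n (n * Complex.I * c) z : ℂ)) r * (ψ r : ℂ) := by
  obtain ⟨φ, h0, h1, hdiv⟩ := hψ.exists_vectorField n (n * Complex.I * c) Complex.I
  have key := hv.integral_divergence φ
  obtain ⟨-, k1⟩ := integral_radial_weight (fun ε hε =>
    integrableOn_mul_angFun (hv.integrableOn_annulus hε) n c) hψ (c := fun r => (r ^ 2)⁻¹)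
    (by fun_prop) (fun a ha => ⟨(a ^ 2)⁻¹, fun r hr => by
      rw [abs_inv, abs_of_pos (by have := ha.trans_le hr; positivity)]
      exact inv_anti₀ (by positivity) (by gcongr)⟩)
  obtain ⟨-, k2⟩ := integral_radial_weight (fun ε hε =>
    integrableOn_mul_angFun (hv.integrableOn_tanPart hε) n (n * Complex.I * c)) hψ measurable_inv
    exists_inv_bound
  have hne : ∀ᵐ z : ℂ, z ≠ 0 := by simp [ae_iff, measure_singleton]
  have hang : ∀ z, angFun n (n * Complex.I * (n * Complex.I * c)) z = -(n ^ 2 * angFun n c z) := by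
    intro z
    have : n * Complex.I * (n * Complex.I * c) * unitDir z ^ n
        = ((-(n ^ 2 : ℝ) : ℝ) : ℂ) * (c * unitDir z ^ n) := by
      push_cast
      linear_combination (n : ℂ) ^ 2 * c * unitDir z ^ n * Complex.I_sq
    rw [angFun, angFun, this, Complex.re_ofReal_mul]
    ring
  have e1 : ∫ z, v z * ((∑ j, fderiv ℝ (φ j) z (dir j) : ℝ) : ℂ)
      = -((n : ℂ) ^ 2 * ∫ z, v z * (angFun n c z : ℂ) * (((‖z‖ ^ 2)⁻¹ * ψ ‖z‖ : ℝ) : ℂ)) := by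
    rw [← integral_const_mul, ← integral_neg]
    refine integral_congr_ae ?_
    filter_upwards [hne] with z hz
    rw [hdiv z hz, hang, Complex.I_re, Complex.I_im]
    push_cast
    ring
  have e2 : ∫ z, (g 0 z * (φ 0 z : ℂ) + g 1 z * (φ 1 z : ℂ))
      = ∫ z, tanPart g z * (angFun n (n * Complex.I * c) z : ℂ) * ((‖z‖⁻¹ * ψ ‖z‖ : ℝ) : ℂ) := by
    refine integral_congr_ae (ae_of_all _ fun z => ?_)
    simp only [h0, h1, tanPart, Complex.I_mul_re, Complex.I_mul_im]
    push_cast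
    ring
  rw [e1, e2, k1, k2, neg_inj, ← intervalIntegral.integral_const_mul] at key
  refine Eq.trans ?_ (key.trans ?_) <;>
    refine intervalIntegral.integral_congr_ae (ae_of_all _ fun r hr => ?_) <;>
    rw [uIoc_of_le (by norm_num)] at hr <;>
    have : (r : ℂ) ≠ 0 := by exact_mod_cast hr.1.ne'
  · push_cast
    field_simp
  · push_cast
    field_simp

lemma weak_flux (hσa : 0 < σa) (hla : 0 < la) (hR : 1 < R) (hv : IsWeakSolution σa la ω R v g)
    (hψ : IsRadialTest ψ) (n : ℕ) (c : ℂ) :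
    (∫ r in (0 : ℝ)..3, ((r : ℂ) * massRad σa R r *
        ringMean (fun z => radPart g z * (angFun n c z : ℂ)) r) * ((deriv ψ r : ℝ) : ℂ))
      + ∫ r in (0 : ℝ)..3, ((massTan σa R r : ℂ) * ringMean (fun z => tanPart g z *
          (angFun n (n * Complex.I * c) z : ℂ)) r) * (ψ r : ℂ)
      = ∫ r in (0 : ℝ)..3, ((ω ^ 2 * r / modulusRad la R r : ℝ) : ℂ) *
          ringMean (fun z => v z * (angFun n c z : ℂ)) r * (ψ r : ℂ) := by
  obtain ⟨φ, hφ, hφd⟩ := hψ.exists_separated n c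
  obtain ⟨C, hC0, hC⟩ := exists_medium_bound hσa hla hR
  have key := hv.weak φ
  obtain ⟨i1, k1⟩ := integral_radial_weight (fun ε hε =>
    integrableOn_mul_angFun (hv.integrableOn_radPart hε) n c) hψ.derivTest (measurable_massRad σa R)
    (fun a ha => ⟨C, fun r hr => (hC r (ha.trans_le hr)).2.1⟩)
  obtain ⟨i2, k2⟩ := integral_radial_weight (fun ε hε =>
    integrableOn_mul_angFun (hv.integrableOn_tanPart hε) n (n * Complex.I * c)) hψ
    (c := fun r => massTan σa R r * r⁻¹) ((measurable_massTan σa R).mul measurable_inv)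
    (fun a ha => by
      obtain ⟨D, hD⟩ := exists_inv_bound a ha
      refine ⟨C * D, fun r hr => ?_⟩
      rw [abs_mul]
      exact mul_le_mul (hC r (ha.trans_le hr)).2.2.2.1 (hD r hr) (abs_nonneg _) hC0)
  obtain ⟨-, k3⟩ := integral_radial_weight (fun ε hε =>
    integrableOn_mul_angFun (hv.integrableOn_annulus hε) n c) hψ
    (c := fun r => ω ^ 2 * (modulusRad la R r)⁻¹) ((measurable_modulusRad la R).inv.const_mul _)
    (fun a ha => ⟨ω ^ 2 * C, fun r hr => by
      rw [abs_mul, abs_of_nonneg (by positivity : (0 : ℝ) ≤ ω ^ 2)]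
      gcongr
      exact (hC r (ha.trans_le hr)).2.2.2.2⟩)
  have hne : ∀ᵐ z : ℂ, z ≠ 0 := by simp [ae_iff, measure_singleton]
  have e1 : ∫ x, ∑ j, ∑ k, (sigmaR σa R x j k : ℂ) * g j x * (fderiv ℝ φ x (dir k) : ℂ)
      = ∫ z, (radPart g z * (angFun n c z : ℂ) * ((massRad σa R ‖z‖ * deriv ψ ‖z‖ : ℝ) : ℂ)
        + tanPart g z * (angFun n (n * Complex.I * c) z : ℂ)
          * ((massTan σa R ‖z‖ * ‖z‖⁻¹ * ψ ‖z‖ : ℝ) : ℂ)) := by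
    refine integral_congr_ae ?_
    filter_upwards [hne] with z hz
    rw [sum_sigmaR (fun j => g j z) _ hz, (hφd z hz).1, (hφd z hz).2, radPart, tanPart]
    push_cast
    ring
  have e2 : ∫ x, (ω : ℂ) ^ 2 * ((lambdaR la R x)⁻¹ : ℝ) * v x * (φ x : ℂ)
      = ∫ z, v z * (angFun n c z : ℂ) * ((ω ^ 2 * (modulusRad la R ‖z‖)⁻¹ * ψ ‖z‖ : ℝ) : ℂ) := by
    refine integral_congr_ae (ae_of_all _ fun z => ?_)
    simp only [hφ, lambdaR_eq]
    push_cast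
    ring
  rw [e1, e2, integral_add i1 i2, k1, k2, k3] at key
  refine Eq.trans ?_ (key.trans ?_)
  · congr 1
    refine intervalIntegral.integral_congr_ae (ae_of_all _ fun r hr => ?_)
    rw [uIoc_of_le (by norm_num)] at hr
    have : (r : ℂ) ≠ 0 := by exact_mod_cast hr.1.ne'
    push_cast
    field_simp
  · refine intervalIntegral.integral_congr fun r _ => ?_
    push_cast
    ring

/-- The Fourier coefficients of a weak solution solve the radial system. -/
lemma isModeOn (hσa : 0 < σa) (hla : 0 < la) (hR : 1 < R) (hv : IsWeakSolution σa la ω R v g)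
    (n : ℕ) (c : ℂ) : ∃ F, ∀ a, 0 < a → a ≤ 3 →
      IsModeOn σa la ω R n a 3 (ringMean fun z => v z * (angFun n c z : ℂ)) F := by
  obtain ⟨C, hC0, hC⟩ := exists_medium_bound hσa hla hR
  set V := ringMean fun z => v z * (angFun n c z : ℂ) with hVdef
  set Gr := ringMean fun z => radPart g z * (angFun n c z : ℂ) with hGr
  set Gt := ringMean fun z => tanPart g z * (angFun n (n * Complex.I * c) z : ℂ) with hGt
  have hS : ({R, 2} : Set ℝ).Countable := Set.Finite.countable (by simp)
  have hVc : ∀ a, 0 < a → a ≤ 3 → ContinuousOn V (Icc a 3) := fun a ha ha3 =>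
    continuousOn_ringMean (hv.continuousOn.mul (Complex.continuous_ofReal.comp_continuousOn
      ((contDiffOn_angFun n c).continuousOn.mono fun z hz => hz.2))) ha ha3
  have hVat : ∀ r ∈ Ioo (0 : ℝ) 3, ContinuousAt V r := fun r hr =>
    (hVc (r / 2) (by linarith [hr.1]) (by linarith [hr.1, hr.2])).continuousAt
      (Icc_mem_nhds (by linarith [hr.1]) hr.2)
  have hVl : LocallyIntegrableOn V (Ioo 0 3) := locallyIntegrableOn_ringMean fun ε hε =>
    integrableOn_mul_angFun (hv.integrableOn_annulus hε) n c
  have hGrl : LocallyIntegrableOn Gr (Ioo 0 3) := locallyIntegrableOn_ringMean fun ε hε =>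
    integrableOn_mul_angFun (hv.integrableOn_radPart hε) n c
  have hGtl : LocallyIntegrableOn Gt (Ioo 0 3) := locallyIntegrableOn_ringMean fun ε hε =>
    integrableOn_mul_angFun (hv.integrableOn_tanPart hε) n _
  have hVi : ∀ a, 0 < a → a ≤ 3 → IntervalIntegrable V volume a 3 := fun a ha ha3 =>
    ContinuousOn.intervalIntegrable (by rw [uIcc_of_le ha3]; exact hVc a ha ha3)
  -- the tangential part of the gradient is expressed by `V`, since it is tested with `ψ` itself
  have htl : LocallyIntegrableOn (fun r : ℝ => (n : ℂ) ^ 2 * (((r⁻¹ : ℝ) : ℂ) * V r)) (Ioo 0 3) := by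
    refine ContinuousOn.locallyIntegrableOn (fun r hr => ?_) measurableSet_Ioo
    refine (continuousAt_const.mul (ContinuousAt.mul ?_ (hVat r hr))).continuousWithinAt
    exact Complex.continuous_ofReal.continuousAt.comp (continuousAt_inv₀ hr.1.ne')
  have htan : ∀ᵐ r, r ∈ Ioo (0 : ℝ) 3 → Gt r = (n : ℂ) ^ 2 * (((r⁻¹ : ℝ) : ℂ) * V r) := by
    have := isOpen_Ioo.ae_eq_zero_of_integral_contDiff_smul_eq_zero (hGtl.sub htl) (μ := volume)
      fun ψ h1 h2 h3 => ?_
    · filter_upwards [this] with r hr hmem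
      exact sub_eq_zero.1 (hr hmem)
    have hψ : IsRadialTest ψ := ⟨h1, h2, h3⟩
    have key := hv.weak_tangential hψ n c
    rw [hψ.integral_eq, hψ.integral_eq] at key
    have e : ∀ r, ψ r • ((Gt - fun r : ℝ => (n : ℂ) ^ 2 * (((r⁻¹ : ℝ) : ℂ) * V r)) r)
        = Gt r * (ψ r : ℂ) - (n : ℂ) ^ 2 * (((r⁻¹ : ℝ) : ℂ) * V r) * (ψ r : ℂ) := by
      intro r; rw [Complex.real_smul, Pi.sub_apply]; ring
    refine (integral_congr_ae (ae_of_all _ e)).trans ?_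
    rw [integral_sub (hψ.integrable_mul hGtl) (hψ.integrable_mul htl), key, sub_self]
  -- `Q` is the right-hand side of the equation for the flux. The flux is at first only `L¹`, but has
  -- the weak derivative `Q`, hence coincides with a continuous primitive of `Q`
  set Q : ℝ → ℂ := fun r =>
    ((n ^ 2 * massTan σa R r / r - ω ^ 2 * r / modulusRad la R r : ℝ) : ℂ) * V r with hQdef
  have hQi : ∀ a, 0 < a → a ≤ 3 → IntervalIntegrable Q volume a 3 := by
    intro a ha ha3
    refine intervalIntegrable_mul_of_bounded (C := n ^ 2 * C / a + ω ^ 2 * 3 * C) ha3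
      ((((measurable_massTan σa R).const_mul _).div measurable_id).sub
        ((measurable_id.const_mul _).div (measurable_modulusRad la R))) (fun r hr => ?_) (hVi a ha ha3)
    have hr0 := ha.trans hr.1
    obtain ⟨-, -, -, h1, h2⟩ := hC r hr0
    refine (abs_sub _ _).trans ?_
    rw [abs_div, abs_mul, div_eq_mul_inv (ω ^ 2 * r), abs_mul (ω ^ 2 * r), abs_mul (ω ^ 2),
      abs_of_pos hr0, abs_of_nonneg (by positivity : (0 : ℝ) ≤ (n : ℝ) ^ 2),
      abs_of_nonneg (by positivity : (0 : ℝ) ≤ ω ^ 2)]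
    gcongr
    · exact hr.1.le
    · exact hr.2
  have hQc : ∀ r ∈ Ioo (0 : ℝ) 3, r ∉ ({R, 2} : Set ℝ) → ContinuousAt Q r := by
    intro r hr hr'
    obtain ⟨-, h2, h3⟩ := continuousAt_medium (σa := σa) (la := la) hR hr.1 hr'
    have hm : modulusRad la R r ≠ 0 := by
      have : 0 < modulusRad la R r := by
        rw [modulusRad]
        split_ifs with h h'
        · exact hla
        · exact one_pos
        · have : 0 < r - 1 := by linarith [not_le.1 h]
          have := hr.1
          positivity
      exact this.ne'
    refine ContinuousAt.mul (Complex.continuous_ofReal.continuousAt.comp ?_) (hVat r hr)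
    exact ((continuousAt_const.mul h2).div continuousAt_id hr.1.ne').sub
      ((continuousAt_const.mul continuousAt_id).div h3 hm)
  obtain ⟨H, hHc, hHd⟩ := exists_primitive_off hQi hQc
  have toIoo : ∀ {H : ℝ → ℂ}, (∀ a : ℝ, 0 < a → a ≤ 3 → ContinuousOn H (Icc a 3)) →
      ContinuousOn H (Ioo 0 3) := fun hH r hr =>
    ((hH (r / 2) (by linarith [hr.1]) (by linarith [hr.1, hr.2])).continuousAt
      (Icc_mem_nhds (by linarith [hr.1]) hr.2)).continuousWithinAt
  have hQl := locallyIntegrableOn_of_intervalIntegrable hQi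
  have hPl : LocallyIntegrableOn (fun r : ℝ => (r : ℂ) * massRad σa R r * Gr r) (Ioo 0 3) := by
    intro r hr
    obtain ⟨s, hs, hsi⟩ := hGrl r hr
    refine ⟨s ∩ Ioo 0 3, inter_mem hs self_mem_nhdsWithin, ?_⟩
    refine Integrable.bdd_mul (c := 3 * C) (hsi.mono_set inter_subset_left)
      (Complex.measurable_ofReal.mul
        (Complex.measurable_ofReal.comp (measurable_massRad σa R))).aestronglyMeasurable ?_
    refine ae_restrict_of_ae_restrict_of_subset inter_subset_right
      ((ae_restrict_iff' measurableSet_Ioo).2 (ae_of_all _ fun r hr => ?_))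
    change ‖(r : ℂ) * ((massRad σa R r : ℝ) : ℂ)‖ ≤ _
    rw [norm_mul, Complex.norm_real, Complex.norm_real, Real.norm_of_nonneg hr.1.le]
    exact mul_le_mul hr.2.le (hC r hr.1).2.1 (norm_nonneg _) (by norm_num)
  obtain ⟨d, hd⟩ := exists_const_of_weakDeriv hPl hS (toIoo hHc) hHd hQl fun ψ hψ => by
    have key := hv.weak_flux hσa hla hR hψ n c
    have e : ∫ r in (0 : ℝ)..3, ((massTan σa R r : ℂ) * Gt r) * (ψ r : ℂ)
        = (∫ r in (0 : ℝ)..3, Q r * (ψ r : ℂ)) + ∫ r in (0 : ℝ)..3,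
          ((ω ^ 2 * r / modulusRad la R r : ℝ) : ℂ) * V r * (ψ r : ℂ) := by
      have hi : LocallyIntegrableOn (fun r => ((ω ^ 2 * r / modulusRad la R r : ℝ) : ℂ) * V r)
          (Ioo 0 3) := by
        refine locallyIntegrableOn_of_intervalIntegrable fun a ha ha3 => ?_
        refine intervalIntegrable_mul_of_bounded (C := ω ^ 2 * 3 * C) ha3
          ((measurable_id.const_mul _).div (measurable_modulusRad la R)) (fun r hr => ?_)
          (hVi a ha ha3)
        have hr0 := ha.trans hr.1
        obtain ⟨-, -, -, -, h2⟩ := hC r hr0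
        rw [div_eq_mul_inv (ω ^ 2 * r), abs_mul (ω ^ 2 * r), abs_mul (ω ^ 2),
          abs_of_pos hr0, abs_of_nonneg (by positivity : (0 : ℝ) ≤ ω ^ 2)]
        gcongr
        exact hr.2
      rw [← intervalIntegral.integral_add (hψ.integrable_mul hQl).intervalIntegrable
        (hψ.integrable_mul hi).intervalIntegrable]
      have h3 : ∀ᵐ r : ℝ, r ≠ 3 := by simp [ae_iff, measure_singleton]
      refine intervalIntegral.integral_congr_ae ?_
      filter_upwards [htan, h3] with r hr hr3 hmem
      rw [uIoc_of_le (by norm_num)] at hmem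
      rw [hr ⟨hmem.1, lt_of_le_of_ne hmem.2 hr3⟩]
      simp only [hQdef]
      push_cast
      ring
    rw [e] at key
    linear_combination key
  set F : ℝ → ℂ := fun r => H r + d with hFdef
  have hFc : ∀ a : ℝ, 0 < a → a ≤ 3 → ContinuousOn F (Icc a 3) := fun a ha ha3 =>
    (hHc a ha ha3).add continuousOn_const
  -- `D = F / (σ r)` is the weak derivative of `V`; as `V` and the primitive of `D` are continuous,
  -- they differ by a constant everywhere and not only almost everywhere
  set D : ℝ → ℂ := fun r => F r / (massRad σa R r * r : ℝ) with hDdef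
  have hDi : ∀ a, 0 < a → a ≤ 3 → IntervalIntegrable D volume a 3 := by
    intro a ha ha3
    have h := intervalIntegrable_mul_of_bounded (c := fun r => (massRad σa R r * r)⁻¹)
      (C := C * a⁻¹) ha3 (((measurable_massRad σa R).mul measurable_id).inv) (fun r hr => ?_)
      (ContinuousOn.intervalIntegrable (by rw [uIcc_of_le ha3]; exact hFc a ha ha3))
    · refine h.congr_ae (ae_of_all _ fun r => ?_)
      simp only [hDdef, div_eq_mul_inv]
      push_cast
      ring
    · have hr0 := ha.trans hr.1
      rw [mul_inv, abs_mul, abs_of_pos (inv_pos.2 hr0)]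
      exact mul_le_mul (hC r hr0).2.2.1 (inv_anti₀ ha hr.1.le) (inv_pos.2 hr0).le hC0
  have hDc : ∀ r ∈ Ioo (0 : ℝ) 3, r ∉ ({R, 2} : Set ℝ) → ContinuousAt D r := by
    intro r hr hr'
    obtain ⟨h1, -, -⟩ := continuousAt_medium (σa := σa) (la := la) hR hr.1 hr'
    have hm : massRad σa R r * r ≠ 0 := (mul_pos (hC r hr.1).1 hr.1).ne'
    refine ContinuousAt.div ?_ (Complex.continuous_ofReal.continuousAt.comp (h1.mul continuousAt_id))
      (by exact_mod_cast hm)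
    exact (toIoo hFc).continuousAt (isOpen_Ioo.mem_nhds hr)
  obtain ⟨W, hWc, hWd⟩ := exists_primitive_off hDi hDc
  obtain ⟨e, he⟩ := exists_const_of_weakDeriv hVl hS (toIoo hWc) hWd
    (locallyIntegrableOn_of_intervalIntegrable hDi) fun ψ hψ => by
    rw [hv.weak_radial hψ n c]
    congr 1
    have h3 : ∀ᵐ r : ℝ, r ≠ 3 := by simp [ae_iff, measure_singleton]
    refine intervalIntegral.integral_congr_ae ?_
    filter_upwards [hd, h3] with r hr hr3 hmem
    rw [uIoc_of_le (by norm_num)] at hmem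
    have h1 := hr ⟨hmem.1, lt_of_le_of_ne hmem.2 hr3⟩
    have hm : (massRad σa R r : ℂ) ≠ 0 := by exact_mod_cast (hC r hmem.1).1.ne'
    have hr0 : (r : ℂ) ≠ 0 := by exact_mod_cast hmem.1.ne'
    change Gr r * (ψ r : ℂ) = D r * (ψ r : ℂ)
    simp only [hDdef, hFdef]
    rw [← h1]
    push_cast
    field_simp
  have hVW : EqOn V (fun r => W r + e) (Ioo 0 3) := by
    refine Measure.eqOn_open_of_ae_eq (μ := volume) ?_ isOpen_Ioo (toIoo hVc)
      ((toIoo hWc).add continuousOn_const)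
    exact (ae_restrict_iff' measurableSet_Ioo).2 he
  refine ⟨F, fun a ha ha3 => ⟨hVc a ha ha3, hFc a ha ha3, fun r hr hr' => ?_, fun r hr hr' => ?_⟩⟩
  · have hr0 : r ∈ Ioo (0 : ℝ) 3 := ⟨ha.trans hr.1, hr.2⟩
    refine ((hWd r hr0 hr').add_const e).congr_of_eventuallyEq ?_
    filter_upwards [isOpen_Ioo.mem_nhds hr0] with s hs
    exact hVW hs
  · exact (hHd r ⟨ha.trans hr.1, hr.2⟩ hr').add_const d

end IsWeakSolution

/-! ### Regularity across the origin -/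

/-- The function `f(|z|²) Re (c zⁿ)`. -/
def polyTest (f : ℝ → ℝ) (n : ℕ) (c z : ℂ) : ℝ := f (Complex.normSq z) * (c * z ^ n).re

section polyTest

variable {f : ℝ → ℝ}

lemma contDiff_normSq {m : WithTop ℕ∞} : ContDiff ℝ m Complex.normSq := by
  have e : (Complex.normSq : ℂ → ℝ) = fun z => z.re * z.re + z.im * z.im :=
    funext Complex.normSq_apply
  rw [e]
  exact (Complex.reCLM.contDiff.mul Complex.reCLM.contDiff).add
    (Complex.imCLM.contDiff.mul Complex.imCLM.contDiff)

lemma contDiff_polyTest (hf : ContDiff ℝ ((⊤ : ℕ∞) : WithTop ℕ∞) f) (n : ℕ) (c : ℂ) :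
    ContDiff ℝ ((⊤ : ℕ∞) : WithTop ℕ∞) (polyTest f n c) :=
  (hf.comp contDiff_normSq).mul
    (Complex.reCLM.contDiff.comp (contDiff_const.mul (contDiff_id.pow n)))

lemma fderiv_polyTest (hf : ContDiff ℝ ((⊤ : ℕ∞) : WithTop ℕ∞) f) (n : ℕ) (c z w : ℂ) :
    fderiv ℝ (polyTest f n c) z w
      = polyTest (deriv f) n c z * (2 * (z.re * w.re + z.im * w.im))
        + polyTest f (n - 1) (n * c * w) z := by
  have hl : HasDerivAt (fun s : ℝ => z + (s : ℂ) * w) w 0 := by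
    have := (Complex.ofRealCLM.hasDerivAt (x := (0 : ℝ))).mul_const w
    simpa using this.const_add z
  have h0 : z + ((0 : ℝ) : ℂ) * w = z := by simp
  have h1 : HasDerivAt (fun s : ℝ => polyTest f n c (z + (s : ℂ) * w))
      (fderiv ℝ (polyTest f n c) z w) 0 := by
    have hd : HasFDerivAt (polyTest f n c) (fderiv ℝ (polyTest f n c) z) (z + ((0 : ℝ) : ℂ) * w) := by
      rw [h0]
      exact ((contDiff_polyTest hf n c).differentiable (by simp) z).hasFDerivAt
    exact hd.comp_hasDerivAt 0 hl
  have h2 : HasDerivAt (fun s : ℝ => Complex.normSq (z + (s : ℂ) * w))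
      (2 * (z.re * w.re + z.im * w.im)) 0 := by
    have hre := (Complex.reCLM.hasFDerivAt.comp_hasDerivAt (0 : ℝ) hl)
    have him := (Complex.imCLM.hasFDerivAt.comp_hasDerivAt (0 : ℝ) hl)
    have := (hre.mul hre).add (him.mul him)
    refine (this.congr_deriv ?_).congr_of_eventuallyEq (Eventually.of_forall fun s => ?_)
    · simp
      ring
    · simp [Complex.normSq_apply]
  have h3 : HasDerivAt (fun s : ℝ => (c * (z + (s : ℂ) * w) ^ n).re)
      (n * c * w * z ^ (n - 1)).re 0 := by
    have := Complex.reCLM.hasFDerivAt.comp_hasDerivAt (0 : ℝ) ((hl.pow n).const_mul c)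
    refine this.congr_deriv ?_
    rw [h0]
    change (c * (n * z ^ (n - 1) * w)).re = _
    congr 1
    ring
  have h4 : HasDerivAt (fun s : ℝ => f (Complex.normSq (z + (s : ℂ) * w)))
      (deriv f (Complex.normSq z) * (2 * (z.re * w.re + z.im * w.im))) 0 := by
    have hfd : HasDerivAt f (deriv f (Complex.normSq z)) (Complex.normSq (z + ((0 : ℝ) : ℂ) * w)) := by
      rw [h0]
      exact (hf.differentiable (by simp) _).hasDerivAt
    exact hfd.comp 0 h2
  rw [h1.unique (h4.mul h3)]
  simp only [polyTest, h0]
  ring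

/-- The Laplacian of `f(|z|²) Re (c zⁿ)`. -/
lemma laplacian_polyTest (hf : ContDiff ℝ ((⊤ : ℕ∞) : WithTop ℕ∞) f) (n : ℕ) (c z : ℂ) :
    ∑ j, fderiv ℝ (fun y => fderiv ℝ (polyTest f n c) y (dir j)) z (dir j)
      = polyTest (fun t => 4 * t * deriv (deriv f) t + 4 * (n + 1) * deriv f t) n c z := by
  have hf' : ContDiff ℝ ((⊤ : ℕ∞) : WithTop ℕ∞) (deriv f) := (contDiff_infty_iff_deriv.1 hf).2
  have key : ∀ w : ℂ, fderiv ℝ (fun y => fderiv ℝ (polyTest f n c) y w) z w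
      = (polyTest (deriv (deriv f)) n c z * (2 * (z.re * w.re + z.im * w.im))
          + polyTest (deriv f) (n - 1) (n * c * w) z) * (2 * (z.re * w.re + z.im * w.im))
        + polyTest (deriv f) n c z * (2 * (w.re * w.re + w.im * w.im))
        + (polyTest (deriv f) (n - 1) (n * c * w) z * (2 * (z.re * w.re + z.im * w.im))
          + polyTest f (n - 1 - 1) ((n - 1 : ℕ) * (n * c * w) * w) z) := by
    intro w
    have e : (fun y => fderiv ℝ (polyTest f n c) y w) = fun y =>
        polyTest (deriv f) n c y * (2 * (y.re * w.re + y.im * w.im))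
          + polyTest f (n - 1) (n * c * w) y := funext fun y => fderiv_polyTest hf n c y w
    have d1 : DifferentiableAt ℝ (polyTest (deriv f) n c) z :=
      (contDiff_polyTest hf' n c).differentiable (by simp) z
    have d2 : DifferentiableAt ℝ (polyTest f (n - 1) (n * c * w)) z :=
      (contDiff_polyTest hf _ _).differentiable (by simp) z
    have d3 : HasFDerivAt (fun y : ℂ => 2 * (y.re * w.re + y.im * w.im))
        ((2 : ℝ) • (w.re • Complex.reCLM + w.im • Complex.imCLM)) z := by
      refine (((Complex.reCLM.hasFDerivAt (x := z)).mul_const w.re).add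
        ((Complex.imCLM.hasFDerivAt (x := z)).mul_const w.im)).const_mul 2
    have hd : HasFDerivAt (fun y => polyTest (deriv f) n c y * (2 * (y.re * w.re + y.im * w.im))
        + polyTest f (n - 1) (n * c * w) y) _ z := (d1.hasFDerivAt.mul d3).add d2.hasFDerivAt
    rw [e, hd.fderiv]
    simp only [_root_.add_apply, _root_.smul_apply, smul_eq_mul, fderiv_polyTest hf,
      fderiv_polyTest hf', Complex.reCLM_apply, Complex.imCLM_apply]
    ring
  rw [Fin.sum_univ_two, key, key]
  simp only [polyTest, dir, Complex.normSq_apply]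
  rcases n with _ | n
  · simp
    ring
  · simp only [Nat.add_sub_cancel, pow_succ]
    simp
    ring

end polyTest

/-- A cut-off function, equal to `1` for `t ≤ 1/4` and to `0` for `t ≥ 1/2`. -/
def cutoff (t : ℝ) : ℝ := Real.smoothTransition (2 - 4 * t)

/-- The regular radial profile of order `n`, as a function of `t = r²` and divided by `rⁿ`, cut off
away from the origin. -/
def cutProfile (k : ℝ) (n : ℕ) (t : ℝ) : ℝ := cutoff t * chainJ n (k ^ 2 * t / 4)

section cutProfile

variable {k : ℝ} {n : ℕ}

lemma contDiff_cutProfile (k : ℝ) (n : ℕ) :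
    ContDiff ℝ ((⊤ : ℕ∞) : WithTop ℕ∞) (cutProfile k n) := by
  refine ContDiff.mul ?_ ?_
  · exact Real.smoothTransition.contDiff.comp (contDiff_const.sub (contDiff_const.mul contDiff_id))
  · exact ((contDiff_chainJ n).of_le (by simp)).comp
      ((contDiff_const.mul contDiff_id).div_const _)

lemma cutProfile_of_lt {t : ℝ} (ht : t < 1 / 4) : cutProfile k n t = chainJ n (k ^ 2 * t / 4) := by
  rw [cutProfile, cutoff, Real.smoothTransition.one_of_one_le (by linarith), one_mul]

lemma cutProfile_of_gt {t : ℝ} (ht : 1 / 2 < t) : cutProfile k n t = 0 := by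
  rw [cutProfile, cutoff, Real.smoothTransition.zero_of_nonpos (by linarith), zero_mul]

lemma deriv_chainJ_comp (k : ℝ) (n : ℕ) (t : ℝ) :
    HasDerivAt (fun t => chainJ n (k ^ 2 * t / 4)) (-(k ^ 2 / 4) * chainJ (n + 1) (k ^ 2 * t / 4)) t := by
  have h : HasDerivAt (fun t : ℝ => k ^ 2 * t / 4) (k ^ 2 / 4) t := by
    simpa using ((hasDerivAt_id t).const_mul (k ^ 2)).div_const 4
  exact ((hasDerivAt_chainJ n _).comp t h).congr_deriv (by ring)

lemma deriv_cutProfile_of_lt {t : ℝ} (ht : t < 1 / 4) :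
    deriv (cutProfile k n) t = -(k ^ 2 / 4) * chainJ (n + 1) (k ^ 2 * t / 4) := by
  refine ((deriv_chainJ_comp k n t).congr_of_eventuallyEq ?_).deriv
  filter_upwards [Iio_mem_nhds ht] with s hs
  exact cutProfile_of_lt hs

lemma deriv_deriv_cutProfile_of_lt {t : ℝ} (ht : t < 1 / 4) :
    deriv (deriv (cutProfile k n)) t = (k ^ 2 / 4) ^ 2 * chainJ (n + 2) (k ^ 2 * t / 4) := by
  refine ((((deriv_chainJ_comp k (n + 1) t).const_mul (-(k ^ 2 / 4))).congr_of_eventuallyEq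
    ?_).deriv).trans (by ring)
  filter_upwards [Iio_mem_nhds ht] with s hs
  exact deriv_cutProfile_of_lt hs

lemma deriv_cutProfile_of_gt {t : ℝ} (ht : 1 / 2 < t) : deriv (cutProfile k n) t = 0 := by
  refine ((hasDerivAt_const t (0 : ℝ)).congr_of_eventuallyEq ?_).deriv
  filter_upwards [Ioi_mem_nhds ht] with s hs
  exact cutProfile_of_gt hs

lemma deriv_deriv_cutProfile_of_gt {t : ℝ} (ht : 1 / 2 < t) :
    deriv (deriv (cutProfile k n)) t = 0 := by
  refine ((hasDerivAt_const t (0 : ℝ)).congr_of_eventuallyEq ?_).deriv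
  filter_upwards [Ioi_mem_nhds ht] with s hs
  exact deriv_cutProfile_of_gt hs

/-- The Helmholtz operator applied to the cut-off regular mode, divided by the angular factor. -/
def cutDefect (k : ℝ) (n : ℕ) (t : ℝ) : ℝ :=
  4 * t * deriv (deriv (cutProfile k n)) t + 4 * (n + 1) * deriv (cutProfile k n) t
    + k ^ 2 * cutProfile k n t

lemma cutDefect_of_lt {t : ℝ} (ht : t < 1 / 4) : cutDefect k n t = 0 := by
  rw [cutDefect, cutProfile_of_lt ht, deriv_cutProfile_of_lt ht, deriv_deriv_cutProfile_of_lt ht]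
  have h := chainJ_recurrence n (k ^ 2 * t / 4)
  linear_combination k ^ 2 * h

lemma cutDefect_of_gt {t : ℝ} (ht : 1 / 2 < t) : cutDefect k n t = 0 := by
  rw [cutDefect, cutProfile_of_gt ht, deriv_cutProfile_of_gt ht, deriv_deriv_cutProfile_of_gt ht]
  ring

end cutProfile

/-- A Fourier coefficient of a solution of the Helmholtz equation, in the sense of distributions on
a disc about the origin, has no singular part: the cut-off regular mode is a test function, and
integration by parts turns the equation into the vanishing of a Wronskian. -/
lemma wronskian_eq_zero_of_helmholtz {σa la ω R : ℝ} {v : ℂ → ℂ} {g : Fin 2 → ℂ → ℂ} (hσa : 0 < σa)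
    (hla : 0 < la) (hR : 1 < R) (hR2 : R < 2)
    (hv : IsWeakSolution σa la ω R v g) {T : 𝓓'(disc R, ℂ)} (hT : AgreesOffOrigin T v)
    (hTh : helmholtz (kappa σa la * ω) T = 0) (n : ℕ) (c : ℂ) {F : ℝ → ℂ}
    (hm : IsModeOn σa la ω R n (1 / 4) 3 (ringMean fun z => v z * (angFun n c z : ℂ)) F) :
    ringMean (fun z => v z * (angFun n c z : ℂ)) (1 / 4)
        * (σa * modeP chainJ (kappa σa la * ω) n (1 / 4) : ℝ)
      - F (1 / 4) * (modeF chainJ (kappa σa la * ω) n (1 / 4) : ℝ) = 0 := by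
  set k := kappa σa la * ω with hk
  set V := ringMean fun z => v z * (angFun n c z : ℂ) with hV
  have hk2 : k ^ 2 = ω ^ 2 / (σa * la) := by
    rw [hk, mul_pow, kappa_sq hσa hla]; field_simp
  set f := cutProfile k n with hfdef
  have hf : ContDiff ℝ ((⊤ : ℕ∞) : WithTop ℕ∞) f := contDiff_cutProfile k n
  have hf' : ContDiff ℝ ((⊤ : ℕ∞) : WithTop ℕ∞) (deriv f) := (contDiff_infty_iff_deriv.1 hf).2
  have hsq : ∀ z : ℂ, Complex.normSq z = ‖z‖ ^ 2 := Complex.normSq_eq_norm_sq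
  -- the cut-off regular mode is smooth at the origin, hence a test function for `T`
  have hsupp : tsupport (polyTest f n c) ⊆ Metric.closedBall 0 (3 / 4) := by
    refine closure_minimal (fun z hz => by_contra fun hcon => hz ?_) Metric.isClosed_closedBall
    rw [mem_closedBall_zero_iff, not_le] at hcon
    rw [polyTest, hfdef, cutProfile_of_gt, zero_mul]
    rw [hsq]
    nlinarith
  let φ : 𝓓(disc R, ℝ) := ⟨polyTest f n c, contDiff_polyTest hf n c,
    HasCompactSupport.of_support_subset_isCompact (isCompact_closedBall 0 (3 / 4))
      ((subset_tsupport _).trans hsupp),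
    hsupp.trans (Metric.closedBall_subset_ball (by linarith))⟩
  let Ψ : 𝓓(disc R, ℝ) := (∑ j, ∂_{dir j} (∂_{dir j} φ)) + k ^ 2 • φ
  have hΨ : ∀ z, Ψ z = polyTest (cutDefect k n) n c z := by
    intro z
    have h1 : Ψ z = (∑ j, fderiv ℝ (fun y => fderiv ℝ (polyTest f n c) y (dir j)) z (dir j))
        + k ^ 2 * polyTest f n c z := by
      rw [Fin.sum_univ_two]
      change (∑ j, ∂_{dir j} (∂_{dir j} φ) : 𝓓(disc R, ℝ)) z + (k ^ 2 • φ : 𝓓(disc R, ℝ)) z = _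
      rw [Fin.sum_univ_two]
      rfl
    rw [h1, laplacian_polyTest hf]
    simp only [polyTest, cutDefect]
    ring
  -- near the origin the regular mode satisfies the Helmholtz equation, so that `T` acts on `Ψ` through
  -- the function `v`
  have hΨ0 : (0 : ℂ) ∉ tsupport Ψ := by
    rw [notMem_tsupport_iff_eventuallyEq]
    filter_upwards [Metric.ball_mem_nhds (0 : ℂ) (by norm_num : (0 : ℝ) < 1 / 2)] with z hz
    rw [mem_ball_zero_iff] at hz
    rw [hΨ, polyTest, cutDefect_of_lt, zero_mul]
    · rfl
    · rw [hsq]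
      nlinarith [norm_nonneg z]
  have hTΨ : ∫ z, (Ψ z : ℂ) * v z = 0 := by
    rw [← hT Ψ hΨ0]
    have h1 : helmholtz k T φ = 0 := by rw [hTh]; rfl
    rw [helmholtz_apply] at h1
    have h2 : T Ψ = (∑ j, T (∂_{dir j} (∂_{dir j} φ))) + (k : ℂ) ^ 2 * T φ := by
      change T ((∑ j, ∂_{dir j} (∂_{dir j} φ)) + k ^ 2 • φ) = _
      rw [map_add, map_sum, map_smul, Complex.real_smul]
      push_cast
      rfl
    rw [h2, h1]
  obtain ⟨a₀, ha0, hφa⟩ := isAnnularTest_of_agrees (by linarith : R ≤ 3) Ψ hΨ0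
  have hint : Integrable fun z => v z * (Ψ z : ℂ) :=
    IsWeakSolution.integrable_mul_test (fun ε => hv.integrableOn_annulus) hφa ha0
  simp only [mul_comm _ (v _)] at hTΨ
  have hzero : ∀ z : ℂ, ‖z‖ < 1 / 4 ∨ 3 ≤ ‖z‖ → v z * (Ψ z : ℂ) = 0 := by
    intro z hz
    rw [hΨ, polyTest]
    rcases hz with hz | hz
    · rw [cutDefect_of_lt (by rw [hsq]; nlinarith [norm_nonneg z])]; simp
    · rw [cutDefect_of_gt (by rw [hsq]; nlinarith)]; simp
  rw [integral_polar hint (by norm_num) (by norm_num) hzero] at hTΨ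
  -- `Ψ` is a separated function, and the integral over the angle gives `V`
  have hrad : ∀ r ∈ Ioc (1 / 4 : ℝ) 3, (r : ℂ) * ∫ θ in (-Real.pi)..Real.pi,
      v (pt r θ) * (Ψ (pt r θ) : ℂ) = V r * ((r ^ (n + 1) * cutDefect k n (r ^ 2) : ℝ) : ℂ) := by
    intro r hr
    have hr0 : 0 < r := by linarith [hr.1]
    rw [hV, ringMean, ← intervalIntegral.integral_const_mul, ← intervalIntegral.integral_mul_const]
    refine intervalIntegral.integral_congr fun θ _ => ?_
    have e1 : c * pt r θ ^ n = ((r ^ n : ℝ) : ℂ) * (c * circ θ ^ n) := by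
      rw [pt, mul_pow]; push_cast; ring
    simp only [hΨ, polyTest, hsq, norm_pt_of_pos hr0, angFun_pt hr0, e1, Complex.re_ofReal_mul]
    push_cast
    ring
  have hTr : ∫ r in (1 / 4 : ℝ)..3, V r * ((r ^ (n + 1) * cutDefect k n (r ^ 2) : ℝ) : ℂ) = 0 := by
    rw [← hTΨ]
    refine (intervalIntegral.integral_congr_ae (ae_of_all _ fun r hr => ?_)).symm
    rw [uIoc_of_le (by norm_num)] at hr
    exact hrad r hr
  have hcd : Continuous (cutDefect k n) := by
    have h1 : Continuous (deriv (deriv (cutProfile k n))) :=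
      (contDiff_infty_iff_deriv.1 hf').2.continuous
    have h2 : Continuous (deriv (cutProfile k n)) := hf'.continuous
    have h3 : Continuous (cutProfile k n) := hf.continuous
    change Continuous fun t => 4 * t * deriv (deriv (cutProfile k n)) t
      + 4 * (n + 1) * deriv (cutProfile k n) t + k ^ 2 * cutProfile k n t
    fun_prop
  have hi1 : IntervalIntegrable (fun r => V r * ((r ^ (n + 1) * cutDefect k n (r ^ 2) : ℝ) : ℂ))
      volume (1 / 4) 3 := by
    refine ContinuousOn.intervalIntegrable ?_
    rw [uIcc_of_le (by norm_num)]
    exact hm.continuousOn.mul (Continuous.continuousOn (by fun_prop))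
  have hsplit := intervalIntegral.integral_add_adjacent_intervals (a := 1 / 4) (b := 1) (c := 3)
    (hi1.mono_set (uIcc_subset_uIcc left_mem_uIcc (by
      rw [uIcc_of_le (by norm_num)]; norm_num)))
    (hi1.mono_set (uIcc_subset_uIcc (by rw [uIcc_of_le (by norm_num)]; norm_num) right_mem_uIcc))
  have hout : ∫ r in (1 : ℝ)..3, V r * ((r ^ (n + 1) * cutDefect k n (r ^ 2) : ℝ) : ℂ) = 0 := by
    rw [intervalIntegral.integral_congr (g := fun _ => 0)]
    · simp
    · intro r hr
      rw [uIcc_of_le (by norm_num)] at hr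
      simp only
      rw [cutDefect_of_gt (by nlinarith [hr.1]), mul_zero, Complex.ofReal_zero, mul_zero]
  rw [hTr, hout, add_zero] at hsplit
  -- the profile `y = rⁿ f(r²)` of the test function and `s = r y'`
  set y : ℝ → ℝ := fun r => r ^ n * f (r ^ 2) with hy
  set s : ℝ → ℝ := fun r => 2 * r ^ (n + 2) * deriv f (r ^ 2) + n * y r with hs
  have hyc : Continuous y := by have := hf.continuous; fun_prop
  have hsc : Continuous s := by have := hf'.continuous; fun_prop
  have hsqd : ∀ r : ℝ, HasDerivAt (fun r : ℝ => r ^ 2) (2 * r) r := fun r => by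
    simpa using hasDerivAt_pow 2 r
  have hyd : ∀ r, 0 < r → HasDerivAt y (s r / r) r := by
    intro r hr
    have h1 := ((hf.differentiable (by simp) (r ^ 2)).hasDerivAt.comp r (hsqd r))
    refine ((hasDerivAt_pow n r).mul h1).congr_deriv ?_
    simp only [hs, hy, Function.comp]
    rcases n with _ | n
    · simp; field_simp
    · simp only [Nat.add_sub_cancel]
      push_cast
      field_simp
      ring
  have hsd : ∀ r, 0 < r → HasDerivAt s (n ^ 2 * y r / r - k ^ 2 * r * y r
      + r ^ (n + 1) * cutDefect k n (r ^ 2)) r := by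
    intro r hr
    have h1 := ((hf'.differentiable (by simp) (r ^ 2)).hasDerivAt.comp r (hsqd r))
    refine ((((hasDerivAt_pow (n + 2) r).const_mul 2).mul h1).add
      ((hyd r hr).const_mul (n : ℝ))).congr_deriv ?_
    simp only [hs, hy, Function.comp, cutDefect, ← hfdef]
    push_cast
    field_simp
    ring
  -- the integrand is the derivative of the Wronskian of `V` and `y`, which vanishes at `r = 1`, beyond
  -- the cut-off; at `r = 1/4` the function `y` is the regular profile
  have hE := integral_eq_of_hasDerivAt_off_countable_of_le
    (fun r => V r * (s r : ℂ) - F r / σa * (y r : ℂ))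
    (fun r => V r * ((r ^ (n + 1) * cutDefect k n (r ^ 2) : ℝ) : ℂ))
    (by norm_num : (1 / 4 : ℝ) ≤ 1) countable_empty
    (((hm.continuousOn.mono (Icc_subset_Icc_right (by norm_num))).mul
      (Complex.continuous_ofReal.comp hsc).continuousOn).sub
      (((hm.continuousOn_flux.mono (Icc_subset_Icc_right (by norm_num))).div_const _).mul
        (Complex.continuous_ofReal.comp hyc).continuousOn)) (fun r hr => ?_)
    (hi1.mono_set (uIcc_subset_uIcc left_mem_uIcc (by
      rw [uIcc_of_le (by norm_num)]; norm_num)))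
  · rw [hsplit] at hE
    have y1 : y 1 = 0 := by
      simp only [hy, hfdef]; rw [cutProfile_of_gt (by norm_num)]; ring
    have s1 : s 1 = 0 := by
      simp only [hs, hfdef]; rw [deriv_cutProfile_of_gt (by norm_num), y1]; ring
    have y2 : y (1 / 4) = modeF chainJ k n (1 / 4) := by
      simp only [hy, hfdef]; rw [cutProfile_of_lt (by norm_num), modeF]
    have s2 : s (1 / 4) = modeP chainJ k n (1 / 4) := by
      simp only [hs, hfdef]
      rw [deriv_cutProfile_of_lt (by norm_num), y2, modeP]
      ring
    rw [y1, s1, y2, s2] at hE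
    have hσ : (σa : ℂ) ≠ 0 := by exact_mod_cast hσa.ne'
    push_cast at hE ⊢
    field_simp at hE
    linear_combination hE
  · have hr0 : 0 < r := by linarith [hr.1.1]
    have hr3 : r ∈ Ioo (1 / 4 : ℝ) 3 := ⟨hr.1.1, by linarith [hr.1.2]⟩
    have hrR : r ≤ R := by linarith [hr.1.2]
    have hrS : r ∉ ({R, 2} : Set ℝ) := by
      simp only [mem_insert_iff, mem_singleton_iff, not_or]
      exact ⟨by linarith [hr.1.2], by linarith [hr.1.2]⟩
    have d1 := hm.hasDerivAt r hr3 hrS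
    have d2 := hm.hasDerivAt_flux r hr3 hrS
    have hr0' : (r : ℂ) ≠ 0 := by exact_mod_cast hr0.ne'
    have hσ : (σa : ℂ) ≠ 0 := by exact_mod_cast hσa.ne'
    have hl : (la : ℂ) ≠ 0 := by exact_mod_cast hla.ne'
    refine ((d1.mul (hsd r hr0).ofReal_comp).sub
      ((d2.div_const _).mul (hyd r hr0).ofReal_comp)).congr_deriv ?_
    rw [massRad, massTan, modulusRad, if_pos hrR, if_pos hrR, if_pos hrR, hk2]
    push_cast
    field_simp
    ring

/-! ### Uniqueness in the truncated cloak -/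

/-- A function whose Fourier coefficients on every circle vanish is zero. -/
lemma eq_zero_of_ringMean {v : ℂ → ℂ} (hv : ContinuousOn v (Metric.closedBall 0 3 \ {0}))
    {r : ℝ} (hr : 0 < r) (hr3 : r ≤ 3)
    (h : ∀ (n : ℕ) (c : ℂ), ringMean (fun z => v z * (angFun n c z : ℂ)) r = 0) (θ : ℝ) :
    v (pt r θ) = 0 := by
  have : Fact (0 < 2 * Real.pi) := ⟨Real.two_pi_pos⟩
  have hnorm : ∀ x : AddCircle (2 * Real.pi), ‖(r : ℂ) * (AddCircle.toCircle x : ℂ)‖ = r := fun x => by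
    rw [norm_mul, Complex.norm_real, Real.norm_of_nonneg hr.le, Circle.norm_coe, mul_one]
  have hc : Continuous fun x : AddCircle (2 * Real.pi) => v (r * (AddCircle.toCircle x : ℂ)) := by
    refine hv.comp_continuous (continuous_const.mul
      (continuous_subtype_val.comp AddCircle.continuous_toCircle)) fun x => ?_
    refine ⟨mem_closedBall_zero_iff.2 ((hnorm x).trans_le hr3), fun h0 => ?_⟩
    have := hnorm x
    rw [mem_singleton_iff.1 h0, norm_zero] at this
    exact hr.ne this
  let f : C(AddCircle (2 * Real.pi), ℂ) := ⟨_, hc⟩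
  have hcirc : ∀ t : ℝ, ((AddCircle.toCircle (t : AddCircle (2 * Real.pi)) : Circle) : ℂ) = circ t := by
    intro t
    rw [AddCircle.toCircle_apply_mk, Circle.coe_exp, circ, div_self Real.two_pi_pos.ne', one_mul]
  have hf : ∀ t : ℝ, f (t : AddCircle (2 * Real.pi)) = v (pt r t) := fun t => by
    change v (r * ((AddCircle.toCircle (t : AddCircle (2 * Real.pi)) : Circle) : ℂ)) = _
    rw [hcirc]; rfl
  have hvc : Continuous fun t => v (pt r t) := by
    have : (fun t => v (pt r t)) = fun t : ℝ => f (t : AddCircle (2 * Real.pi)) :=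
      funext fun t => (hf t).symm
    rw [this]
    exact f.continuous.comp (AddCircle.continuous_mk' _)
  have hreal : ∀ (n : ℕ) (c : ℂ), ∫ t in (-Real.pi)..Real.pi,
      v (pt r t) * (((c * circ t ^ n).re : ℝ) : ℂ) = 0 := by
    intro n c
    have := h n c
    simp only [ringMean, angFun_pt hr] at this
    exact this
  have hcont : ∀ (n : ℕ) (c : ℂ), IntervalIntegrable
      (fun t => v (pt r t) * (((c * circ t ^ n).re : ℝ) : ℂ)) volume (-Real.pi) Real.pi := by
    intro n c
    exact (hvc.mul (Complex.continuous_ofReal.comp (Complex.continuous_re.comp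
      (continuous_const.mul (continuous_circ.pow n))))).intervalIntegrable _ _
  have hexp : ∀ n : ℕ, (∫ t in (-Real.pi)..Real.pi, circ t ^ n * v (pt r t)) = 0 ∧
      (∫ t in (-Real.pi)..Real.pi, (starRingEnd ℂ) (circ t ^ n) * v (pt r t)) = 0 := by
    intro n
    have him : ∀ w : ℂ, (-Complex.I * w).re = w.im := fun w => by simp
    have hconj : ∀ w : ℂ, (starRingEnd ℂ) w = (w.re : ℂ) - w.im * Complex.I := fun w => by
      apply Complex.ext <;> simp
    have e1 : ∀ t, circ t ^ n * v (pt r t) = v (pt r t) * (((1 * circ t ^ n).re : ℝ) : ℂ)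
        + Complex.I * (v (pt r t) * (((-Complex.I * circ t ^ n).re : ℝ) : ℂ)) := by
      intro t
      have hw := Complex.re_add_im (circ t ^ n)
      rw [one_mul, him]
      linear_combination (-(v (pt r t))) * hw
    have e2 : ∀ t, (starRingEnd ℂ) (circ t ^ n) * v (pt r t)
        = v (pt r t) * (((1 * circ t ^ n).re : ℝ) : ℂ)
        - Complex.I * (v (pt r t) * (((-Complex.I * circ t ^ n).re : ℝ) : ℂ)) := by
      intro t
      rw [one_mul, him, hconj]
      ring
    refine ⟨?_, ?_⟩
    · simp only [e1]
      rw [intervalIntegral.integral_add (hcont n 1) ((hcont n _).const_mul _),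
        intervalIntegral.integral_const_mul, hreal, hreal, mul_zero, add_zero]
    · simp only [e2]
      rw [intervalIntegral.integral_sub (hcont n 1) ((hcont n _).const_mul _),
        intervalIntegral.integral_const_mul, hreal, hreal, mul_zero, sub_zero]
  have hcoef : ∀ n : ℤ, fourierCoeff f n = 0 := by
    intro n
    rw [fourierCoeff_eq_intervalIntegral f n (-Real.pi),
      show -Real.pi + 2 * Real.pi = Real.pi by ring]
    have e : ∀ t : ℝ, fourier (-n) (t : AddCircle (2 * Real.pi)) • f (t : AddCircle (2 * Real.pi))
        = circ t ^ (-n) * v (pt r t) := by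
      intro t
      rw [hf, smul_eq_mul, fourier_apply, AddCircle.toCircle_zsmul, Circle.coe_zpow, hcirc]
    simp only [e]
    rcases le_total n 0 with hn | hn
    · obtain ⟨m, rfl⟩ : ∃ m : ℕ, n = -(m : ℤ) := ⟨n.natAbs, by omega⟩
      simp only [neg_neg, zpow_natCast]
      rw [(hexp m).1, smul_zero]
    · lift n to ℕ using hn
      have e2 : ∀ t : ℝ, circ t ^ (-(n : ℤ)) = (starRingEnd ℂ) (circ t ^ n) := by
        intro t
        rw [zpow_neg, zpow_natCast, map_pow, ← inv_pow]
        congr 1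
        exact Complex.inv_eq_conj (norm_circ t)
      simp only [e2]
      rw [(hexp n).2, smul_zero]
  have hsum : Summable (fourierCoeff f) := by
    have : fourierCoeff (f : AddCircle (2 * Real.pi) → ℂ) = fun _ => 0 := funext hcoef
    rw [this]
    exact summable_zero
  have key := hasSum_fourier_series_of_summable hsum
  simp only [hcoef, zero_smul] at key
  have hf0 : f = 0 := key.unique hasSum_zero
  rw [← hf, hf0]
  rfl

/-- The truncated cloak has at most one solution. -/
lemma IsCloakSolution.eqOn {σa la ω R : ℝ} (hσa : 0 < σa) (hla : 0 < la) (hω : 0 < ω)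
    (hR : 1 < R) (hR2 : R < 2) (hdet : ∀ n, modeDet σa la ω R n ≠ 0) {N : ℕ} {q : ℕ × ℕ → ℂ}
    {u v : ℂ → ℂ} (hu : IsCloakSolution σa la ω R N q u) (hv : IsCloakSolution σa la ω R N q v) :
    EqOn v u (Metric.closedBall 0 3 \ {0}) := by
  obtain ⟨g, g1, g2, g3⟩ := hu.weak
  obtain ⟨h, h1, h2, h3⟩ := hv.weak
  have wu : IsWeakSolution σa la ω R u g := ⟨hu.continuousOn, hu.boundary, g1, g2, g3⟩
  have wv : IsWeakSolution σa la ω R v h := ⟨hv.continuousOn, hv.boundary, h1, h2, h3⟩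
  have wd := wv.add hσa hla hR (wu.smul (-1))
  obtain ⟨S, S1, S2⟩ := hu.source
  obtain ⟨T, T1, T2⟩ := hv.source
  have hκ := kappa_sq hσa hla
  have hop : ∀ T : 𝓓'(disc R, ℂ), (la * σa) • laplace T + ω ^ 2 • T
      = (la * σa) • helmholtz (kappa σa la * ω) T := by
    intro T
    rw [helmholtz, smul_add, smul_smul, mul_pow, hκ]
    congr 2
    field_simp
  have hD : helmholtz (kappa σa la * ω) (T + (-1 : ℂ) • S) = 0 := by
    rw [hop] at S2 T2
    have h0 : helmholtz (kappa σa la * ω) T = helmholtz (kappa σa la * ω) S :=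
      smul_right_injective _ (mul_pos hla hσa).ne' (T2.trans S2.symm)
    rw [helmholtz_add, helmholtz_smul, h0]
    ext φ
    change helmholtz _ S φ + -1 * helmholtz _ S φ = 0
    ring
  have hA : AgreesOffOrigin (T + (-1 : ℂ) • S) (v + (-1 : ℂ) • u) := by
    intro φ h0
    obtain ⟨a₀, ha0, hφ⟩ := isAnnularTest_of_agrees (by linarith : R ≤ 3) φ h0
    have i1 := IsWeakSolution.integrable_mul_test (fun ε => wv.integrableOn_annulus) hφ ha0
    have i2 := IsWeakSolution.integrable_mul_test (fun ε => wu.integrableOn_annulus) hφ ha0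
    change T φ + -1 * S φ = _
    rw [T1 φ h0, S1 φ h0]
    simp only [mul_comm ((φ _ : ℝ) : ℂ)]
    rw [← integral_const_mul, ← integral_add i1 (i2.const_mul _)]
    refine integral_congr_ae (ae_of_all _ fun z => ?_)
    simp only [Pi.add_apply, Pi.smul_apply, smul_eq_mul]
    ring
  have hmean : ∀ (n : ℕ) (c : ℂ) (r : ℝ), 0 < r → r ≤ 3 →
      ringMean (fun z => (v + (-1 : ℂ) • u) z * (angFun n c z : ℂ)) r = 0 := by
    intro n c
    obtain ⟨F, hF⟩ := wd.isModeOn hσa hla hR n c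
    refine IsModeOn.eq_zero hσa hla hω hR hR2 (hdet n) hF ?_ (a := 1 / 4) (by norm_num)
      (by linarith) (wronskian_eq_zero_of_helmholtz hσa hla hR hR2 wd hA hD n c
        (hF _ (by norm_num) (by norm_num)))
    rw [ringMean]
    have : ∀ θ, (v + (-1 : ℂ) • u) (pt 3 θ) * (angFun n c (pt 3 θ) : ℂ) = 0 := fun θ => by
      rw [wd.boundary _ (norm_pt_of_pos (by norm_num) θ), zero_mul]
    simp only [this, intervalIntegral.integral_zero]
  intro z hz
  have hz0 : 0 < ‖z‖ := norm_pos_iff.2 fun h => hz.2 (by simp [h])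
  have hz3 : ‖z‖ ≤ 3 := mem_closedBall_zero_iff.1 hz.1
  obtain ⟨θ, hθ⟩ := exists_pt z
  have := eq_zero_of_ringMean wd.continuousOn hz0 hz3 (fun n c => hmean n c _ hz0 hz3) θ
  rw [← hθ] at this
  simp only [Pi.add_apply, Pi.smul_apply, smul_eq_mul, neg_mul, one_mul] at this
  linear_combination this

/-! ### Trigonometric polynomials on the circle -/

lemma integral_circ_zpow {n : ℤ} (hn : n ≠ 0) : ∫ t in (0 : ℝ)..(2 * Real.pi), circ t ^ n = 0 := by
  have hc : (n : ℂ) * Complex.I ≠ 0 := mul_ne_zero (Int.cast_ne_zero.2 hn) Complex.I_ne_zero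
  have e : ∀ t : ℝ, circ t ^ n = Complex.exp (n * Complex.I * t) := fun t => by
    rw [circ, ← Complex.exp_int_mul]; congr 1; ring
  simp only [e]
  rw [integral_exp_mul_complex hc]
  have h : Complex.exp (n * Complex.I * ((2 * Real.pi : ℝ) : ℂ)) = 1 := by
    rw [Complex.exp_eq_one_iff]
    exact ⟨n, by push_cast; ring⟩
  rw [h]
  simp

lemma fourierCoeffOn_circ_sum (s : Finset ℤ) (c : ℤ → ℂ) (n : ℤ) :
    fourierCoeffOn Real.two_pi_pos (fun θ => ∑ m ∈ s, c m * circ θ ^ m) n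
      = if n ∈ s then c n else 0 := by
  rw [fourierCoeffOn_eq_integral]
  have e : ∀ t : ℝ, fourier (-n) (t : AddCircle (2 * Real.pi - 0)) • (∑ m ∈ s, c m * circ t ^ m)
      = ∑ m ∈ s, c m * circ t ^ (m - n) := by
    intro t
    rw [smul_eq_mul, Finset.mul_sum, fourier_coe_apply]
    refine Finset.sum_congr rfl fun m _ => ?_
    have h : Complex.exp (2 * Real.pi * Complex.I * ((-n : ℤ) : ℂ) * t / ((2 * Real.pi - 0 : ℝ) : ℂ))
        = circ t ^ (-n) := by
      rw [circ, ← Complex.exp_int_mul]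
      congr 1
      have : (Real.pi : ℂ) ≠ 0 := by exact_mod_cast Real.pi_ne_zero
      push_cast
      field_simp
      ring
    rw [h, sub_eq_add_neg, zpow_add₀ (circ_ne_zero t)]
    ring
  simp only [e]
  have hi : ∀ m ∈ s, IntervalIntegrable (fun t => c m * circ t ^ (m - n)) volume 0 (2 * Real.pi) :=
    fun m _ => (continuous_const.mul (continuous_circ.zpow₀ _ fun t =>
      Or.inl (circ_ne_zero t))).intervalIntegrable _ _
  rw [intervalIntegral.integral_finsetSum hi]
  have hm : ∀ m ∈ s, ∫ t in (0 : ℝ)..(2 * Real.pi), c m * circ t ^ (m - n)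
      = if m = n then ((2 * Real.pi : ℝ) : ℂ) * c m else 0 := by
    intro m _
    rw [intervalIntegral.integral_const_mul]
    split_ifs with h
    · subst h
      simp [mul_comm]
    · rw [integral_circ_zpow (sub_ne_zero.2 h), mul_zero]
  rw [Finset.sum_congr rfl hm, Finset.sum_ite_eq']
  split_ifs
  · have : (Real.pi : ℂ) ≠ 0 := by exact_mod_cast Real.pi_ne_zero
    rw [sub_zero, Complex.real_smul]
    push_cast
    field_simp
  · rw [smul_zero]

lemma hasHalfLaplacian_circ_sum (s : Finset ℤ) (c : ℤ → ℂ) :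
    HasHalfLaplacian (fun θ => ∑ m ∈ s, c m * circ θ ^ m)
      fun θ => ∑ m ∈ s, ((|m| : ℤ) : ℂ) * c m * circ θ ^ m := by
  intro θ
  simp only [fourierCoeffOn_circ_sum]
  have hs : HasSum (fun n : ℤ =>
      ((|n| : ℤ) : ℂ) * (if n ∈ s then c n else 0) * Complex.exp (n * θ * Complex.I)) _ :=
    hasSum_sum_of_ne_finset_zero (s := s) fun n hn => by rw [if_neg hn, mul_zero, zero_mul]
  convert hs using 1
  refine Finset.sum_congr rfl fun m hm => ?_
  rw [if_pos hm, circ, ← Complex.exp_int_mul, mul_assoc (m : ℂ)]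

/-! ### The limit field -/

lemma contDiffOn_modeF_chainJ (k : ℝ) (n : ℕ) :
    ContDiffOn ℝ ((⊤ : ℕ∞) : WithTop ℕ∞) (modeF chainJ k n) (Ioi 0) := by
  have := contDiff_chainJ n
  unfold modeF
  exact ContDiff.contDiffOn (by fun_prop)

lemma contDiffOn_modeF_chainY {k : ℝ} (hk : 0 < k) (n : ℕ) :
    ContDiffOn ℝ ((⊤ : ℕ∞) : WithTop ℕ∞) (modeF chainY k n) (Ioi 0) := by
  have hY : ContDiffOn ℝ ((⊤ : ℕ∞) : WithTop ℕ∞) (chainY n) (Ioi 0) :=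
    ((contDiff_chainJ n).contDiffOn.mul (Real.contDiffOn_log.mono fun t ht => (ne_of_gt ht))).add
      ((contDiff_regY n).contDiffOn.div (contDiff_id.pow n).contDiffOn
        fun t ht => pow_ne_zero _ (ne_of_gt ht))
  exact (contDiff_id.pow n).contDiffOn.mul (hY.comp
    (ContDiff.contDiffOn (f := fun r : ℝ => k ^ 2 * r ^ 2 / 4) (by fun_prop)) fun r hr => by
      have : (0 : ℝ) < r := hr
      exact mem_Ioi.2 (by positivity))

lemma contDiffOn_modeFun {V : ℝ → ℝ} (n : ℤ)
    (hV : ContDiffOn ℝ ((⊤ : ℕ∞) : WithTop ℕ∞) V (Ioi 0)) :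
    ContDiffOn ℝ ((⊤ : ℕ∞) : WithTop ℕ∞) (modeFun n fun r => (V r : ℂ)) {0}ᶜ := by
  have h1 : ContDiffOn ℝ ((⊤ : ℕ∞) : WithTop ℕ∞) (fun z : ℂ => V ‖z‖) {0}ᶜ :=
    hV.comp (fun z hz => (contDiffAt_norm ℝ hz).contDiffWithinAt) fun z hz => norm_pos_iff.2 hz
  have h2 : ContDiffOn ℝ ((⊤ : ℕ∞) : WithTop ℕ∞) (fun z => unitDir z ^ n) {0}ᶜ := by
    rcases n with n | n
    · simpa using contDiffOn_unitDir.pow n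
    · simp only [zpow_negSucc]
      exact (contDiffOn_unitDir.pow (n + 1)).inv fun z hz => pow_ne_zero _ (unitDir_ne_zero hz)
  exact (Complex.ofRealCLM.contDiff.comp_contDiffOn h1).mul h2

lemma contDiffOn_totalField {k : ℝ} (hk : 0 < k) (b : ℤ →₀ ℂ) (A : ℤ → ℂ) :
    ContDiffOn ℝ ((⊤ : ℕ∞) : WithTop ℕ∞) (totalField k b A) {0}ᶜ := by
  unfold totalField Finsupp.sum
  exact ContDiffOn.sum fun n _ => contDiffOn_const.mul
    ((contDiffOn_const.mul (contDiffOn_modeFun n (contDiffOn_modeF_chainJ k _))).add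
      (contDiffOn_modeFun n (contDiffOn_modeF_chainY hk _)))

lemma totalField_pt {k : ℝ} (b : ℤ →₀ ℂ) (A : ℤ → ℂ) {r : ℝ} (hr : 0 < r) (θ : ℝ) :
    totalField k b A (pt r θ) = ∑ n ∈ b.support,
      b n * (A n * modeF chainJ k n.natAbs r + modeF chainY k n.natAbs r) * circ θ ^ n := by
  simp only [totalField, Finsupp.sum, modeFun_pt hr, regularAmp, singularAmp, harm]
  exact Finset.sum_congr rfl fun n _ => by ring

lemma hasDerivAt_totalField_pt {k : ℝ} (hk : 0 < k) (b : ℤ →₀ ℂ) (A : ℤ → ℂ) {r : ℝ} (hr : 0 < r)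
    (θ : ℝ) :
    HasDerivAt (fun r => totalField k b A (pt r θ)) (∑ n ∈ b.support,
      b n * (A n * ((modeP chainJ k n.natAbs r / r : ℝ) : ℂ)
        + ((modeP chainY k n.natAbs r / r : ℝ) : ℂ)) * circ θ ^ n) r := by
  have e : (fun r => totalField k b A (pt r θ)) =ᶠ[𝓝 r] fun r => ∑ n ∈ b.support,
      b n * (A n * modeF chainJ k n.natAbs r + modeF chainY k n.natAbs r) * circ θ ^ n :=
    (lt_mem_nhds hr).mono fun s hs => totalField_pt b A hs θ
  refine HasDerivAt.congr_of_eventuallyEq (HasDerivAt.fun_sum fun n _ => ?_) e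
  exact ((((hasDerivAt_modeF isBesselChain_chainJ hk n.natAbs hr).ofReal_comp.const_mul (A n)).add
    (hasDerivAt_modeF isBesselChain_chainY hk n.natAbs hr).ofReal_comp).const_mul (b n)).mul_const _

/-- The limit of the fields in the truncated cloaks: inside the unit disc the field of the point
source that satisfies the non-local boundary condition, and zero in the cloak. -/
def limitField (σa la ω : ℝ) (b : ℤ →₀ ℂ) (z : ℂ) : ℂ :=
  if ‖z‖ ≤ 1 then
    totalField (kappa σa la * ω) b (fun n => limitAmp σa la ω n.natAbs) z
  else 0

lemma limitField_inner {σa la ω : ℝ} (b : ℤ →₀ ℂ) {z : ℂ} (hz : ‖z‖ ≤ 1) :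
    limitField σa la ω b z
      = totalField (kappa σa la * ω) b (fun n => limitAmp σa la ω n.natAbs) z := if_pos hz

/-- In the limit the coupling of the interior to the cloak is a relation between the Fourier
coefficients of the trace and of the normal derivative, with the multiplier `|n|`. -/
lemma NonResonant.limitAmp_boundary {σa la ω : ℝ} (hσa : 0 < σa) (hla : 0 < la) (hω : 0 < ω)
    (h : NonResonant σa la ω) (n : ℕ) :
    σa * (limitAmp σa la ω n * modeP chainJ (kappa σa la * ω) n 1
        + modeP chainY (kappa σa la * ω) n 1)
      + n * (limitAmp σa la ω n * modeF chainJ (kappa σa la * ω) n 1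
        + modeF chainY (kappa σa la * ω) n 1) = 0 := by
  have e : limitAmp σa la ω n * limitDet σa la ω n = -(n * modeF chainY (kappa σa la * ω) n 1
      + σa * modeP chainY (kappa σa la * ω) n 1) :=
    div_mul_cancel₀ _ (h.limitDet_ne_zero hσa hla hω n)
  rw [limitDet] at e
  linear_combination e

lemma NonResonant.isLimitSolution {σa la ω : ℝ} (hσa : 0 < σa) (hla : 0 < la) (hω : 0 < ω)
    (h : NonResonant σa la ω) (N : ℕ) (q : ℕ × ℕ → ℂ) :
    IsLimitSolution σa la ω N q
      (limitField σa la ω (sourceField (kappa σa la * ω) N q)) := by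
  have hκ := kappa_pos hσa hla
  have hk := mul_pos hκ hω
  set k := kappa σa la * ω with hkdef
  set b := sourceField k N q
  set A : ℤ → ℂ := fun n => limitAmp σa la ω n.natAbs
  refine ⟨?_, ?_, ?_⟩
  · refine ((contDiffOn_totalField hk b A).mono fun z hz => hz.2).congr fun z hz => ?_
    exact limitField_inner b (mem_closedBall_zero_iff.1 hz.1)
  · obtain ⟨T, h1, h2⟩ := exists_totalField_dist hk (by norm_num : (1 : ℝ) ≤ 3) N q A
    refine ⟨T, h1.congr fun z hz => ?_, ?_⟩
    · exact (limitField_inner b (mem_ball_zero_iff.1 hz.1).le).symm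
    · rw [pointSource, smul_smul, mul_inv_cancel₀ (pow_ne_zero 2 hκ.ne'), one_smul, ← h2, helmholtz,
        hkdef, mul_pow]
  · refine ⟨fun θ => ∑ n ∈ b.support, ((|n| : ℤ) : ℂ)
      * (b n * (A n * modeF chainJ k n.natAbs 1 + modeF chainY k n.natAbs 1)) * circ θ ^ n, ?_,
      fun θ => ?_⟩
    · have e : circleTrace (limitField σa la ω b) = fun θ => ∑ n ∈ b.support,
          b n * (A n * modeF chainJ k n.natAbs 1 + modeF chainY k n.natAbs 1) * circ θ ^ n := by
        funext θ
        have hp : Complex.exp (θ * Complex.I) = pt 1 θ := by rw [pt, Complex.ofReal_one, one_mul, circ]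
        rw [circleTrace, hp, limitField_inner b (norm_pt_of_pos one_pos θ).le,
          totalField_pt b A one_pos]
      rw [e]
      exact hasHalfLaplacian_circ_sum _ _
    · have hd : HasDerivWithinAt (fun r : ℝ => limitField σa la ω b (r * Complex.exp (θ * Complex.I)))
          (∑ n ∈ b.support, b n * (A n * ((modeP chainJ k n.natAbs 1 / 1 : ℝ) : ℂ)
            + ((modeP chainY k n.natAbs 1 / 1 : ℝ) : ℂ)) * circ θ ^ n) (Iic 1) 1 := by
        refine (hasDerivAt_totalField_pt hk b A one_pos θ).hasDerivWithinAt.congr_of_eventuallyEq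
          ?_ ?_
        · filter_upwards [self_mem_nhdsWithin, mem_nhdsWithin_of_mem_nhds (lt_mem_nhds one_pos)]
            with r hr hr0
          exact limitField_inner b ((norm_pt_of_pos hr0 θ).trans_le hr)
        · exact limitField_inner b (norm_pt_of_pos one_pos θ).le
      rw [innerRadialDeriv, hd.derivWithin (uniqueDiffOn_Iic 1 1 self_mem_Iic), Finset.mul_sum,
        ← Finset.sum_add_distrib]
      refine Finset.sum_eq_zero fun n _ => ?_
      have hb := congrArg (Complex.ofReal) (h.limitAmp_boundary hσa hla hω n.natAbs)
      rw [← hkdef] at hb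
      push_cast at hb
      have hn : ((|n| : ℤ) : ℂ) = (n.natAbs : ℂ) := by
        rw [Int.abs_eq_natAbs, Int.cast_natCast]
      rw [hn, div_one, div_one]
      linear_combination (b n * circ θ ^ n) * hb

/-- The fields in the truncated cloaks converge at every point off the origin: inside the unit disc
because the amplitudes of the regular modes converge, outside because the amplitudes of the outer
modes tend to zero. -/
lemma NonResonant.tendsto_cloakField {σa la ω : ℝ} (hσa : 0 < σa) (hla : 0 < la) (hω : 0 < ω)
    (h : NonResonant σa la ω) (b : ℤ →₀ ℂ) (z : ℂ) :
    Tendsto (fun R => cloakField σa la ω R b z) (𝓝[>] 1) (𝓝 (limitField σa la ω b z)) := by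
  rcases le_or_gt ‖z‖ 1 with hz | hz
  · rw [limitField_inner b hz]
    have hlim : Tendsto (fun R => totalField (kappa σa la * ω) b
        (fun n => innerAmp σa la ω R n.natAbs) z) (𝓝[>] 1)
        (𝓝 (totalField (kappa σa la * ω) b (fun n => limitAmp σa la ω n.natAbs) z)) := by
      unfold totalField Finsupp.sum
      exact tendsto_finsetSum _ fun n _ => tendsto_const_nhds.mul
        (((Complex.continuous_ofReal.tendsto _).comp
          (h.tendsto_innerAmp hσa hla hω n.natAbs)).mul_const _ |>.add tendsto_const_nhds)
    refine hlim.congr' ?_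
    filter_upwards [self_mem_nhdsWithin] with R hR
    exact (cloakField_inner b (hz.trans (le_of_lt hR))).symm
  · rw [limitField, if_neg hz.not_ge]
    have hlim : Tendsto (fun R => ∑ n ∈ b.support, b n * ((outerAmp σa la ω R n.natAbs : ℂ)
        * modeFun n (fun r => (outerF ω n.natAbs (flatRadius r) : ℂ)) z)) (𝓝[>] 1)
        (𝓝 (∑ n ∈ b.support, b n * (((0 : ℝ) : ℂ)
          * modeFun n (fun r => (outerF ω n.natAbs (flatRadius r) : ℂ)) z))) :=
      tendsto_finsetSum _ fun n _ => tendsto_const_nhds.mul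
        (((Complex.continuous_ofReal.tendsto _).comp
          (h.tendsto_outerAmp hσa hla hω n.natAbs)).mul_const _)
    simp only [Complex.ofReal_zero, zero_mul, mul_zero, Finset.sum_const_zero] at hlim
    refine hlim.congr' ?_
    filter_upwards [mem_nhdsWithin_of_mem_nhds (gt_mem_nhds hz)] with R hR
    exact (cloakField_outer b hR).symm

end Cloak

end

theorem theorem1 (σa la ω : ℝ) (hσa : 0 < σa) (hla : 0 < la) (hω : 0 < ω)
    (hres : Cloak.NonResonant σa la ω) (N : ℕ) (q : ℕ × ℕ → ℂ) :
    (∀ᶠ R in 𝓝[>] (1 : ℝ), ∃ u : ℂ → ℂ, Cloak.IsCloakSolution σa la ω R N q u ∧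
      ∀ v : ℂ → ℂ, Cloak.IsCloakSolution σa la ω R N q v →
        EqOn v u (Metric.closedBall 0 3 \ {0})) ∧
    ∃ u₁ : ℂ → ℂ,
      (∀ u : ℝ → ℂ → ℂ, (∀ᶠ R in 𝓝[>] (1 : ℝ), Cloak.IsCloakSolution σa la ω R N q (u R)) →
        ∀ᵐ x ∂(volume.restrict (Metric.ball (0 : ℂ) 3)),
          Tendsto (fun R => u R x) (𝓝[>] 1) (𝓝 (u₁ x))) ∧
      Cloak.IsLimitSolution σa la ω N q u₁ ∧
      ∀ x ∈ Metric.ball (0 : ℂ) 2 \ Metric.closedBall 0 1, u₁ x = 0 := by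
  have hwell : ∀ᶠ R in 𝓝[>] (1 : ℝ), 1 < R ∧ R < 2 ∧ ∀ n, Cloak.modeDet σa la ω R n ≠ 0 := by
    filter_upwards [hres.eventually_modeDet_ne_zero hσa hla hω,
      Ioo_mem_nhdsGT (show (1 : ℝ) < 2 by norm_num)] with R h1 h2
    exact ⟨h2.1, h2.2, h1⟩
  refine ⟨?_, Cloak.limitField σa la ω (Cloak.sourceField (Cloak.kappa σa la * ω) N q), ?_,
    hres.isLimitSolution hσa hla hω N q, ?_⟩
  · filter_upwards [hwell] with R ⟨h1, h2, hdet⟩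
    have hsol := Cloak.isCloakSolution_cloakField hσa hla hω h1 h2 hdet N q
    exact ⟨_, hsol, fun v hv => hsol.eqOn hσa hla hω h1 h2 hdet hv⟩
  · intro u hu
    filter_upwards [ae_restrict_mem Metric.isOpen_ball.measurableSet,
      ae_restrict_of_ae (compl_mem_ae_iff.2 (measure_singleton (0 : ℂ)))] with x hx hx0
    refine (hres.tendsto_cloakField hσa hla hω _ x).congr' ?_
    filter_upwards [hwell, hu] with R ⟨h1, h2, hdet⟩ hR
    exact hR.eqOn hσa hla hω h1 h2 hdet
      (Cloak.isCloakSolution_cloakField hσa hla hω h1 h2 hdet N q)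
      ⟨Metric.ball_subset_closedBall hx, hx0⟩
  · intro x hx
    rw [Cloak.limitField, if_neg fun h => hx.2 (mem_closedBall_zero_iff.2 h)]
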